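/- **Setting.** Let $D\ge 0$ and let $\mu$ be a complex Borel measure on the unit torus $\mathbb T^D\subset\mathbb C^D$. For $\alpha\in\mathbb Z^D$ let $|\alpha|=\sum_i|\alpha_i|$ be its longitude, and $[k]=\{\alpha:|\alpha|=k\}$. Matrices indexed by $\mathbb Z^D$ are split into blocks $A_{[k],[l]}$. For $a\in\{\pm1,\dots,\pm D\}$ put $e_a=\operatorname{sgn}(a)\,e_{|a|}$, let $(\Upsilon_\alpha)_{\gamma,\delta}=1$ if $\gamma+\alpha=\delta$ and $0$ otherwise, and write $\Upsilon_a=\Upsilon_{e_a}$. Fix $n_a=(n_{a,b})_b\in\mathbb C^{2D}$ and $q_a\in\mathbb C$, and put $L_{n_a}(z)=\sum_b n_{a,b}z^{e_b}$, $\hat n_{a,b}=\overline{n_{a,-b}}$. For continuous times $t=(t_\alpha)_{\alpha\in\mathbb Z^D}\in\mathbb C^{\mathbb Z^D}$ and discrete times $m=(m_a)_a\in\mathbb Z^{2D}$ put $$v_{t,m}(z)=\exp\Big(\sum_\alpha t_\alpha z^\alpha\Big)\prod_a\big(L_{n_a}(z)-q_a\big)^{m_a},\qquad G(t,m)_{\gamma,\delta}=\int_{\mathbb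 T^D} z^{\gamma-\delta}\,v_{t,m}(z)\,d\mu(z).$$ The factor $v_{t,m}$ is *defined at* $z$ if $\sum_\alpha|t_\alpha z^\alpha|<\infty$ and $L_{n_a}(z)\neq q_a$ whenever $m_a<0$. The pair $(t,m)$ is *admissible* if $v_{t,m}$ is defined at every point of $\mathbb T^D$ and $G(t,m)$ has a Gauss–Borel factorization $G=S^{-1}H(\hat S^{-1})^\dagger$, with $S,\hat S$ block lower triangular with identity diagonal blocks and $H$ block diagonal with nonsingular blocks. Then $S,H,\hat S$ are unique; they are given by truncation (quasi-determinant) formulas, which also give the blocks at nearby times. For $k\ge1$ put $$\beta_{[k]}=S_{[k],[k-1]},\qquad \hat\beta_{[k]}=\hat S_{[k],[k-1]},\qquad \Upsilon_a^{(k)}=(\Upsilon_a)_{[k-1],[k]},\qquad N_a^{(k)}=\sum_b n_{a,b}\Upsilon_b^{(k)},\qquad \hat N_a^{(k)}=\sum_b \hat n_{a,b}\Upsilon_b^{(k)}.$$ Let $\partial_\alpha=\partial/\partial t_\alpha$ and $\bar\partial_\alpha=\partial/\partial\bar t_\alpha$ (Wirtinger derivatives), $\partial_a=\partial_{e_a}$,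 $\partial_{(a,b)}=\partial_{e_a+e_b}$ (so $\partial_{(a,-a)}=\partial/\partial t_0$), and similarly $\bar\partial_{-a}=\partial/\partial\bar t_{-e_a}$, $\bar\partial_{(-a,-b)}=\partial/\partial\bar t_{-e_a-e_b}$. Let $\partial_{n_a}=\sum_b n_{a,b}\partial_b$ and $\bar\partial_{\bar n_a}=\sum_b\hat n_{a,b}\bar\partial_{-b}$. Let $(T_af)(m)=f(m+\epsilon_a)$, with $\epsilon_a$ the $a$-th unit vector of $\mathbb Z^{2D}$, and $\Delta_a=T_a-1$. **Theorem.** Let $(t,m)$ be admissible. The following holds at $(t,m)$. 1. *Regularity.* The entries of every $\beta_{[k]}$ (respectively $\hat\beta_{[k]}$) are, near $t$, holomorphic (respectively antiholomorphic) functions of any finite number of the times $t_\alpha$. 2. *Onsite KP equations.* Let $k\ge1$ and $a,b,c,d\in\{\pm1,\dots,\pm D\}$, and write $\beta=\beta_{[k]}$, $\Upsilon_a=\Upsilon_a^{(k)}$, $X=\partial_a\beta\,\Upsilon_b+\partial_b\beta\,\Upsilon_a$, $Y=\partial_c\beta\,\Upsilon_d+\partial_d\beta\,\Upsilon_c$.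 Then $$\begin{aligned}\partial_{(a,b)}Y-\partial_{(c,d)}X={}&\partial_a\partial_bY-\partial_c\partial_dX\\ &+(\partial_b\partial_c\beta)(\Upsilon_d\beta\Upsilon_a-\Upsilon_a\beta\Upsilon_d)+(\partial_b\partial_d\beta)(\Upsilon_c\beta\Upsilon_a-\Upsilon_a\beta\Upsilon_c)\\ &+(\partial_a\partial_c\beta)(\Upsilon_d\beta\Upsilon_b-\Upsilon_b\beta\Upsilon_d)+(\partial_a\partial_d\beta)(\Upsilon_c\beta\Upsilon_b-\Upsilon_b\beta\Upsilon_c)+[Y,X].\end{aligned}$$ The same equation holds with $\beta_{[k]},\partial_a,\partial_{(a,b)}$ replaced by $\hat\beta_{[k]},\bar\partial_{-a},\bar\partial_{(-a,-b)}$, and likewise for the other indices. These equations involve the single site $k$ only. 3. *Differential-difference equations.* If moreover $(t,m+\epsilon_a)$, $(t,m+\epsilon_c)$ and $(t,m+\epsilon_a+\epsilon_c)$ are admissible, then for every $k\ge1$, with $\beta=\beta_{[k]}$ and $N_a=N_a^{(k)}$, $$\Delta_c\big[\partial_{n_a}\beta+(\Delta_a\beta)(q_a+N_a\beta)\big]N_c=\Delta_a\big[\partial_{n_c}\beta+(\Delta_c\beta)(q_c+N_c\beta)\big]N_a.$$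 The same holds with $\beta_{[k]},\partial_{n_a},q_a,N_a^{(k)}$ replaced by $\hat\beta_{[k]},\bar\partial_{\bar n_a},\bar q_a,\hat N_a^{(k)}$, and likewise for $c$. 4. *Linear systems.* The equations in 2 and 3 arise as the compatibility conditions of the following linear systems. Let $\chi(z)=(z^\alpha)_\alpha$, and define the Baker functions $$\Psi_1=v_{t,m}(z)\,S\chi(z),\qquad \hat\Psi_1=\hat v_{t,m}(z)\,\hat S\chi(z),\qquad \hat\Psi_2=H(\hat S^{-1})^\dagger\chi(z),\qquad \Psi_2=H^\dagger(S^{-1})^\dagger\chi(z),$$ where $\hat v_{t,m}(z)=\exp\big(\sum_\alpha\overline{t_{-\alpha}}z^\alpha\big)\prod_a(L_{\hat n_a}(z)-\bar q_a)^{m_a}$. The functions $\Psi_1$ and $\hat\Psi_1$ are considered at any $z\in(\mathbb C\setminus\{0\})^D$ at which $v_{t,m}$, respectively $\hat v_{t,m}$, is defined; $\hat\Psi_2$ and $\Psi_2$ are formal Laurent series in $z$, differentiated coefficient by coefficient. The components of $\Psi_1,\hat\Psi_2$ are holomorphic, and those of $\hat\Psi_1,\Psi_2$ antiholomorphic, near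 $t$ in any finite number of times. For each $k\ge0$, the block $\Psi_{[k]}$ of $\Psi\in\{\Psi_1,\hat\Psi_2\}$ satisfies, for all $a,b$, $$\partial_{(a,b)}\Psi_{[k]}=\partial_a\partial_b\Psi_{[k]}+(U_{a,b})_{[k]}\Psi_{[k]}\ \ (a+b\ne0),\qquad \Psi_{[k]}=\partial_a\partial_{-a}\Psi_{[k]}+(U_{a,-a})_{[k]}\Psi_{[k]},$$ where $(U_{a,b})_{[k]}=-\partial_a\beta_{[k]}\Upsilon^{(k)}_b-\partial_b\beta_{[k]}\Upsilon^{(k)}_a$ for $k\ge1$ and $(U_{a,b})_{[0]}=0$. If $(t,m+\epsilon_a)$ is admissible, it also satisfies $$(\partial_{n_a}-T_a)\Psi_{[k]}=\big[q_a-(\Delta_a\beta_{[k]})N_a^{(k)}\big]\Psi_{[k]}$$ (for $k=0$ the second term in the bracket is $0$). The blocks of $\Psi\in\{\hat\Psi_1,\Psi_2\}$ satisfy the same systems with $\beta_{[k]},\partial_a,\partial_{(a,b)},\partial_{n_a},q_a,N_a^{(k)}$ replaced by $\hat\beta_{[k]},\bar\partial_{-a},\bar\partial_{(-a,-b)},\bar\partial_{\bar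 n_a},\bar q_a,\hat N_a^{(k)}$. -/

import Mathlib

open MeasureTheory Matrix
open scoped ComplexConjugate

noncomputable section

namespace TorusKP

/-! ### Multi-indices, longitude, semi-infinite matrices -/

/-- Multi-indices in `ℤ^D`; they index the rows and columns of the semi-infinite matrices. -/
abbrev MIdx (D : ℕ) := Fin D → ℤ

/-- The longitude `|α| = ∑ |α_i|`. -/
def longitude {D : ℕ} (α : MIdx D) : ℕ := ∑ i, (α i).natAbs

/-- `[k]`, the multi-indices of longitude `k`. -/
abbrev Level (D k : ℕ) := {α : MIdx D // longitude α = k}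

/-- `[0] ∪ ⋯ ∪ [k-1]`, the multi-indices of longitude less than `k`. -/
abbrev Low (D k : ℕ) := {α : MIdx D // longitude α < k}

lemma finite_longitude_lt (D k : ℕ) : {α : MIdx D | longitude α < k}.Finite := by
  refine (Set.finite_Icc (fun _ : Fin D => -(k : ℤ)) (fun _ => (k : ℤ))).subset ?_
  intro α hα
  have h : ∀ i, (α i).natAbs < k := fun i =>
    lt_of_le_of_lt (Finset.single_le_sum (f := fun i => (α i).natAbs)
      (fun _ _ => Nat.zero_le _) (Finset.mem_univ i)) hα
  exact ⟨fun i => by have := h i; simp only; omega, fun i => by have := h i; simp only; omega⟩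

instance instFiniteLow (D k : ℕ) : Finite (Low D k) := (finite_longitude_lt D k).to_subtype

instance instFiniteLevel (D k : ℕ) : Finite (Level D k) :=
  ((finite_longitude_lt D (k + 1)).subset (fun α (hα : longitude α = k) => by
    show longitude α < k + 1
    omega)).to_subtype

instance instFintypeLow (D k : ℕ) : Fintype (Low D k) := Fintype.ofFinite _

instance instFintypeLevel (D k : ℕ) : Fintype (Level D k) := Fintype.ofFinite _

/-- Semi-infinite matrices, with the block structure given by the longitude. -/
abbrev BMat (D : ℕ) := Matrix (MIdx D) (MIdx D) ℂ

/-- The block `A_{[k],[l]}`. -/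
def block {D : ℕ} (k l : ℕ) (A : BMat D) : Matrix (Level D k) (Level D l) ℂ :=
  A.submatrix Subtype.val Subtype.val

/-- The truncation `A^{[k]}`, made of the blocks `A_{[i],[j]}` with `i, j < k`. -/
def trunc {D : ℕ} (k : ℕ) (A : BMat D) : Matrix (Low D k) (Low D k) ℂ :=
  A.submatrix Subtype.val Subtype.val

/-! ### Gauss–Borel factorization -/

/-- All the principal block minors are nonzero. -/
def QuasiDefinite {D : ℕ} (G : BMat D) : Prop := ∀ k, (trunc k G).det ≠ 0

/-- Block lower triangular with identity diagonal blocks. -/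
def IsLowerUnitriangular {D : ℕ} (S : BMat D) : Prop :=
  ∀ γ δ, longitude γ ≤ longitude δ → S γ δ = if γ = δ then 1 else 0

/-- `G = S⁻¹ H (Ŝ⁻¹)†` with `S`, `Ŝ` block lower unitriangular and `H` block diagonal with
nonsingular blocks. For such factors truncation commutes with products and inverses, so the
factorization is expressed on all truncations. -/
structure IsGaussBorel {D : ℕ} (G S H Sh : BMat D) : Prop where
  lower : IsLowerUnitriangular S
  lower_hat : IsLowerUnitriangular Sh
  diag : ∀ γ δ, longitude γ ≠ longitude δ → H γ δ = 0
  nonsing : ∀ k, (block k k H).det ≠ 0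
  factor : ∀ k, trunc k G = (trunc k S)⁻¹ * trunc k H * ((trunc k Sh)⁻¹)ᴴ

/-- The factor `S` of a quasi-definite `G`: the row of `S` at `γ ∈ [k]` is
`(-G_{γ,<k} (G^{[k]})⁻¹, 1, 0, …)`. -/
def gaussS {D : ℕ} (G : BMat D) : BMat D := fun γ δ =>
  if h : longitude δ < longitude γ then
    -∑ ε : Low D (longitude γ), G γ ε * (trunc (longitude γ) G)⁻¹ ε ⟨δ, h⟩
  else if γ = δ then 1 else 0

/-- The factor `Ŝ` of `G`, which is the factor `S` of `G†`. -/
def gaussSh {D : ℕ} (G : BMat D) : BMat D := gaussS Gᴴ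

/-- The factor `H` of `G`: `H_{[k]} = G_{[k],[k]} - G_{[k],<k} (G^{[k]})⁻¹ G_{<k,[k]}`, the last
quasi-determinant of `G^{[k+1]}`. -/
def gaussH {D : ℕ} (G : BMat D) : BMat D := fun γ δ =>
  if longitude γ = longitude δ then
    G γ δ - ∑ ε : Low D (longitude γ), ∑ ε' : Low D (longitude γ),
      G γ ε * (trunc (longitude γ) G)⁻¹ ε ε' * G ε' δ
  else 0


lemma sum_low {D : ℕ} (n : ℕ) (f : MIdx D → ℂ) :
    ∑ ε : Low D n, f ε = ∑ ε ∈ (finite_longitude_lt D n).toFinset, f ε :=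
  (Finset.sum_subtype _ (fun x => by rw [Set.Finite.mem_toFinset]; rfl) f).symm

lemma gaussS_lower {D : ℕ} (G : BMat D) : IsLowerUnitriangular (gaussS G) := by
  intro γ δ h
  simp [gaussS, not_lt.mpr h]

lemma sum_gaussS_mul {D : ℕ} (G : BMat D) {n : ℕ} (γ : Low D n) (δ : MIdx D) :
    ∑ ε : Low D n, gaussS G γ ε * G ε δ = G γ δ -
      ∑ ε : Low D (longitude γ.1), ∑ ε' : Low D (longitude γ.1),
        G γ ε * (trunc (longitude γ.1) G)⁻¹ ε ε' * G ε' δ := by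
  have key : ∀ ε : MIdx D, gaussS G γ ε * G ε δ =
      (if ε = γ.1 then G ε δ else 0) +
      (if longitude ε < longitude γ.1 then gaussS G γ ε * G ε δ else 0) := by
    intro ε
    by_cases h : longitude ε < longitude γ.1
    · have : ε ≠ γ.1 := by rintro rfl; exact lt_irrefl _ h
      simp [this, h]
    · by_cases h' : ε = γ.1
      · subst h'; simp [gaussS]
      · simp [h, h', gaussS, Ne.symm h']
  rw [sum_low n (fun ε => gaussS G γ ε * G ε δ), Finset.sum_congr rfl (fun ε _ => key ε),
    Finset.sum_add_distrib]
  have h1 : ∑ ε ∈ (finite_longitude_lt D n).toFinset, (if ε = γ.1 then G ε δ else 0) = G γ δ := by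
    rw [Finset.sum_ite_eq', if_pos]
    rw [Set.Finite.mem_toFinset]
    exact γ.2
  have h2 : ∑ ε ∈ (finite_longitude_lt D n).toFinset,
      (if longitude ε < longitude γ.1 then gaussS G γ ε * G ε δ else 0) =
      ∑ ε : Low D (longitude γ.1), gaussS G γ ε * G ε δ := by
    rw [sum_low _ (fun ε => gaussS G γ ε * G ε δ), ← Finset.sum_filter]
    congr 1
    ext ε
    have := γ.2
    simp only [Finset.mem_filter, Set.Finite.mem_toFinset]
    show longitude ε < n ∧ longitude ε < longitude γ.1 ↔ longitude ε < longitude γ.1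
    omega
  rw [h1, h2, sub_eq_add_neg]
  congr 1
  have h3 : ∀ ε' : Low D (longitude γ.1), gaussS G γ ε' * G ε' δ =
      -∑ ε : Low D (longitude γ.1), G γ ε * (trunc (longitude γ.1) G)⁻¹ ε ε' * G ε' δ := by
    intro ε'
    rw [gaussS, dif_pos ε'.2, neg_mul, Finset.sum_mul]
  rw [Finset.sum_congr rfl (fun ε' _ => h3 ε'), Finset.sum_neg_distrib, Finset.sum_comm]

lemma sum_gaussS_mul_of_lt {D : ℕ} {G : BMat D} (hG : QuasiDefinite G) {n : ℕ} (γ : Low D n)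
    (δ : MIdx D) (h : longitude δ < longitude γ.1) :
    ∑ ε : Low D n, gaussS G γ ε * G ε δ = 0 := by
  rw [sum_gaussS_mul, sub_eq_zero]
  have hu : IsUnit (trunc (longitude γ.1) G).det := isUnit_iff_ne_zero.mpr (hG _)
  have h1 := Matrix.nonsing_inv_mul _ hu
  have h2 : ∀ ε : Low D (longitude γ.1),
      ∑ ε' : Low D (longitude γ.1), G γ ε * (trunc (longitude γ.1) G)⁻¹ ε ε' * G ε' δ =
      if ε = ⟨δ, h⟩ then G γ ε else 0 := by
    intro ε
    have := congrFun (congrFun h1 ε) ⟨δ, h⟩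
    rw [Matrix.mul_apply, Matrix.one_apply] at this
    simp only [mul_assoc, ← Finset.mul_sum]
    have e : ∑ ε' : Low D (longitude γ.1), (trunc (longitude γ.1) G)⁻¹ ε ε' * G ε' δ =
      if ε = ⟨δ, h⟩ then 1 else 0 := this
    rw [e]; simp
  rw [Finset.sum_congr rfl (fun ε _ => h2 ε)]
  simp

lemma QuasiDefinite.conjTranspose {D : ℕ} {G : BMat D} (hG : QuasiDefinite G) :
    QuasiDefinite Gᴴ := by
  intro k
  have : trunc k Gᴴ = (trunc k G)ᴴ := rfl
  rw [this, Matrix.det_conjTranspose]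
  exact star_ne_zero.mpr (hG k)

lemma det_trunc_of_lower {D : ℕ} {S : BMat D} (hS : IsLowerUnitriangular S) (k : ℕ) :
    (trunc k S).det = 1 := by
  rw [← Matrix.det_transpose]
  have hT : Matrix.BlockTriangular (trunc k S)ᵀ (fun γ : Low D k => longitude γ.1) := by
    intro γ δ h
    have h' : longitude δ.1 < longitude γ.1 := h
    have hne : δ.1 ≠ γ.1 := by intro e; rw [e] at h'; exact lt_irrefl _ h'
    simp [trunc, hS _ _ h'.le, hne]
  rw [hT.det]
  refine Finset.prod_eq_one fun a _ => ?_
  have : (trunc k S)ᵀ.toSquareBlock (fun γ : Low D k => longitude γ.1) a = 1 := by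
    ext γ δ
    have h1 := γ.2
    have h2 := δ.2
    show S δ.1.1 γ.1.1 = _
    rw [hS _ _ (by omega), Matrix.one_apply]
    simp [Subtype.ext_iff, eq_comm]
  rw [this, Matrix.det_one]

/-- `S G Ŝ† = H` on truncations. -/
lemma gauss_mul {D : ℕ} {G : BMat D} (hG : QuasiDefinite G) (k : ℕ) :
    trunc k (gaussS G) * trunc k G * (trunc k (gaussSh G))ᴴ = trunc k (gaussH G) := by
  ext γ δ
  have lowS : ∀ {A : BMat D} (γ δ : MIdx D), longitude γ ≤ longitude δ →
      gaussS A γ δ = if γ = δ then 1 else 0 := fun {A} γ δ h => gaussS_lower A γ δ h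
  by_cases hlt : longitude γ.1 < longitude δ.1
  · have hz : ∀ ε : Low D k,
        ∑ ε' : Low D k, G ε ε' * star (gaussSh G δ ε') = 0 ∨ longitude δ.1 ≤ longitude ε.1 := by
      intro ε
      by_cases h : longitude ε.1 < longitude δ.1
      · left
        have := congrArg star (sum_gaussS_mul_of_lt hG.conjTranspose δ ε.1 h)
        simpa [gaussSh, star_sum, Matrix.conjTranspose_apply, mul_comm] using this
      · exact Or.inr (not_lt.mp h)
    rw [Matrix.mul_assoc, Matrix.mul_apply]
    have : trunc k (gaussH G) γ δ = 0 := by simp [trunc, gaussH, hlt.ne]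
    rw [this]
    refine Finset.sum_eq_zero fun ε _ => ?_
    rcases hz ε with h | h
    · have : (trunc k G * (trunc k (gaussSh G))ᴴ) ε δ = 0 := by
        rw [Matrix.mul_apply]; exact h
      rw [this, mul_zero]
    · have hne : γ.1 ≠ ε.1 := by intro e; rw [e] at hlt; omega
      have : trunc k (gaussS G) γ ε = 0 := by
        show gaussS G γ ε = 0
        rw [lowS _ _ (by omega), if_neg hne]
      rw [this, zero_mul]
  · rw [not_lt] at hlt
    rw [Matrix.mul_apply]
    have h1 : ∀ ε : Low D k, (trunc k (gaussS G) * trunc k G) γ ε *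
        (trunc k (gaussSh G))ᴴ ε δ =
        if ε = δ then ∑ ε' : Low D k, gaussS G γ ε' * G ε' δ else 0 := by
      intro ε
      have e1 : (trunc k (gaussS G) * trunc k G) γ ε =
          ∑ ε' : Low D k, gaussS G γ ε' * G ε' ε := rfl
      have e2 : (trunc k (gaussSh G))ᴴ ε δ = star (gaussSh G δ ε) := rfl
      rw [e1, e2]
      by_cases h : longitude ε.1 < longitude δ.1
      · have hne : ε ≠ δ := by rintro rfl; exact lt_irrefl _ h
        rw [sum_gaussS_mul_of_lt hG γ ε.1 (by omega), zero_mul, if_neg hne]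
      · rw [gaussSh, lowS _ _ (not_lt.mp h)]
        by_cases h' : ε = δ
        · subst h'; simp
        · have : δ.1 ≠ ε.1 := fun e => h' (Subtype.ext e.symm)
          simp [h', this]
    rw [Finset.sum_congr rfl (fun ε _ => h1 ε), Finset.sum_ite_eq' Finset.univ δ,
      if_pos (Finset.mem_univ _)]
    show _ = gaussH G γ δ
    rcases hlt.lt_or_eq with h | h
    · rw [sum_gaussS_mul_of_lt hG γ δ.1 h, gaussH, if_neg (by omega)]
    · rw [sum_gaussS_mul, gaussH, if_pos h.symm]

/-- The matrices above are the Gauss–Borel factors of a quasi-definite `G`. -/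
theorem isGaussBorel_gauss {D : ℕ} {G : BMat D} (hG : QuasiDefinite G) :
    IsGaussBorel G (gaussS G) (gaussH G) (gaussSh G) := by
  have dS : ∀ k, (trunc k (gaussS G)).det = 1 := det_trunc_of_lower (gaussS_lower G)
  have dSh : ∀ k, (trunc k (gaussSh G)).det = 1 := det_trunc_of_lower (gaussS_lower Gᴴ)
  refine ⟨gaussS_lower G, gaussS_lower Gᴴ, fun γ δ h => by simp [gaussH, h], fun k => ?_,
    fun k => ?_⟩
  · have hd : (trunc (k + 1) (gaussH G)).det ≠ 0 := by
      rw [← gauss_mul hG, Matrix.det_mul, Matrix.det_mul, Matrix.det_conjTranspose, dS, dSh]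
      simpa using hG (k + 1)
    intro h0
    apply hd
    obtain ⟨v, hv, hv0⟩ := Matrix.exists_mulVec_eq_zero_iff.mpr h0
    refine Matrix.exists_mulVec_eq_zero_iff.mp
      ⟨fun δ => if h : longitude δ.1 = k then v ⟨δ.1, h⟩ else 0, ?_, ?_⟩
    · intro hw
      apply hv
      ext δ
      have := congrFun hw ⟨δ.1, by have := δ.2; omega⟩
      simpa [δ.2] using this
    · ext γ
      simp only [Matrix.mulVec, dotProduct, Pi.zero_apply]
      by_cases hγ : longitude γ.1 = k
      · have := congrFun hv0 ⟨γ.1, hγ⟩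
        simp only [Matrix.mulVec, dotProduct, Pi.zero_apply] at this
        refine Eq.trans (Eq.symm ?_) this
        refine Finset.sum_of_injOn
          (fun δ : Level D k => (⟨δ.1, by have := δ.2; omega⟩ : Low D (k + 1)))
          (fun x _ y _ h => Subtype.ext (congrArg (fun z : Low D (k + 1) => z.1) h))
          (fun _ _ => by simp) ?_ ?_
        · intro δ _ h
          have : longitude δ.1 ≠ k := fun e => h ⟨⟨δ.1, e⟩, by simp, rfl⟩
          simp [this]
        · intro δ _
          simp [δ.2, trunc, block]
      · refine Finset.sum_eq_zero fun δ _ => ?_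
        by_cases hδ : longitude δ.1 = k
        · simp [trunc, gaussH, hδ, hγ]
        · simp [hδ]
  · have uS : IsUnit (trunc k (gaussS G)).det := by rw [dS]; exact isUnit_one
    have uSh : IsUnit (trunc k (gaussSh G))ᴴ.det := by
      rw [Matrix.det_conjTranspose, dSh]; simp
    rw [← gauss_mul hG, Matrix.conjTranspose_nonsing_inv, Matrix.mul_assoc (trunc k (gaussS G)),
      Matrix.nonsing_inv_mul_cancel_left _ _ uS, Matrix.mul_nonsing_inv_cancel_right _ _ uSh]

lemma IsGaussBorel.conjTranspose {D : ℕ} {G S H Sh : BMat D} (h : IsGaussBorel G S H Sh) :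
    IsGaussBorel Gᴴ Sh Hᴴ S where
  lower := h.lower_hat
  lower_hat := h.lower
  diag γ δ hne := by simp [Matrix.conjTranspose_apply, h.diag δ γ hne.symm]
  nonsing k := by
    have : block k k Hᴴ = (block k k H)ᴴ := rfl
    rw [this, Matrix.det_conjTranspose]
    exact star_ne_zero.mpr (h.nonsing k)
  factor k := by
    have e1 : trunc k Gᴴ = (trunc k G)ᴴ := rfl
    have e2 : trunc k Hᴴ = (trunc k H)ᴴ := rfl
    rw [e1, e2, h.factor k, Matrix.conjTranspose_mul, Matrix.conjTranspose_mul,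
      Matrix.conjTranspose_conjTranspose, Matrix.mul_assoc]

lemma IsGaussBorel.quasiDefinite {D : ℕ} {G S H Sh : BMat D} (h : IsGaussBorel G S H Sh) :
    QuasiDefinite G := by
  intro k
  have hH : Matrix.BlockTriangular (trunc k H) (fun γ : Low D k => longitude γ.1) := by
    intro γ δ hlt
    have h' : longitude δ.1 < longitude γ.1 := hlt
    exact h.diag γ.1 δ.1 h'.ne'
  rw [h.factor k, Matrix.det_mul, Matrix.det_mul, Matrix.det_conjTranspose,
    Matrix.det_nonsing_inv, Matrix.det_nonsing_inv, det_trunc_of_lower h.lower,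
    det_trunc_of_lower h.lower_hat, hH.det]
  simp only [Ring.inverse_one, one_mul, star_one, mul_one]
  refine Finset.prod_ne_zero_iff.mpr fun a ha => ?_
  obtain ⟨γ, -, hγ⟩ := Finset.mem_image.mp ha
  have hak : a < k := hγ ▸ γ.2
  let e : {γ : Low D k // longitude γ.1 = a} ≃ Level D a :=
    { toFun := fun x => ⟨x.1.1, x.2⟩
      invFun := fun x => ⟨⟨x.1, by have := x.2; omega⟩, x.2⟩
      left_inv := fun _ => rfl
      right_inv := fun _ => rfl }
  have : (trunc k H).toSquareBlock (fun γ : Low D k => longitude γ.1) a =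
      (block a a H).submatrix e e := rfl
  rw [this, Matrix.det_submatrix_equiv_self]
  exact h.nonsing a

lemma IsGaussBorel.left_eq {D : ℕ} {G S H Sh : BMat D} (h : IsGaussBorel G S H Sh) :
    S = gaussS G := by
  have hG := h.quasiDefinite
  ext γ δ
  by_cases hlt : longitude δ < longitude γ
  swap
  · rw [h.lower γ δ (not_lt.mp hlt), gaussS_lower G γ δ (not_lt.mp hlt)]
  have hk : ∀ A : BMat D, IsLowerUnitriangular A →
      (∀ δ' : Low D (longitude γ), ∑ ε : Low D (longitude γ + 1), A γ ε * G ε δ' = 0) →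
      (fun ε : Low D (longitude γ) => A γ ε) ᵥ* trunc (longitude γ) G =
        fun δ' : Low D (longitude γ) => -G γ δ' := by
    intro A hA h0
    ext δ'
    have key : ∀ ε : MIdx D, A γ ε * G ε δ' =
        (if longitude ε < longitude γ then A γ ε * G ε δ' else 0) +
        (if ε = γ then G ε δ' else 0) := by
      intro ε
      by_cases h1 : longitude ε < longitude γ
      · have : ε ≠ γ := by rintro rfl; exact lt_irrefl _ h1
        simp [this, h1]
      · rw [hA γ ε (not_lt.mp h1)]
        by_cases h2 : ε = γ
        · subst h2; simp
        · simp [h1, h2, Ne.symm h2]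
    have h0' := h0 δ'
    rw [sum_low _ (fun ε => A γ ε * G ε δ'), Finset.sum_congr rfl (fun ε _ => key ε),
      Finset.sum_add_distrib, Finset.sum_ite_eq', if_pos, ← Finset.sum_filter] at h0'
    · have hs : (finite_longitude_lt D (longitude γ + 1)).toFinset.filter
          (fun ε => longitude ε < longitude γ) = (finite_longitude_lt D (longitude γ)).toFinset := by
        ext ε
        simp only [Finset.mem_filter, Set.Finite.mem_toFinset]
        show longitude ε < longitude γ + 1 ∧ longitude ε < longitude γ ↔
          longitude ε < longitude γ
        omega
      rw [hs, ← sum_low _ (fun ε => A γ ε * G ε δ')] at h0'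
      exact eq_neg_of_add_eq_zero_left h0'
    · rw [Set.Finite.mem_toFinset]
      exact Nat.lt_succ_self (longitude γ)
  have hS0 : ∀ δ' : Low D (longitude γ),
      ∑ ε : Low D (longitude γ + 1), S γ ε * G ε δ' = 0 := by
    intro δ'
    set n := longitude γ + 1 with hn
    have uS : IsUnit (trunc n S).det := by rw [det_trunc_of_lower h.lower]; exact isUnit_one
    have uSh : IsUnit (trunc n Sh)ᴴ.det := by
      rw [Matrix.det_conjTranspose, det_trunc_of_lower h.lower_hat]; simp
    have hSG : trunc n S * trunc n G = trunc n H * ((trunc n Sh)ᴴ)⁻¹ := by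
      rw [h.factor n, Matrix.mul_assoc, Matrix.mul_nonsing_inv_cancel_left _ _ uS,
        Matrix.conjTranspose_nonsing_inv]
    have b1 : Matrix.BlockTriangular (trunc n H) (fun γ : Low D n => longitude γ.1) := by
      intro γ δ hlt
      have h' : longitude δ.1 < longitude γ.1 := hlt
      exact h.diag γ.1 δ.1 h'.ne'
    have b2 : Matrix.BlockTriangular (trunc n Sh)ᴴ (fun γ : Low D n => longitude γ.1) := by
      intro γ δ hlt
      have h' : longitude δ.1 < longitude γ.1 := hlt
      have hne : δ.1 ≠ γ.1 := by intro e; rw [e] at h'; exact lt_irrefl _ h'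
      simp [trunc, Matrix.conjTranspose_apply, h.lower_hat _ _ h'.le, hne]
    have := Matrix.invertibleOfIsUnitDet _ uSh
    have b3 := b1.mul (Matrix.blockTriangular_inv_of_blockTriangular b2)
    rw [← hSG] at b3
    have hδ := δ'.2
    exact b3 (i := ⟨γ, by omega⟩) (j := ⟨δ'.1, by omega⟩) hδ
  have e1 := hk S h.lower hS0
  have e2 := hk (gaussS G) (gaussS_lower G) (fun δ' =>
    sum_gaussS_mul_of_lt hG ⟨γ, Nat.lt_succ_self _⟩ δ' δ'.2)
  have hu : IsUnit (trunc (longitude γ) G).det := isUnit_iff_ne_zero.mpr (hG _)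
  have e3 := congrArg (fun v => v ᵥ* (trunc (longitude γ) G)⁻¹) (e1.trans e2.symm)
  simp only [Matrix.vecMul_vecMul, Matrix.mul_nonsing_inv _ hu, Matrix.vecMul_one] at e3
  exact congrFun e3 ⟨δ, hlt⟩

/-- The Gauss–Borel factors are unique. -/
theorem IsGaussBorel.unique {D : ℕ} {G S H Sh : BMat D} (h : IsGaussBorel G S H Sh) :
    S = gaussS G ∧ H = gaussH G ∧ Sh = gaussSh G := by
  have hS := h.left_eq
  have hSh : Sh = gaussSh G := h.conjTranspose.left_eq
  refine ⟨hS, ?_, hSh⟩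
  ext γ δ
  obtain ⟨n, h1, h2⟩ : ∃ n, longitude γ < n ∧ longitude δ < n :=
    ⟨longitude γ + longitude δ + 1, by omega, by omega⟩
  have uS : IsUnit (trunc n S).det := by rw [det_trunc_of_lower h.lower]; exact isUnit_one
  have uSh : IsUnit (trunc n Sh)ᴴ.det := by
    rw [Matrix.det_conjTranspose, det_trunc_of_lower h.lower_hat]; simp
  have e := gauss_mul h.quasiDefinite n
  rw [← hS, ← hSh, h.factor n, Matrix.conjTranspose_nonsing_inv, Matrix.mul_assoc (trunc n S)⁻¹,
    Matrix.mul_nonsing_inv_cancel_left _ _ uS, Matrix.nonsing_inv_mul_cancel_right _ _ uSh] at e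
  exact congrFun (congrFun e ⟨γ, h1⟩) ⟨δ, h2⟩

/-! ### Spectral matrices and Laurent monomials -/

/-- The signed indices `{±1, …, ±D}`. -/
abbrev SDir (D : ℕ) := Fin D × ℤˣ

/-- `sgn(a) e_{|a|}`; in particular `unitVec (j, -1) = - unitVec (j, 1)`. -/
def unitVec {D : ℕ} (a : SDir D) : MIdx D := Pi.single a.1 (a.2 : ℤ)

/-- The spectral matrix `Υ_α`, with entries `(Υ_α)_{γ,δ} = 1` if `γ + α = δ`, and `0` otherwise. -/
def upsilon {D : ℕ} (α : MIdx D) : BMat D := fun γ δ => if γ + α = δ then 1 else 0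

/-- `L_n(Υ) = ∑_b n_b Υ_b`. -/
def slash {D : ℕ} (n : SDir D → ℂ) : BMat D := ∑ b, n b • upsilon (unitVec b)

/-- The Laurent monomial `z^α`. -/
def mono {D : ℕ} (z : Fin D → ℂ) (α : MIdx D) : ℂ := ∏ i, z i ^ α i

/-- The Laurent polynomial `L_n(z) = ∑_b n_b z^{±e_{|b|}}`. -/
def laurent {D : ℕ} (n : SDir D → ℂ) (z : Fin D → ℂ) : ℂ := ∑ b, n b * mono z (unitVec b)

/-! ### The deformed measure and its moment matrix -/

/-- The unit torus in `ℂ^D`. -/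
abbrev UnitTorus (D : ℕ) := {z : Fin D → ℂ // ∀ i, ‖z i‖ = 1}

/-- Continuous times `t = (t_α)`, `α ∈ ℤ^D`. -/
abbrev Times (D : ℕ) := MIdx D → ℂ

/-- Discrete times `m`; there are `2D` discrete directions. -/
abbrev Disc (D : ℕ) := SDir D → ℤ

/-- The factor `exp(∑ t_α z^α) ∏_a (L_{n_a}(z) - q_a)^{m_a}` of the deformed measure. -/
def vacuum {D : ℕ} (n : SDir D → SDir D → ℂ) (q : SDir D → ℂ) (t : Times D) (m : Disc D)
    (z : Fin D → ℂ) : ℂ :=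
  Complex.exp (∑' α, t α * mono z α) * ∏ a, (laurent (n a) z - q a) ^ m a

/-- The deformation factor makes sense at `z`: the series converges absolutely and there is no
division by zero. -/
structure VacuumDefined {D : ℕ} (n : SDir D → SDir D → ℂ) (q : SDir D → ℂ) (t : Times D)
    (m : Disc D) (z : Fin D → ℂ) : Prop where
  summable : Summable fun α => ‖t α * mono z α‖
  ne_zero : ∀ a, m a < 0 → laurent (n a) z ≠ q a

/-- The moment matrix `G(t, m)` of the deformed measure; its `(γ, δ)` entry is
`∫ z^{γ-δ} exp(t(z)) ∏_a (L_{n_a}(z) - q_a)^{m_a} dμ(z)`. -/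
def moment {D : ℕ} (μ : ComplexMeasure (UnitTorus D)) (n : SDir D → SDir D → ℂ) (q : SDir D → ℂ)
    (t : Times D) (m : Disc D) : BMat D := fun γ δ =>
  VectorMeasure.integral μ (fun z : UnitTorus D => vacuum n q t m z.1 * mono z.1 (γ - δ))
    (ContinuousLinearMap.mul ℝ ℂ)

/-- `(t, m)` is admissible: the deformed measure is defined and its moment matrix has a
Gauss–Borel factorization. -/
def Admissible {D : ℕ} (μ : ComplexMeasure (UnitTorus D)) (n : SDir D → SDir D → ℂ)
    (q : SDir D → ℂ) (t : Times D) (m : Disc D) : Prop :=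
  (∀ z : UnitTorus D, VacuumDefined n q t m z.1) ∧
    ∃ S H Sh : BMat D, IsGaussBorel (moment μ n q t m) S H Sh

/-! ### Derivatives with respect to the times -/

/-- The Wirtinger derivative `∂/∂t_α = (∂/∂x - i ∂/∂y) / 2`, `t_α = x + i y`. -/
def dT {D : ℕ} (α : MIdx D) (f : Times D → ℂ) (t : Times D) : ℂ :=
  (deriv (fun x : ℝ => f (t + Pi.single α (x : ℂ))) 0 -
    Complex.I * deriv (fun y : ℝ => f (t + Pi.single α (y * Complex.I))) 0) / 2

/-- The Wirtinger derivative `∂/∂t̄_α = (∂/∂x + i ∂/∂y) / 2`, `t_α = x + i y`. -/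
def dTbar {D : ℕ} (α : MIdx D) (f : Times D → ℂ) (t : Times D) : ℂ :=
  (deriv (fun x : ℝ => f (t + Pi.single α (x : ℂ))) 0 +
    Complex.I * deriv (fun y : ℝ => f (t + Pi.single α (y * Complex.I))) 0) / 2

/-- `∂/∂t̄_{-α}`. -/
def dTbarNeg {D : ℕ} (α : MIdx D) (f : Times D → ℂ) (t : Times D) : ℂ := dTbar (-α) f t

/-- Entrywise action of a derivation on matrix functions. -/
def mderiv {D : ℕ} {ι κ : Type} (dd : MIdx D → (Times D → ℂ) → Times D → ℂ) (α : MIdx D)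
    (F : Times D → Matrix ι κ ℂ) (t : Times D) : Matrix ι κ ℂ :=
  fun i j => dd α (fun s => F s i j) t

/-- `f` is holomorphic near `t` as a function of any finite number of times. -/
def HolAt {D : ℕ} (f : Times D → ℂ) (t : Times D) : Prop :=
  ∀ (N : ℕ) (v : Fin N → MIdx D),
    AnalyticAt ℂ (fun s : Fin N → ℂ => f (t + ∑ j, Pi.single (v j) (s j))) 0

/-- `f` is antiholomorphic near `t` as a function of any finite number of times. -/
def AntiHolAt {D : ℕ} (f : Times D → ℂ) (t : Times D) : Prop := HolAt (fun s => conj (f s)) t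

/-! ### The equations

They are written for a derivation `dd` and a first subdiagonal `β`. The equations for the unhatted
objects have `dd α = ∂/∂t_α`, and those for the hatted ones have `dd α = ∂/∂t̄_{-α}`, `β̂` in place
of `β`, and `n̂_{a,b} = conj n_{a,-b}`, `conj q_a` in place of `n_{a,b}`, `q_a`. -/

/-- `n̂_{a,b} = conj n_{a,-b}`, so that `L_{n̂_a}(Υ) = L_{n_a}(Υ)†`. -/
def nHat {D : ℕ} (n : SDir D → SDir D → ℂ) : SDir D → SDir D → ℂ :=
  fun a b => conj (n a (b.1, -b.2))

def qHat {D : ℕ} (q : SDir D → ℂ) : SDir D → ℂ := fun a => conj (q a)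

/-- The times `conj t_{-α}`, so that `(exp ∑ t_α Υ_α)† = exp ∑ conj t_{-α} Υ_α`. -/
def tHat {D : ℕ} (t : Times D) : Times D := fun α => conj (t (-α))

/-- `(Υ_a)_{[k],[k+1]}`. -/
def up {D : ℕ} (k : ℕ) (a : SDir D) : Matrix (Level D k) (Level D (k + 1)) ℂ :=
  block k (k + 1) (upsilon (unitVec a))

/-- The onsite KP equation for a matrix `β` of size `[k+1] × [k]`. -/
def KPEquation {D : ℕ} (dd : MIdx D → (Times D → ℂ) → Times D → ℂ) (k : ℕ)
    (β : Times D → Matrix (Level D (k + 1)) (Level D k) ℂ) (a b c d : SDir D)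
    (t : Times D) : Prop :=
  let X : Times D → Matrix (Level D (k + 1)) (Level D (k + 1)) ℂ := fun s =>
    mderiv dd (unitVec a) β s * up k b + mderiv dd (unitVec b) β s * up k a
  let Y : Times D → Matrix (Level D (k + 1)) (Level D (k + 1)) ℂ := fun s =>
    mderiv dd (unitVec c) β s * up k d + mderiv dd (unitVec d) β s * up k c
  mderiv dd (unitVec a + unitVec b) Y t - mderiv dd (unitVec c + unitVec d) X t =
    mderiv dd (unitVec a) (mderiv dd (unitVec b) Y) t
      - mderiv dd (unitVec c) (mderiv dd (unitVec d) X) t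
      + mderiv dd (unitVec b) (mderiv dd (unitVec c) β) t *
          (up k d * β t * up k a - up k a * β t * up k d)
      + mderiv dd (unitVec b) (mderiv dd (unitVec d) β) t *
          (up k c * β t * up k a - up k a * β t * up k c)
      + mderiv dd (unitVec a) (mderiv dd (unitVec c) β) t *
          (up k d * β t * up k b - up k b * β t * up k d)
      + mderiv dd (unitVec a) (mderiv dd (unitVec d) β) t *
          (up k c * β t * up k b - up k b * β t * up k c)
      + (Y t * X t - X t * Y t)

/-- The onsite differential-difference equation for a matrix `β` of size `[k+1] × [k]`:
`Δ_c [∂_{n_a} β + (Δ_a β)(q_a + N_a β)] N_c = Δ_a [∂_{n_c} β + (Δ_c β)(q_c + N_c β)] N_a`, where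
`N_a = L_{n_a}(Υ)_{[k],[k+1]}`, `∂_{n_a} = ∑_b n_{a,b} dd_b` and `Δ_a f(m) = f(m + e_a) - f(m)`. -/
def DiffDiffEquation {D : ℕ} (dd : MIdx D → (Times D → ℂ) → Times D → ℂ)
    (n : SDir D → SDir D → ℂ) (q : SDir D → ℂ) (k : ℕ)
    (β : Times D → Disc D → Matrix (Level D (k + 1)) (Level D k) ℂ) (a c : SDir D)
    (t : Times D) (m : Disc D) : Prop :=
  let N : SDir D → Matrix (Level D k) (Level D (k + 1)) ℂ := fun a => block k (k + 1) (slash (n a))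
  let Δ : SDir D → (Disc D → Matrix (Level D (k + 1)) (Level D k) ℂ) →
      Disc D → Matrix (Level D (k + 1)) (Level D k) ℂ := fun a F m => F (m + Pi.single a 1) - F m
  let F : SDir D → Disc D → Matrix (Level D (k + 1)) (Level D k) ℂ := fun a m =>
    (∑ b, n a b • mderiv dd (unitVec b) (fun s => β s m) t)
      + Δ a (β t) m * (q a • (1 : Matrix (Level D k) (Level D k) ℂ) + N a * β t m)
  Δ c (F a) m * N c = Δ a (F c) m * N a

/-- The `k`-th diagonal block of `U_{a,b} = - (∂_a β) (Υ_b)_> - (∂_b β) (Υ_a)_>`, where `β` is the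
first subdiagonal of `S`. -/
def potential {D : ℕ} (dd : MIdx D → (Times D → ℂ) → Times D → ℂ) (S : Times D → BMat D)
    (a b : SDir D) (t : Times D) : (k : ℕ) → Matrix (Level D k) (Level D k) ℂ
  | 0 => 0
  | k + 1 => -(mderiv dd (unitVec a) (fun s => block (k + 1) k (S s)) t * up k b)
      - mderiv dd (unitVec b) (fun s => block (k + 1) k (S s)) t * up k a

/-- `∂_{(a,b)} Ψ = ∂_a ∂_b Ψ + U_{a,b} Ψ` if `a + b ≠ 0`, and `Ψ = ∂_a ∂_{-a} Ψ + U_{a,-a} Ψ`, for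
the `k`-th block `Ψ` of a Baker function. -/
def SchrodingerSystem {D : ℕ} (dd : MIdx D → (Times D → ℂ) → Times D → ℂ) (S : Times D → BMat D)
    (k : ℕ) (Ψ : Times D → Level D k → ℂ) (t : Times D) : Prop :=
  ∀ (a b : SDir D) (γ : Level D k),
    (unitVec a + unitVec b ≠ 0 →
      dd (unitVec a + unitVec b) (fun s => Ψ s γ) t =
        dd (unitVec a) (dd (unitVec b) (fun s => Ψ s γ)) t
          + (potential dd S a b t k *ᵥ Ψ t) γ) ∧
    (unitVec a + unitVec b = 0 →
      Ψ t γ = dd (unitVec a) (dd (unitVec b) (fun s => Ψ s γ)) t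
          + (potential dd S a b t k *ᵥ Ψ t) γ)

/-- The `k`-th diagonal block of `(Δ_a β) (L_{n_a}(Υ))_>`, where `β` is the first subdiagonal
of `S`. -/
def diffPotential {D : ℕ} (n : SDir D → SDir D → ℂ) (S : Disc D → BMat D) (a : SDir D)
    (m : Disc D) : (k : ℕ) → Matrix (Level D k) (Level D k) ℂ
  | 0 => 0
  | k + 1 => (block (k + 1) k (S (m + Pi.single a 1)) - block (k + 1) k (S m)) *
      block k (k + 1) (slash (n a))

/-- `(∂_{n_a} - T_a) Ψ = [q_a - (Δ_a β) (L_{n_a}(Υ))_>] Ψ`, for the `k`-th block `Ψ` of a Baker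
function. -/
def DifferenceSystem {D : ℕ} (dd : MIdx D → (Times D → ℂ) → Times D → ℂ)
    (n : SDir D → SDir D → ℂ) (q : SDir D → ℂ) (S : Times D → Disc D → BMat D) (k : ℕ)
    (Ψ : Times D → Disc D → Level D k → ℂ) (a : SDir D) (t : Times D) (m : Disc D) : Prop :=
  ∀ γ : Level D k,
    ∑ b, n a b * dd (unitVec b) (fun s => Ψ s m γ) t - Ψ t (m + Pi.single a 1) γ =
      q a * Ψ t m γ - (diffPotential n (S t) a m k *ᵥ Ψ t m) γ

/-! ### Baker functions -/

/-- `(S χ(z))_γ`, the biorthogonal Laurent polynomial attached to `γ`. -/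
def lop {D : ℕ} (S : BMat D) (z : Fin D → ℂ) (γ : MIdx D) : ℂ :=
  ∑ δ : Low D (longitude γ + 1), S γ δ * mono z δ

/-- The matrix `H (Ŝ⁻¹)†`. -/
def waveTwo {D : ℕ} (H Sh : BMat D) : BMat D := fun γ δ =>
  (trunc (longitude γ + longitude δ + 1) H * ((trunc (longitude γ + longitude δ + 1) Sh)⁻¹)ᴴ)
    ⟨γ, by omega⟩ ⟨δ, by omega⟩

section Factors

variable {D : ℕ} (μ : ComplexMeasure (UnitTorus D)) (n : SDir D → SDir D → ℂ) (q : SDir D → ℂ)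

/-- The Gauss–Borel factors of `G(t, m)`. -/
def facS (t : Times D) (m : Disc D) : BMat D := gaussS (moment μ n q t m)

def facSh (t : Times D) (m : Disc D) : BMat D := gaussSh (moment μ n q t m)

def facH (t : Times D) (m : Disc D) : BMat D := gaussH (moment μ n q t m)

/-- `β_{[k+1]} = S_{[k+1],[k]}`. -/
def beta (k : ℕ) (t : Times D) (m : Disc D) : Matrix (Level D (k + 1)) (Level D k) ℂ :=
  block (k + 1) k (facS μ n q t m)

/-- `β̂_{[k+1]} = Ŝ_{[k+1],[k]}`. -/
def betaHat (k : ℕ) (t : Times D) (m : Disc D) : Matrix (Level D (k + 1)) (Level D k) ℂ :=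
  block (k + 1) k (facSh μ n q t m)

/-- The `k`-th block of the Baker function `Ψ₁ = S W₀ χ(z)`. -/
def Psi1 (z : Fin D → ℂ) (k : ℕ) (t : Times D) (m : Disc D) (γ : Level D k) : ℂ :=
  vacuum n q t m z * lop (facS μ n q t m) z γ

/-- The `k`-th block of the Baker function `Ψ̂₁ = Ŝ W₀† χ(z)`. -/
def Psi1Hat (z : Fin D → ℂ) (k : ℕ) (t : Times D) (m : Disc D) (γ : Level D k) : ℂ :=
  vacuum (nHat n) (qHat q) (tHat t) m z * lop (facSh μ n q t m) z γ

/-- The coefficient of `z^δ` in the `k`-th block of the Baker function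
`Ψ̂₂ = Ŵ₂ χ(z)`, `Ŵ₂ = H (Ŝ⁻¹)†`. -/
def Psi2Hat (δ : MIdx D) (k : ℕ) (t : Times D) (m : Disc D) (γ : Level D k) : ℂ :=
  waveTwo (facH μ n q t m) (facSh μ n q t m) γ δ

/-- The coefficient of `z^δ` in the `k`-th block of the Baker function
`Ψ₂ = W₂ χ(z)`, `W₂ = H† (S⁻¹)†`. -/
def Psi2 (δ : MIdx D) (k : ℕ) (t : Times D) (m : Disc D) (γ : Level D k) : ℂ :=
  waveTwo (facH μ n q t m)ᴴ (facS μ n q t m) γ δ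

end Factors

end TorusKP

end

open TorusKP

/-! The block row `Z` of `S` at level `k` is determined by two properties. Its entries at longitude
at least `k` are those of the identity, and it annihilates every column of `G` of longitude less
than `k`. Uniqueness is `eq_zero_of_pairing`: a row supported in longitude less than `k` and
annihilating those columns vanishes, because the truncation of `G` is nonsingular.

The columns of `G` are waves: `∂_α` takes the entry at `ε` to the entry at `ε + α`, and a discrete
step applies `L_{n_a} - q_a` in the same way. The functions `v(z) z^ε` are waves too. For any wave
`Φ`, differentiating `∑ F_ε Φ_ε` amounts to replacing the row `F` by `nabla α F`, which does not
involve `Φ`. An identity between rows therefore gives a linear equation for every wave.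

Such identities come from orthogonality. The pairings of `Z` with low columns vanish identically in
the times, so `nabla` derivatives of `Z` annihilate these columns as well. In `nabla_{a+b} Z -
nabla_a nabla_b Z` the doubly shifted terms cancel at high longitudes. What survives there is
concentrated at longitude `k` and is exactly the potential, so subtracting `U Z` leaves a row that
must vanish (`MomentFamily.nabla_nabla`). The same argument with a discrete step gives
`nablaDir_blockRow`. Pairing with `v(z) z^ε` yields the systems for `Ψ₁`; pairing with an arbitrary
column of `G` yields those for the coefficients of `Ψ̂₂`, because `H (Ŝ⁻¹)† = S G`
(`waveTwo_eq_pairing`).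

The operators `nabla` commute. Computing a mixed derivative of `Z` from two linear systems in the
two possible orders (`compatibility`, `diffDiff`) gives an identity of rows, whose columns of
longitude `k + 1`, for `Z` at level `k + 1`, are the nonlinear equations. Only one block row enters,
so only one site does.

On the analytic side, a finite change of the times multiplies the integrand by an exponential in the
Banach algebra of continuous functions on the torus, to which a bounded functional is applied; the
moments are therefore holomorphic (`waveAt_genMoment`). No topology on the infinitely many times is
needed: openness along finite-dimensional slices suffices, and for a given level only finitely many
truncations must be nonsingular.

The hatted half follows by conjugation. `G†` is the moment matrix of the conjugate functional with
data `n̂`, `q̂`, `t̂`, the factor `Ŝ` of `G` is the factor `S` of `G†`, and `t ↦ t̂` turns `∂/∂t_α`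
into `∂/∂t̄_{-α}`. This is why the main argument is written for functionals rather than for
measures. -/

noncomputable section

namespace TorusKP

open Filter Topology

variable {D : ℕ}

/-! ### Holomorphic functions of the times -/

/-- The shift of the times by `s j` in the direction `v j`, for all `j`. -/
def slice {N : ℕ} (v : Fin N → MIdx D) (s : Fin N → ℂ) : Times D := ∑ j, Pi.single (v j) (s j)

lemma slice_add {N : ℕ} (v : Fin N → MIdx D) (r s : Fin N → ℂ) :
    slice v (r + s) = slice v r + slice v s := by
  simp [slice, Pi.single_add, Finset.sum_add_distrib]

lemma slice_zero {N : ℕ} (v : Fin N → MIdx D) : slice v 0 = 0 := by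
  simp [slice]

lemma slice_single {N : ℕ} (v : Fin N → MIdx D) (i : Fin N) (x : ℂ) :
    slice v (Pi.single i x) = Pi.single (v i) x := by
  rw [slice, Finset.sum_eq_single i]
  · simp
  · intro j _ hj; simp [hj]
  · simp

lemma slice_cons {N : ℕ} (α : MIdx D) (v : Fin N → MIdx D) (x : ℂ) (r : Fin N → ℂ) :
    slice (Fin.cons α v : Fin (N + 1) → MIdx D) (Fin.cons x r) = Pi.single α x + slice v r := by
  simp [slice, Fin.sum_univ_succ]

lemma HolAt.analyticAt {f : Times D → ℂ} {t : Times D} (h : HolAt f t) {N : ℕ}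
    (v : Fin N → MIdx D) : AnalyticAt ℂ (fun s => f (t + slice v s)) 0 := h N v

/-- By the chain rule the derivative along the imaginary axis is `i f'`, and `(f' - i · i f') / 2 =
f'`. -/
lemma dT_eq_of_hasDerivAt {f : Times D → ℂ} {t : Times D} {α : MIdx D} {f' : ℂ}
    (h : HasDerivAt (fun x : ℂ => f (t + Pi.single α x)) f' 0) : dT α f t = f' := by
  have h1 : HasDerivAt (fun x : ℝ => f (t + Pi.single α (x : ℂ))) f' 0 :=
    HasDerivAt.comp_ofReal (z := 0) (by simpa using h)
  have h2 : HasDerivAt (fun y : ℝ => f (t + Pi.single α (y * Complex.I))) (f' * Complex.I) 0 := by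
    have h3 : HasDerivAt (fun y : ℂ => f (t + Pi.single α (y * Complex.I))) (f' * Complex.I) 0 := by
      have h4 : HasDerivAt (fun y : ℂ => y * Complex.I) Complex.I 0 := by
        simpa using (hasDerivAt_id (0 : ℂ)).mul_const Complex.I
      exact HasDerivAt.comp (0 : ℂ) (h₂ := fun x : ℂ => f (t + Pi.single α x)) (by simpa using h) h4
    exact HasDerivAt.comp_ofReal (z := 0) (by simpa using h3)
  rw [dT, h1.deriv, h2.deriv]
  linear_combination (-f' / 2) * Complex.I_mul_I

/-- The base point `r` is arbitrary, not just the origin, so the formula can itself be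
differentiated along the slice. -/
lemma dT_slice {f : Times D → ℂ} {t : Times D} {N : ℕ} (v : Fin N → MIdx D) (i : Fin N)
    {r : Fin N → ℂ} (h : DifferentiableAt ℂ (fun s => f (t + slice v s)) r) :
    dT (v i) f (t + slice v r) = fderiv ℂ (fun s => f (t + slice v s)) r (Pi.single i 1) := by
  apply dT_eq_of_hasDerivAt
  have h1 : HasDerivAt (fun x : ℂ => r + x • (Pi.single i 1 : Fin N → ℂ)) (Pi.single i 1) 0 := by
    simpa using ((hasDerivAt_id (0 : ℂ)).smul_const (Pi.single i 1 : Fin N → ℂ)).const_add r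
  have h2 : HasFDerivAt (fun s => f (t + slice v s)) (fderiv ℂ (fun s => f (t + slice v s)) r)
      (r + (0 : ℂ) • (Pi.single i 1 : Fin N → ℂ)) := by simpa using h.hasFDerivAt
  have h3 := h2.comp_hasDerivAt (0 : ℂ) h1
  refine h3.congr_of_eventuallyEq (Eventually.of_forall fun x => ?_)
  simp only [Function.comp]
  congr 1
  rw [slice_add, ← Pi.single_smul, smul_eq_mul, mul_one, slice_single, add_assoc]

lemma HolAt.hasDerivAt {f : Times D → ℂ} {t : Times D} (h : HolAt f t) (α : MIdx D) :
    HasDerivAt (fun x : ℂ => f (t + Pi.single α x)) (dT α f t) 0 := by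
  have h1 : AnalyticAt ℂ (fun x : ℂ => f (t + Pi.single α x)) 0 := by
    have h2 := h.analyticAt (fun _ : Fin 1 => α)
    have h3 : AnalyticAt ℂ (fun x : ℂ => (fun _ : Fin 1 => x)) 0 := by
      rw [analyticAt_pi_iff]; exact fun _ => analyticAt_id
    have h4 := AnalyticAt.comp (f := fun x : ℂ => (fun _ : Fin 1 => x)) (x := 0) h2 h3
    refine h4.congr (Eventually.of_forall fun x => ?_)
    simp [slice]
  have := h1.differentiableAt.hasDerivAt
  rwa [← dT_eq_of_hasDerivAt this] at this

lemma HolAt.const (c : ℂ) (t : Times D) : HolAt (fun _ => c) t := fun _ _ => analyticAt_const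

lemma HolAt.add {f g : Times D → ℂ} {t : Times D} (hf : HolAt f t) (hg : HolAt g t) :
    HolAt (fun s => f s + g s) t := fun N v => (hf N v).add (hg N v)

lemma HolAt.sub {f g : Times D → ℂ} {t : Times D} (hf : HolAt f t) (hg : HolAt g t) :
    HolAt (fun s => f s - g s) t := fun N v => (hf N v).sub (hg N v)

lemma HolAt.neg {f : Times D → ℂ} {t : Times D} (hf : HolAt f t) :
    HolAt (fun s => -f s) t := fun N v => (hf N v).neg

lemma HolAt.mul {f g : Times D → ℂ} {t : Times D} (hf : HolAt f t) (hg : HolAt g t) :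
    HolAt (fun s => f s * g s) t := fun N v => (hf N v).mul (hg N v)

lemma HolAt.inv {f : Times D → ℂ} {t : Times D} (hf : HolAt f t) (h0 : f t ≠ 0) :
    HolAt (fun s => (f s)⁻¹) t := fun N v => (hf N v).inv (by simpa using h0)

lemma HolAt.sum {ι : Type*} {f : ι → Times D → ℂ} {t : Times D} (S : Finset ι)
    (hf : ∀ i ∈ S, HolAt (f i) t) : HolAt (fun s => ∑ i ∈ S, f i s) t := fun N v => by
  exact Finset.analyticAt_fun_sum S fun i hi => hf i hi N v

lemma HolAt.prod {ι : Type*} {f : ι → Times D → ℂ} {t : Times D} (S : Finset ι)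
    (hf : ∀ i ∈ S, HolAt (f i) t) : HolAt (fun s => ∏ i ∈ S, f i s) t := fun N v => by
  exact Finset.analyticAt_fun_prod S fun i hi => hf i hi N v

lemma HolAt.det {ι : Type*} [Fintype ι] [DecidableEq ι] {A : Times D → Matrix ι ι ℂ}
    {t : Times D} (hA : ∀ i j, HolAt (fun s => A s i j) t) : HolAt (fun s => (A s).det) t := by
  simp only [Matrix.det_apply']
  exact HolAt.sum _ fun σ _ => (HolAt.const _ t).mul (HolAt.prod _ fun i _ => hA _ _)

/-- By Cramer's rule the entries are quotients of determinants. -/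
lemma HolAt.matrix_inv {ι : Type*} [Fintype ι] [DecidableEq ι] {A : Times D → Matrix ι ι ℂ}
    {t : Times D} (hA : ∀ i j, HolAt (fun s => A s i j) t) (h0 : (A t).det ≠ 0) (i j : ι) :
    HolAt (fun s => (A s)⁻¹ i j) t := by
  simp only [Matrix.inv_def, Ring.inverse_eq_inv', Matrix.smul_apply, smul_eq_mul,
    Matrix.adjugate_apply]
  refine ((HolAt.det hA).inv h0).mul (HolAt.det fun k l => ?_)
  by_cases h : k = j
  · subst h; simpa using HolAt.const _ t
  · simpa [Matrix.updateRow_ne h] using hA k l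

lemma dT_const (α : MIdx D) (c : ℂ) (t : Times D) : dT α (fun _ => c) t = 0 := by
  simp [dT]

lemma dT_add {f g : Times D → ℂ} {t : Times D} (α : MIdx D) (hf : HolAt f t) (hg : HolAt g t) :
    dT α (fun s => f s + g s) t = dT α f t + dT α g t :=
  dT_eq_of_hasDerivAt ((hf.hasDerivAt α).add (hg.hasDerivAt α))

lemma dT_sub {f g : Times D → ℂ} {t : Times D} (α : MIdx D) (hf : HolAt f t) (hg : HolAt g t) :
    dT α (fun s => f s - g s) t = dT α f t - dT α g t :=
  dT_eq_of_hasDerivAt ((hf.hasDerivAt α).sub (hg.hasDerivAt α))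

lemma dT_neg {f : Times D → ℂ} {t : Times D} (α : MIdx D) (hf : HolAt f t) :
    dT α (fun s => -f s) t = -dT α f t :=
  dT_eq_of_hasDerivAt (hf.hasDerivAt α).neg

lemma dT_mul {f g : Times D → ℂ} {t : Times D} (α : MIdx D) (hf : HolAt f t) (hg : HolAt g t) :
    dT α (fun s => f s * g s) t = dT α f t * g t + f t * dT α g t := by
  apply dT_eq_of_hasDerivAt
  have h := (hf.hasDerivAt α).mul (hg.hasDerivAt α)
  simp only [Pi.single_zero, add_zero] at h
  exact h

lemma dT_sum {ι : Type*} {f : ι → Times D → ℂ} {t : Times D} (α : MIdx D) (S : Finset ι)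
    (hf : ∀ i ∈ S, HolAt (f i) t) :
    dT α (fun s => ∑ i ∈ S, f i s) t = ∑ i ∈ S, dT α (f i) t :=
  dT_eq_of_hasDerivAt (HasDerivAt.fun_sum fun i hi => (hf i hi).hasDerivAt α)

lemma dT_const_mul {f : Times D → ℂ} {t : Times D} (α : MIdx D) (c : ℂ) (hf : HolAt f t) :
    dT α (fun s => c * f s) t = c * dT α f t := by
  rw [dT_mul α (HolAt.const c t) hf, dT_const, zero_mul, zero_add]

/-- On the slice through `v`, `dT α f` is a partial derivative of `f` on the slice enlarged by the
direction `α`, restricted to where the new coordinate is zero. Partial derivatives of analytic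
functions are analytic. -/
lemma HolAt.dT {f : Times D → ℂ} {t : Times D} (hf : HolAt f t) (α : MIdx D) :
    HolAt (dT α f) t := by
  intro N v
  set w : Fin (N + 1) → MIdx D := Fin.cons α v with hw
  have hF := hf.analyticAt w
  set L : (Fin N → ℂ) → (Fin (N + 1) → ℂ) := fun r => Fin.cons 0 r with hL
  have hLa : AnalyticAt ℂ L 0 := by
    rw [analyticAt_pi_iff]
    intro i
    refine Fin.cases ?_ (fun j => ?_) i
    · exact analyticAt_const
    · exact (ContinuousLinearMap.proj (R := ℂ) (φ := fun _ : Fin N => ℂ) j).analyticAt 0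
  have hL0 : L 0 = 0 := by
    ext i; refine Fin.cases ?_ (fun j => ?_) i <;> simp [hL]
  have hwL : ∀ r, slice w (L r) = slice v r := fun r => by simp [hw, hL, slice_cons]
  have h1 : AnalyticAt ℂ (fun r => fderiv ℂ (fun s => f (t + slice w s)) (L r)
      (Pi.single 0 1)) 0 := by
    have h2 : AnalyticAt ℂ (fderiv ℂ (fun s => f (t + slice w s))) (L 0) := by
      rw [hL0]; exact hF.fderiv
    exact ((ContinuousLinearMap.apply ℂ ℂ (Pi.single 0 1 : Fin (N + 1) → ℂ)).analyticAt _).comp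
      (h2.comp hLa)
  refine h1.congr ?_
  have h3 : ∀ᶠ r in 𝓝 (0 : Fin N → ℂ), AnalyticAt ℂ (fun s => f (t + slice w s)) (L r) := by
    have := hF.eventually_analyticAt
    rw [← hL0] at this
    exact hLa.continuousAt.eventually this
  filter_upwards [h3] with r hr
  have := dT_slice w 0 hr.differentiableAt
  rw [hwL] at this
  exact this.symm

/-- Symmetry of the second derivative of an analytic function, on the two-dimensional slice through
`α` and `β`. -/
lemma dT_comm {f : Times D → ℂ} {t : Times D} (hf : HolAt f t) (α β : MIdx D) :
    dT α (dT β f) t = dT β (dT α f) t := by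
  set w : Fin 2 → MIdx D := ![α, β] with hw
  set F : (Fin 2 → ℂ) → ℂ := fun s => f (t + slice w s) with hFdef
  have hF : AnalyticAt ℂ F 0 := hf.analyticAt w
  have key : ∀ i j : Fin 2, dT (w i) (dT (w j) f) t =
      fderiv ℂ (fderiv ℂ F) 0 (Pi.single i 1) (Pi.single j 1) := by
    intro i j
    have h1 := dT_slice (f := dT (w j) f) (t := t) w i (r := 0)
      ((hf.dT (w j)).analyticAt w).differentiableAt
    rw [slice_zero, add_zero] at h1
    rw [h1]
    have h2 : (fun s => dT (w j) f (t + slice w s)) =ᶠ[𝓝 0]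
        fun s => fderiv ℂ F s (Pi.single j 1) := by
      filter_upwards [hF.eventually_analyticAt] with s hs
      exact dT_slice w j hs.differentiableAt
    rw [h2.fderiv_eq]
    have h3 : DifferentiableAt ℂ (fderiv ℂ F) 0 := hF.fderiv.differentiableAt
    rw [fderiv_clm_apply h3 (differentiableAt_const _)]
    simp
  have hs : IsSymmSndFDerivAt ℂ F 0 :=
    ContDiffAt.isSymmSndFDerivAt (n := 2) hF.contDiffAt (by simp)
  have h01 := key 0 1
  have h10 := key 1 0
  simp only [hw, Matrix.cons_val_zero, Matrix.cons_val_one] at h01 h10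
  rw [h01, h10]
  exact hs.eq _ _

/-! ### Sets that are open in all finite-dimensional directions -/

/-- A set of times whose finite-dimensional slices are open. -/
def FinOpen (O : Set (Times D)) : Prop :=
  ∀ s ∈ O, ∀ (N : ℕ) (v : Fin N → MIdx D), ∀ᶠ r in 𝓝 (0 : Fin N → ℂ), s + slice v r ∈ O

lemma FinOpen.inter {O O' : Set (Times D)} (h : FinOpen O) (h' : FinOpen O') :
    FinOpen (O ∩ O') := fun s hs N v => (h s hs.1 N v).and (h' s hs.2 N v)

lemma FinOpen.line {O : Set (Times D)} (h : FinOpen O) {s : Times D} (hs : s ∈ O) (α : MIdx D) :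
    ∀ᶠ x in 𝓝 (0 : ℂ), s + Pi.single α x ∈ O := by
  have h1 : Tendsto (fun x : ℂ => (fun _ : Fin 1 => x)) (𝓝 0) (𝓝 0) := by
    have : Continuous (fun x : ℂ => (fun _ : Fin 1 => x)) := by fun_prop
    exact this.tendsto' _ _ rfl
  filter_upwards [h1.eventually (h s hs 1 fun _ => α)] with x hx
  simpa [slice] using hx

/-- Neither function needs to be differentiable: both lines entering the Wirtinger derivative stay
in `O` near `t`, where the two functions have the same germs. -/
lemma dT_congr {O : Set (Times D)} (hO : FinOpen O) {f g : Times D → ℂ}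
    (hfg : ∀ s ∈ O, f s = g s) (α : MIdx D) {t : Times D} (ht : t ∈ O) :
    dT α f t = dT α g t := by
  have h := hO.line ht α
  have h1 : Tendsto (fun x : ℝ => (x : ℂ)) (𝓝 0) (𝓝 0) :=
    Complex.continuous_ofReal.tendsto' _ _ (by simp)
  have h2 : Tendsto (fun x : ℝ => (x : ℂ) * Complex.I) (𝓝 0) (𝓝 0) :=
    (Complex.continuous_ofReal.mul continuous_const).tendsto' _ _ (by simp)
  have e1 : (fun x : ℝ => f (t + Pi.single α (x : ℂ))) =ᶠ[𝓝 0]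
      fun x : ℝ => g (t + Pi.single α (x : ℂ)) := by
    filter_upwards [h1.eventually h] with x hx using hfg _ hx
  have e2 : (fun x : ℝ => f (t + Pi.single α (x * Complex.I))) =ᶠ[𝓝 0]
      fun x : ℝ => g (t + Pi.single α (x * Complex.I)) := by
    filter_upwards [h2.eventually h] with x hx using hfg _ hx
  rw [dT, dT, e1.deriv_eq, e2.deriv_eq]

lemma HolAt.congr {O : Set (Times D)} (hO : FinOpen O) {f g : Times D → ℂ}
    (hfg : ∀ s ∈ O, f s = g s) {t : Times D} (ht : t ∈ O) (hf : HolAt f t) : HolAt g t :=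
  fun N v => (hf N v).congr ((hO t ht N v).mono fun _ h => hfg _ h)

/-- The locus where a function, holomorphic on a finitely open set, is nonzero. -/
lemma FinOpen.ne_zero {O : Set (Times D)} (hO : FinOpen O) {f : Times D → ℂ}
    (hf : ∀ s ∈ O, HolAt f s) : FinOpen {s | s ∈ O ∧ f s ≠ 0} := by
  intro s hs N v
  have h1 : ContinuousAt (fun r => f (s + slice v r)) 0 := ((hf s hs.1).analyticAt v).continuousAt
  have h2 : ∀ᶠ r in 𝓝 0, f (s + slice v r) ≠ 0 :=
    h1.eventually (isOpen_ne.mem_nhds (by simpa [slice_zero] using hs.2))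
  exact (hO s hs.1 N v).and h2

/-! ### Longitudes -/

lemma longitude_le_add (δ α : MIdx D) : longitude δ ≤ longitude (δ - α) + longitude α := by
  simp only [longitude, ← Finset.sum_add_distrib]
  refine Finset.sum_le_sum fun i _ => ?_
  simp only [Pi.sub_apply]
  omega

lemma longitude_unitVec (b : SDir D) : longitude (unitVec b) = 1 := by
  rw [longitude, Finset.sum_eq_single b.1]
  · simp [unitVec]
  · intro j _ hj; simp [unitVec, hj]
  · simp

lemma longitude_le_sub_unitVec (δ : MIdx D) (b : SDir D) :
    longitude δ ≤ longitude (δ - unitVec b) + 1 := by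
  simpa [longitude_unitVec] using longitude_le_add δ (unitVec b)

/-- A unit step changes the parity of the longitude. -/
lemma longitude_sub_unitVec_ne (δ : MIdx D) (b : SDir D) :
    longitude (δ - unitVec b) ≠ longitude δ := by
  have h : longitude (δ - unitVec b) + longitude (unitVec b) ≡ longitude δ [MOD 2] := by
    simp only [longitude, ← Finset.sum_add_distrib]
    refine Nat.ModEq.sum fun i _ => ?_
    simp only [Pi.sub_apply, Nat.ModEq]
    omega
  rw [longitude_unitVec] at h
  intro e
  rw [e] at h
  simp only [Nat.ModEq] at h
  omega

/-! ### Matrix functions of the times -/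

/-- All the entries of a matrix function are holomorphic near `t`. -/
def MHolAt {ι κ : Type} (F : Times D → Matrix ι κ ℂ) (t : Times D) : Prop :=
  ∀ i j, HolAt (fun s => F s i j) t

section MatrixCalculus

variable {ι κ θ : Type} {F H : Times D → Matrix ι κ ℂ} {t : Times D}

lemma MHolAt.mderiv (hF : MHolAt F t) (α : MIdx D) : MHolAt (mderiv dT α F) t :=
  fun i j => (hF i j).dT α

lemma MHolAt.add (hF : MHolAt F t) (hH : MHolAt H t) : MHolAt (fun s => F s + H s) t :=
  fun i j => (hF i j).add (hH i j)

lemma MHolAt.sub (hF : MHolAt F t) (hH : MHolAt H t) : MHolAt (fun s => F s - H s) t :=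
  fun i j => (hF i j).sub (hH i j)

lemma MHolAt.neg (hF : MHolAt F t) : MHolAt (fun s => -F s) t :=
  fun i j => (hF i j).neg

lemma MHolAt.const (A : Matrix ι κ ℂ) : MHolAt (fun _ => A) t := fun _ _ => HolAt.const _ t

lemma MHolAt.smul (c : ℂ) (hF : MHolAt F t) : MHolAt (fun s => c • F s) t :=
  fun i j => (HolAt.const c t).mul (hF i j)

lemma MHolAt.mul [Fintype κ] {K : Times D → Matrix κ θ ℂ} (hF : MHolAt F t) (hK : MHolAt K t) :
    MHolAt (fun s => F s * K s) t := by
  intro i j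
  simp only [Matrix.mul_apply]
  exact HolAt.sum _ fun l _ => (hF i l).mul (hK l j)

lemma MHolAt.sum {σ : Type*} (S : Finset σ) {F : σ → Times D → Matrix ι κ ℂ}
    (hF : ∀ x ∈ S, MHolAt (F x) t) : MHolAt (fun s => ∑ x ∈ S, F x s) t := by
  intro i j
  simp only [Matrix.sum_apply]
  exact HolAt.sum _ fun x hx => hF x hx i j

lemma mderiv_const (α : MIdx D) (A : Matrix ι κ ℂ) : mderiv dT α (fun _ => A) t = 0 := by
  ext i j; exact dT_const α _ t

lemma mderiv_add (α : MIdx D) (hF : MHolAt F t) (hH : MHolAt H t) :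
    mderiv dT α (fun s => F s + H s) t = mderiv dT α F t + mderiv dT α H t := by
  ext i j; exact dT_add α (hF i j) (hH i j)

lemma mderiv_sub (α : MIdx D) (hF : MHolAt F t) (hH : MHolAt H t) :
    mderiv dT α (fun s => F s - H s) t = mderiv dT α F t - mderiv dT α H t := by
  ext i j; exact dT_sub α (hF i j) (hH i j)

lemma mderiv_neg (α : MIdx D) (hF : MHolAt F t) :
    mderiv dT α (fun s => -F s) t = -mderiv dT α F t := by
  ext i j; exact dT_neg α (hF i j)

lemma mderiv_smul (α : MIdx D) (c : ℂ) (hF : MHolAt F t) :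
    mderiv dT α (fun s => c • F s) t = c • mderiv dT α F t := by
  ext i j; exact dT_const_mul α c (hF i j)

lemma mderiv_sum (α : MIdx D) {σ : Type*} (S : Finset σ) {F : σ → Times D → Matrix ι κ ℂ}
    (hF : ∀ x ∈ S, MHolAt (F x) t) :
    mderiv dT α (fun s => ∑ x ∈ S, F x s) t = ∑ x ∈ S, mderiv dT α (F x) t := by
  ext i j
  simp only [mderiv, Matrix.sum_apply]
  exact dT_sum α S fun x hx => hF x hx i j

lemma mderiv_mul [Fintype κ] {K : Times D → Matrix κ θ ℂ} (α : MIdx D) (hF : MHolAt F t)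
    (hK : MHolAt K t) :
    mderiv dT α (fun s => F s * K s) t = mderiv dT α F t * K t + F t * mderiv dT α K t := by
  ext i j
  simp only [mderiv, Matrix.mul_apply, Matrix.add_apply]
  rw [dT_sum α _ fun l _ => (hF i l).mul (hK l j), ← Finset.sum_add_distrib]
  exact Finset.sum_congr rfl fun l _ => dT_mul α (hF i l) (hK l j)

lemma mderiv_mul_const [Fintype κ] (α : MIdx D) (hF : MHolAt F t) (A : Matrix κ θ ℂ) :
    mderiv dT α (fun s => F s * A) t = mderiv dT α F t * A := by
  rw [mderiv_mul α hF (MHolAt.const A), mderiv_const, Matrix.mul_zero, add_zero]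

lemma mderiv_comm (hF : MHolAt F t) (α β : MIdx D) :
    mderiv dT α (mderiv dT β F) t = mderiv dT β (mderiv dT α F) t := by
  ext i j; exact dT_comm (hF i j) α β

lemma mderiv_congr {O : Set (Times D)} (hO : FinOpen O) (h : ∀ s ∈ O, F s = H s) (α : MIdx D)
    (ht : t ∈ O) : mderiv dT α F t = mderiv dT α H t := by
  ext i j; exact dT_congr hO (fun s hs => by rw [h s hs]) α ht

end MatrixCalculus

/-! ### Rows of semi-infinite matrices

A row `f` stands for the wave function `∑ f_ε Φ_ε`, where `∂_α Φ_ε = Φ_{ε+α}`; the derivatives of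
the wave function correspond to the operators `nabla`. -/

section Rows

variable {ι : Type}

/-- The derivative of a row, with the spectral variables differentiated too. -/
def nabla (α : MIdx D) (F : Times D → Matrix ι (MIdx D) ℂ) (s : Times D) :
    Matrix ι (MIdx D) ℂ := mderiv dT α F s + (F s).submatrix id (· - α)

variable {F H : Times D → Matrix ι (MIdx D) ℂ} {t : Times D}

lemma MHolAt.submatrix (hF : MHolAt F t) {κ : Type} (g : κ → MIdx D) :
    MHolAt (fun s => (F s).submatrix id g) t := fun i j => hF i (g j)

lemma MHolAt.nabla (hF : MHolAt F t) (α : MIdx D) : MHolAt (nabla α F) t :=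
  (hF.mderiv α).add (hF.submatrix _)

lemma nabla_add (α : MIdx D) (hF : MHolAt F t) (hH : MHolAt H t) :
    nabla α (fun s => F s + H s) t = nabla α F t + nabla α H t := by
  simp only [nabla, mderiv_add α hF hH, Matrix.submatrix_add, Pi.add_apply]
  abel

lemma nabla_mul {κ : Type} [Fintype κ] {A : Times D → Matrix ι κ ℂ}
    {Z : Times D → Matrix κ (MIdx D) ℂ} (α : MIdx D) (hA : MHolAt A t) (hZ : MHolAt Z t) :
    nabla α (fun s => A s * Z s) t = mderiv dT α A t * Z t + A t * nabla α Z t := by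
  simp only [nabla, mderiv_mul α hA hZ, Matrix.mul_add]
  rw [add_assoc]
  rfl

/-- Both terms of `nabla` commute with each other: differentiation acts on entries, translation on
column indices. -/
lemma nabla_comm (hF : MHolAt F t) (α β : MIdx D) :
    nabla α (nabla β F) t = nabla β (nabla α F) t := by
  have e : ∀ α β : MIdx D, nabla α (nabla β F) t = mderiv dT α (mderiv dT β F) t +
      (mderiv dT α F t).submatrix id (· - β) + ((mderiv dT β F t).submatrix id (· - α) +
      (F t).submatrix id (fun δ => δ - α - β)) := by
    intro α β
    show mderiv dT α (nabla β F) t + _ = _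
    have : mderiv dT α (nabla β F) t = _ := mderiv_add α (hF.mderiv β) (hF.submatrix (· - β))
    rw [this]
    rfl
  rw [e α β, e β α, mderiv_comm hF α β]
  simp only [sub_right_comm _ α β]
  abel

lemma nabla_congr {O : Set (Times D)} (hO : FinOpen O) (h : ∀ s ∈ O, F s = H s) (α : MIdx D)
    (ht : t ∈ O) : nabla α F t = nabla α H t := by
  simp only [nabla, mderiv_congr hO h α ht, h t ht]

/-! ### Rows of finite support and their pairing with sequences. -/

/-- The rows have finite support, uniformly. -/
def Banded (F : Matrix ι (MIdx D) ℂ) (N : ℕ) : Prop := ∀ i ε, N ≤ longitude ε → F i ε = 0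

lemma Banded.mono {A : Matrix ι (MIdx D) ℂ} {N N' : ℕ} (h : Banded A N) (hN : N ≤ N') :
    Banded A N' := fun i ε hε => h i ε (hN.trans hε)

lemma Banded.mderiv {N : ℕ} (h : ∀ s, Banded (F s) N) (α : MIdx D) (s : Times D) :
    Banded (mderiv dT α F s) N := by
  intro i ε hε
  show dT α (fun s => F s i ε) s = 0
  have : (fun s => F s i ε) = fun _ => 0 := funext fun s => h s i ε hε
  rw [this, dT_const]

lemma Banded.shift {A : Matrix ι (MIdx D) ℂ} {N : ℕ} (h : Banded A N) (α : MIdx D) :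
    Banded (A.submatrix id (· - α)) (N + longitude α) := fun i ε hε =>
  h i (ε - α) (by have := longitude_le_add ε α; omega)

lemma Banded.add {A B : Matrix ι (MIdx D) ℂ} {N : ℕ} (hA : Banded A N) (hB : Banded B N) :
    Banded (A + B) N := fun i ε hε => by
  rw [Matrix.add_apply, hA i ε hε, hB i ε hε, add_zero]

lemma Banded.nabla {N : ℕ} (h : ∀ s, Banded (F s) N) (α : MIdx D) (s : Times D) :
    Banded (nabla α F s) (N + longitude α) :=
  ((Banded.mderiv h α s).mono (Nat.le_add_right _ _)).add ((h s).shift α)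

lemma Banded.mul {κ : Type} [Fintype κ] {N : ℕ} {Z : Matrix κ (MIdx D) ℂ} (h : Banded Z N)
    (A : Matrix ι κ ℂ) : Banded (A * Z) N := fun i ε hε => by
  rw [Matrix.mul_apply]
  exact Finset.sum_eq_zero fun l _ => by rw [h l ε hε, mul_zero]

lemma Banded.smul {A : Matrix ι (MIdx D) ℂ} {N : ℕ} (hA : Banded A N) (c : ℂ) :
    Banded (c • A) N := fun i ε hε => by
  rw [Matrix.smul_apply, hA i ε hε, smul_zero]

lemma Banded.sum {σ : Type*} (S : Finset σ) {A : σ → Matrix ι (MIdx D) ℂ} {N : ℕ}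
    (hA : ∀ x, Banded (A x) N) : Banded (∑ x ∈ S, A x) N := fun i ε hε => by
  rw [Matrix.sum_apply]
  exact Finset.sum_eq_zero fun x _ => hA x i ε hε

/-- The wave functions attached to rows. -/
def pairing (A : Matrix ι (MIdx D) ℂ) (Φ : MIdx D → ℂ) : ι → ℂ := fun i => ∑ᶠ ε, A i ε * Φ ε

/-- The multi-indices of longitude less than `N`. -/
def lowFinset (D N : ℕ) : Finset (MIdx D) := (finite_longitude_lt D N).toFinset

lemma mem_lowFinset {N : ℕ} {ε : MIdx D} : ε ∈ lowFinset D N ↔ longitude ε < N := by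
  rw [lowFinset, Set.Finite.mem_toFinset]; rfl

lemma pairing_eq_sum {A : Matrix ι (MIdx D) ℂ} {N : ℕ} (hA : Banded A N) (Φ : MIdx D → ℂ)
    (i : ι) : pairing A Φ i = ∑ ε ∈ lowFinset D N, A i ε * Φ ε := by
  refine finsum_eq_sum_of_support_subset _ fun ε hε => ?_
  rw [Finset.mem_coe, mem_lowFinset]
  by_contra h
  exact hε (by simp [hA i ε (not_lt.mp h)])

lemma pairing_add {A B : Matrix ι (MIdx D) ℂ} {N N' : ℕ} (hA : Banded A N) (hB : Banded B N')
    (Φ : MIdx D → ℂ) : pairing (A + B) Φ = pairing A Φ + pairing B Φ := by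
  have hA' := hA.mono (Nat.le_add_right N N')
  have hB' := hB.mono (Nat.le_add_left N' N)
  ext i
  rw [Pi.add_apply, pairing_eq_sum hA', pairing_eq_sum hB', pairing_eq_sum (hA'.add hB'),
    ← Finset.sum_add_distrib]
  exact Finset.sum_congr rfl fun ε _ => add_mul _ _ _

lemma pairing_smul (A : Matrix ι (MIdx D) ℂ) (c : ℂ) (Φ : MIdx D → ℂ) :
    pairing (c • A) Φ = c • pairing A Φ := by
  ext i
  simp only [pairing, Matrix.smul_apply, smul_eq_mul, Pi.smul_apply, mul_assoc]
  exact (smul_finsum c fun ε => A i ε * Φ ε).symm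

lemma pairing_sum {σ : Type*} (S : Finset σ) {A : σ → Matrix ι (MIdx D) ℂ} {N : ℕ}
    (hA : ∀ x, Banded (A x) N) (Φ : MIdx D → ℂ) :
    pairing (∑ x ∈ S, A x) Φ = ∑ x ∈ S, pairing (A x) Φ := by
  ext i
  rw [pairing_eq_sum (Banded.sum S hA), Finset.sum_apply,
    Finset.sum_congr rfl fun x _ => pairing_eq_sum (hA x) Φ i, Finset.sum_comm]
  exact Finset.sum_congr rfl fun ε _ => by rw [Matrix.sum_apply, Finset.sum_mul]

lemma pairing_mul {κ : Type} [Fintype κ] {N : ℕ} {Z : Matrix κ (MIdx D) ℂ} (hZ : Banded Z N)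
    (A : Matrix ι κ ℂ) (Φ : MIdx D → ℂ) : pairing (A * Z) Φ = A *ᵥ pairing Z Φ := by
  ext i
  simp only [pairing_eq_sum (hZ.mul A), Matrix.mulVec, dotProduct, pairing_eq_sum hZ,
    Matrix.mul_apply, Finset.sum_mul, Finset.mul_sum]
  rw [Finset.sum_comm]
  simp only [mul_assoc]

lemma pairing_shift (A : Matrix ι (MIdx D) ℂ) (α : MIdx D) (Φ : MIdx D → ℂ) :
    pairing (A.submatrix id (· - α)) Φ = pairing A (fun ε => Φ (ε + α)) := by
  ext i
  simp only [pairing]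
  rw [← finsum_comp_equiv (Equiv.addRight α)]
  simp

/-- The functions `Φ_ε` are holomorphic near `t` and satisfy `∂_α Φ_ε = Φ_{ε+α}`. -/
structure WaveAt (Φ : Times D → MIdx D → ℂ) (t : Times D) : Prop where
  hol : ∀ ε, HolAt (fun s => Φ s ε) t
  deriv : ∀ α ε, dT α (fun s => Φ s ε) t = Φ t (ε + α)

lemma holAt_pairing {Φ : Times D → MIdx D → ℂ} {N : ℕ} (hB : ∀ s, Banded (F s) N)
    (hF : MHolAt F t) (hΦ : ∀ ε, HolAt (fun s => Φ s ε) t) (i : ι) :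
    HolAt (fun s => pairing (F s) (Φ s) i) t := by
  simp only [pairing_eq_sum (hB _)]
  exact HolAt.sum _ fun ε _ => (hF i ε).mul (hΦ ε)

/-- This is the purpose of `nabla`. By the Leibniz rule the derivative falls on the coefficients or
on the wave; in the latter case `Φ_ε` becomes `Φ_{ε+α}`, and reindexing moves the translation to the
row. -/
lemma dT_pairing {Φ : Times D → MIdx D → ℂ} {N : ℕ} (hB : ∀ s, Banded (F s) N)
    (hF : MHolAt F t) (hΦ : WaveAt Φ t) (α : MIdx D) (i : ι) :
    dT α (fun s => pairing (F s) (Φ s) i) t = pairing (nabla α F t) (Φ t) i := by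
  rw [nabla, pairing_add (Banded.mderiv hB α t) ((hB t).shift α), pairing_shift, Pi.add_apply,
    pairing_eq_sum (Banded.mderiv hB α t), pairing_eq_sum (hB t), ← Finset.sum_add_distrib]
  simp only [pairing_eq_sum (hB _)]
  rw [dT_sum α _ fun ε _ => (hF i ε).mul (hΦ.hol ε)]
  refine Finset.sum_congr rfl fun ε _ => ?_
  rw [dT_mul α (hF i ε) (hΦ.hol ε), hΦ.deriv]
  rfl

end Rows

/-! ### Rows of the factor `S` -/

/-- The block row `A_{[k],·}`. -/
def blockRow (k : ℕ) (A : BMat D) : Matrix (Level D k) (MIdx D) ℂ :=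
  A.submatrix Subtype.val id

lemma banded_blockRow {A : BMat D} (hA : IsLowerUnitriangular A) (k : ℕ) :
    Banded (blockRow k A) (k + 1) := by
  intro γ ε hε
  have hγ := γ.2
  show A γ ε = 0
  rw [hA _ _ (by omega), if_neg]
  intro e
  rw [e] at hγ
  omega

/-- The uniqueness principle behind all the linear systems: the supported part of the row is a
vector in the left kernel of a nonsingular truncation. -/
lemma eq_zero_of_pairing {ι : Type} {G : BMat D} {k : ℕ} (hG : (trunc k G).det ≠ 0)
    {A : Matrix ι (MIdx D) ℂ} (hA : Banded A k)
    (h : ∀ δ, longitude δ < k → pairing A (fun ε => G ε δ) = 0) : A = 0 := by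
  ext i ε
  by_cases hε : longitude ε < k
  · have h0 : (fun ε : Low D k => A i ε) ᵥ* trunc k G = 0 := by
      ext δ
      have := congrFun (h δ.1 δ.2) i
      rw [pairing_eq_sum hA] at this
      exact (sum_low k fun ε => A i ε * G ε δ).trans this
    exact congrFun (Matrix.eq_zero_of_vecMul_eq_zero hG h0) ⟨ε, hε⟩
  · exact hA i ε (not_lt.mp hε)

/-- Orthogonality of row `k` needs only the truncation of size `k` to be nonsingular, not
quasi-definiteness. It therefore persists at all nearby times on a finite-dimensional slice. -/
lemma pairing_gaussS {G : BMat D} {k : ℕ} (hG : (trunc k G).det ≠ 0) {δ : MIdx D}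
    (h : longitude δ < k) : pairing (blockRow k (gaussS G)) (fun ε => G ε δ) = 0 := by
  ext γ
  obtain ⟨γ, rfl⟩ := γ
  rw [pairing_eq_sum (banded_blockRow (gaussS_lower G) _)]
  have e := sum_gaussS_mul G (n := longitude γ + 1) ⟨γ, Nat.lt_succ_self _⟩ δ
  rw [sum_low _ fun ε => gaussS G γ ε * G ε δ] at e
  refine e.trans ?_
  rw [Pi.zero_apply, sub_eq_zero]
  -- Since `δ` is itself an index of the truncation, `G⁻¹ G = 1` collapses the quasi-determinant
  -- correction to the entry it corrects.
  have h1 := Matrix.nonsing_inv_mul _ (isUnit_iff_ne_zero.mpr hG)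
  have h2 : ∀ ε : Low D (longitude γ),
      ∑ ε' : Low D (longitude γ), G γ ε * (trunc (longitude γ) G)⁻¹ ε ε' * G ε' δ =
      if ε = ⟨δ, h⟩ then G γ ε else 0 := by
    intro ε
    have := congrFun (congrFun h1 ε) ⟨δ, h⟩
    rw [Matrix.mul_apply, Matrix.one_apply] at this
    simp only [mul_assoc, ← Finset.mul_sum]
    have e : ∑ ε' : Low D (longitude γ), (trunc (longitude γ) G)⁻¹ ε ε' * G ε' δ =
      if ε = ⟨δ, h⟩ then 1 else 0 := this
    rw [e]; simp
  rw [Finset.sum_congr rfl (fun ε _ => h2 ε)]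
  simp

/-- A matrix function on a finitely open set, whose entries are holomorphic, whose columns are
waves, and whose first truncations are nonsingular. -/
structure MomentFamily (O : Set (Times D)) (K : ℕ) (G : Times D → BMat D) : Prop where
  finOpen : FinOpen O
  wave : ∀ s ∈ O, ∀ δ, WaveAt (fun s ε => G s ε δ) s
  det_ne : ∀ s ∈ O, ∀ k ≤ K, (trunc k (G s)).det ≠ 0

/-- The truncation formula expresses the entry of `S` through entries of `G` and of an inverse
truncation; the remaining entries are constants. -/
lemma holAt_gaussS {G : Times D → BMat D} {t : Times D}
    (hG : ∀ γ δ, HolAt (fun s => G s γ δ) t) (γ δ : MIdx D)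
    (h0 : (trunc (longitude γ) (G t)).det ≠ 0) : HolAt (fun s => gaussS (G s) γ δ) t := by
  by_cases h : longitude δ < longitude γ
  · simp only [gaussS, dif_pos h]
    exact (HolAt.sum _ fun ε _ => (hG _ _).mul (HolAt.matrix_inv (fun i j => hG _ _) h0 _ _)).neg
  · simp only [gaussS, dif_neg h]
    exact HolAt.const _ t

lemma MomentFamily.mHolAt {O : Set (Times D)} {K : ℕ} {G : Times D → BMat D}
    (h : MomentFamily O K G) {k : ℕ} (hk : k ≤ K) {s : Times D} (hs : s ∈ O) :
    MHolAt (fun s => blockRow k (gaussS (G s))) s := fun γ δ =>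
  holAt_gaussS (G := G) (fun γ δ => (h.wave s hs δ).hol γ) γ.1 δ (by rw [γ.2]; exact h.det_ne s hs k hk)

/-! ### The potentials -/

lemma mul_up_apply {ι : Type} {k : ℕ} (M : Matrix ι (Level D k) ℂ) (b : SDir D) (i : ι)
    (δ : Level D (k + 1)) :
    (M * up k b) i δ =
      if h : longitude (δ.1 - unitVec b) = k then M i ⟨δ.1 - unitVec b, h⟩ else 0 := by
  rw [Matrix.mul_apply]
  have e : ∀ ε : Level D k, up k b ε δ = if ε.1 = δ.1 - unitVec b then 1 else 0 := by
    intro ε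
    simp only [up, block, upsilon, Matrix.submatrix_apply, eq_sub_iff_add_eq]
  simp only [e]
  split_ifs with h
  · rw [Finset.sum_eq_single ⟨δ.1 - unitVec b, h⟩]
    · simp
    · intro ε _ hε
      rw [if_neg fun e => hε (Subtype.ext e), mul_zero]
    · simp
  · refine Finset.sum_eq_zero fun ε _ => ?_
    rw [if_neg, mul_zero]
    intro e
    exact h (e ▸ ε.2)

lemma dT_lower {S : Times D → BMat D} (hS : ∀ s, IsLowerUnitriangular (S s)) {γ δ : MIdx D}
    (h : longitude γ ≤ longitude δ) (α : MIdx D) (t : Times D) :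
    dT α (fun s => S s γ δ) t = 0 := by
  have : (fun s => S s γ δ) = fun _ => if γ = δ then 1 else 0 := funext fun s => hS s γ δ h
  rw [this, dT_const]

/-- The products with `Υ` keep only those shifted columns that lie one level below. The others have
longitude at least `k`, where the entries of `S` are constant, so the unrestricted formula adds
nothing. For the same reason it covers `k = 0`. -/
lemma potential_apply {S : Times D → BMat D} (hS : ∀ s, IsLowerUnitriangular (S s))
    (a b : SDir D) (t : Times D) (k : ℕ) (γ δ : Level D k) :
    potential dT S a b t k γ δ = -dT (unitVec a) (fun s => S s γ (δ.1 - unitVec b)) t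
      - dT (unitVec b) (fun s => S s γ (δ.1 - unitVec a)) t := by
  obtain ⟨γ, hγ⟩ := γ
  obtain ⟨δ, hδ⟩ := δ
  cases k with
  | zero =>
    rw [dT_lower hS (hγ.le.trans (Nat.zero_le _)), dT_lower hS (hγ.le.trans (Nat.zero_le _))]
    simp [potential]
  | succ k =>
    have e : ∀ a b : SDir D,
        (mderiv dT (unitVec a) (fun s => block (k + 1) k (S s)) t * up k b) ⟨γ, hγ⟩ ⟨δ, hδ⟩ =
        dT (unitVec a) (fun s => S s γ (δ - unitVec b)) t := by
      intro a b
      rw [mul_up_apply]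
      split_ifs with h
      · rfl
      · have := longitude_le_sub_unitVec δ b
        exact (dT_lower hS (by simp only at h; omega) _ _).symm
    simp only [potential, Matrix.sub_apply, Matrix.neg_apply, e]

/-- As for `potential_apply`: at the shifted columns not kept by `Υ`, the entries of `S` do not
depend on `m`. -/
lemma diffPotential_apply (n : SDir D → SDir D → ℂ) {S : Disc D → BMat D}
    (hS : ∀ m, IsLowerUnitriangular (S m)) (a : SDir D) (m : Disc D) (k : ℕ) (γ δ : Level D k) :
    diffPotential n S a m k γ δ = ∑ b, n a b *
      (S (m + Pi.single a 1) γ (δ.1 - unitVec b) - S m γ (δ.1 - unitVec b)) := by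
  obtain ⟨γ, hγ⟩ := γ
  obtain ⟨δ, hδ⟩ := δ
  have h0 : ∀ ε, longitude γ ≤ longitude ε → S (m + Pi.single a 1) γ ε - S m γ ε = 0 := by
    intro ε h
    rw [hS _ _ _ h, hS _ _ _ h, sub_self]
  cases k with
  | zero =>
    rw [Finset.sum_eq_zero]
    · simp [diffPotential]
    · intro b _
      rw [h0 _ (hγ.le.trans (Nat.zero_le _)), mul_zero]
  | succ k =>
    have e : block k (k + 1) (slash (n a)) = ∑ b, n a b • up k b := by
      ext i j
      simp [block, slash, up, Matrix.sum_apply]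
    rw [diffPotential, e, Matrix.mul_sum, Matrix.sum_apply]
    refine Finset.sum_congr rfl fun b _ => ?_
    rw [Matrix.mul_smul, Matrix.smul_apply, mul_up_apply, smul_eq_mul]
    split_ifs with h
    · rfl
    · have := longitude_le_sub_unitVec δ b
      rw [h0 _ (by simp only at h ⊢; omega), mul_zero]

/-! ### The linear systems for the rows of `S` -/

lemma mul_blockRow_apply {A : BMat D} (hA : IsLowerUnitriangular A) {k : ℕ} {ι : Type}
    (M : Matrix ι (Level D k) ℂ) (i : ι) {δ : MIdx D} (h : k ≤ longitude δ) :
    (M * blockRow k A) i δ = if h : longitude δ = k then M i ⟨δ, h⟩ else 0 := by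
  rw [Matrix.mul_apply]
  have e : ∀ ε : Level D k, blockRow k A ε δ = if ε.1 = δ then 1 else 0 := fun ε =>
    hA _ _ (by rw [ε.2]; exact h)
  simp only [e]
  split_ifs with h
  · rw [Finset.sum_eq_single ⟨δ, h⟩]
    · simp
    · intro ε _ hε
      rw [if_neg fun e => hε (Subtype.ext e), mul_zero]
    · simp
  · refine Finset.sum_eq_zero fun ε _ => ?_
    rw [if_neg, mul_zero]
    intro e
    exact h (e ▸ ε.2)

section Systems

variable {O : Set (Times D)} {K : ℕ} {G : Times D → BMat D}

lemma MomentFamily.dT_pairing_blockRow (h : MomentFamily O K G) {k : ℕ} (hk : k ≤ K)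
    {Φ : Times D → MIdx D → ℂ} (hΦ : ∀ s ∈ O, WaveAt Φ s) {s : Times D} (hs : s ∈ O)
    (a : MIdx D) (γ : Level D k) :
    dT a (fun s => pairing (blockRow k (gaussS (G s))) (Φ s) γ) s =
      pairing (nabla a (fun s => blockRow k (gaussS (G s))) s) (Φ s) γ :=
  dT_pairing (fun s => banded_blockRow (gaussS_lower (G s)) k) (h.mHolAt hk hs) (hΦ s hs) a γ

lemma MomentFamily.dT_dT_pairing_blockRow (h : MomentFamily O K G) {k : ℕ} (hk : k ≤ K)
    {Φ : Times D → MIdx D → ℂ} (hΦ : ∀ s ∈ O, WaveAt Φ s) {s : Times D} (hs : s ∈ O)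
    (a b : MIdx D) (γ : Level D k) :
    dT a (dT b fun s => pairing (blockRow k (gaussS (G s))) (Φ s) γ) s =
      pairing (nabla a (nabla b fun s => blockRow k (gaussS (G s))) s) (Φ s) γ := by
  rw [dT_congr h.finOpen (fun r hr => h.dT_pairing_blockRow hk hΦ hr b γ) a hs]
  exact dT_pairing (Banded.nabla (fun s => banded_blockRow (gaussS_lower (G s)) k) b)
    ((h.mHolAt hk hs).nabla b) (hΦ s hs) a γ

/-- Changing `t_0` only multiplies `G` by a scalar, which does not affect `S`. In terms of rows,
`nabla 0 Z = ∂_0 Z + Z`, so `∂_0 Z` annihilates the low columns, and it is supported below level `k`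
because the other entries are constant. -/
lemma MomentFamily.mderiv_zero (h : MomentFamily O K G) {k : ℕ} (hk : k ≤ K) {s : Times D}
    (hs : s ∈ O) : mderiv dT 0 (fun s => blockRow k (gaussS (G s))) s = 0 := by
  have hB := fun s => banded_blockRow (gaussS_lower (G s)) k
  refine eq_zero_of_pairing (h.det_ne s hs k hk) ?_ fun δ hδ => ?_
  · intro γ ε hε
    exact dT_lower (fun s => gaussS_lower (G s)) (by rw [γ.2]; exact hε) 0 s
  · ext γ
    have e1 := h.dT_pairing_blockRow hk (fun s hs => h.wave s hs δ) hs 0 γ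
    rw [nabla, pairing_add (Banded.mderiv hB 0 s) ((hB s).shift 0), pairing_shift] at e1
    simp only [add_zero, Pi.add_apply, pairing_gaussS (h.det_ne s hs k hk) hδ] at e1
    rw [Pi.zero_apply, add_zero] at e1
    rw [← e1, dT_congr h.finOpen (g := fun _ => 0) (fun r hr => by
      rw [pairing_gaussS (h.det_ne r hr k hk) hδ, Pi.zero_apply]) 0 hs, dT_const]
    rfl

/-- The rows of `S` satisfy `∂_{(a,b)} S = ∂_a ∂_b S + U_{a,b} S`. -/
theorem MomentFamily.nabla_nabla (h : MomentFamily O K G) {k : ℕ} (hk : k ≤ K) {s : Times D}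
    (hs : s ∈ O) (a b : SDir D) :
    nabla (unitVec a + unitVec b) (fun s => blockRow k (gaussS (G s))) s =
      nabla (unitVec a) (nabla (unitVec b) fun s => blockRow k (gaussS (G s))) s +
      potential dT (fun s => gaussS (G s)) a b s k * blockRow k (gaussS (G s)) := by
  set U := potential dT (fun s => gaussS (G s)) a b s k with hU
  set Z : Times D → Matrix (Level D k) (MIdx D) ℂ := fun s => blockRow k (gaussS (G s)) with hZ
  have hB : ∀ s, Banded (Z s) (k + 1) := fun s => banded_blockRow (gaussS_lower (G s)) k
  have hlow := fun s => gaussS_lower (G s)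
  rw [← sub_eq_zero]
  refine eq_zero_of_pairing (h.det_ne s hs k hk) ?_ fun δ hδ => ?_
  -- At longitude at least `k` the entries of `Z` have zero derivative and the double shifts cancel.
  -- The first derivatives at `δ - e_a` and `δ - e_b` remain: they cancel the potential when `|δ| =
  -- k`, and vanish when `|δ| > k`.
  · intro γ δ hδ
    have hγ : longitude γ.1 = k := γ.2
    have z : ∀ (α δ : MIdx D), k ≤ longitude δ → ∀ t, dT α (fun s => Z s γ δ) t = 0 :=
      fun α δ hδ t => dT_lower hlow (by rw [hγ]; exact hδ) α t
    have e1 : nabla (unitVec a) (nabla (unitVec b) Z) s γ δ =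
        dT (unitVec a) (fun s => Z s γ (δ - unitVec b)) s +
        (dT (unitVec b) (fun s => Z s γ (δ - unitVec a)) s +
          Z s γ (δ - unitVec a - unitVec b)) := by
      have : (fun s => nabla (unitVec b) Z s γ δ) = fun s => Z s γ (δ - unitVec b) := by
        funext t
        show dT (unitVec b) (fun s => Z s γ δ) t + Z t γ (δ - unitVec b) = _
        rw [z _ _ hδ, zero_add]
      show dT (unitVec a) (fun s => nabla (unitVec b) Z s γ δ) s + _ = _
      rw [this]
      rfl
    have e2 : nabla (unitVec a + unitVec b) Z s γ δ = Z s γ (δ - unitVec a - unitVec b) := by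
      show dT _ (fun s => Z s γ δ) s + Z s γ (δ - (unitVec a + unitVec b)) = _
      rw [z _ _ hδ, zero_add, sub_add_eq_sub_sub]
    have e3 := mul_blockRow_apply (hlow s) U γ hδ
    rw [Matrix.sub_apply, Matrix.add_apply, e1, e2, e3]
    split_ifs with hk'
    · rw [hU, potential_apply hlow]
      simp only [hZ, blockRow, Matrix.submatrix_apply, id]
      ring
    · have h1 := longitude_le_sub_unitVec δ a
      have h2 := longitude_le_sub_unitVec δ b
      rw [z _ _ (by omega), z _ _ (by omega)]
      ring
  -- The pairing of `Z` with the column `δ` vanishes on all of `O`, hence so do its first and second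
  -- derivatives, which are the pairings of the `nabla` derivatives.
  · have hw := fun s hs => h.wave s hs δ
    have hBn := fun s => Banded.nabla hB (unitVec b) s
    have hBnn := Banded.nabla hBn (unitVec a) s
    have p0 : ∀ r ∈ O, ∀ γ, pairing (Z r) (fun ε => G r ε δ) γ = 0 := fun r hr γ => by
      rw [pairing_gaussS (h.det_ne r hr k hk) hδ, Pi.zero_apply]
    have p1 : ∀ (α : MIdx D), ∀ r ∈ O, ∀ γ,
        dT α (fun r => pairing (Z r) (fun ε => G r ε δ) γ) r = 0 := fun α r hr γ => by
      rw [dT_congr h.finOpen (g := fun _ => 0) (fun r hr => p0 r hr γ) α hr, dT_const]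
    have q1 : pairing (nabla (unitVec a + unitVec b) Z s) (fun ε => G s ε δ) = 0 := by
      ext γ
      exact (h.dT_pairing_blockRow hk hw hs _ γ).symm.trans (p1 _ s hs γ)
    have q2 : pairing (nabla (unitVec a) (nabla (unitVec b) Z) s) (fun ε => G s ε δ) = 0 := by
      ext γ
      refine (h.dT_dT_pairing_blockRow hk hw hs _ _ γ).symm.trans ?_
      rw [dT_congr h.finOpen (g := fun _ => 0) (fun r hr => p1 _ r hr γ) _ hs, dT_const]
      rfl
    have q3 : pairing (U * Z s) (fun ε => G s ε δ) = 0 := by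
      rw [pairing_mul (hB s), pairing_gaussS (h.det_ne s hs k hk) hδ, Matrix.mulVec_zero]
    rw [sub_eq_add_neg, ← neg_one_smul ℂ (_ + _ : Matrix (Level D k) (MIdx D) ℂ),
      pairing_add (Banded.nabla hB _ s)
        (((hBnn.mono (Nat.le_add_right _ (k + 1))).add
          (((hB s).mul U).mono (Nat.le_add_left _ _))).smul (-1)),
      pairing_smul, pairing_add hBnn ((hB s).mul U), q1, q2, q3]
    simp

/-- The row identity paired with a wave. When `a + b = 0` the left side is `∂Ψ/∂t_0`, which equals
`Ψ` because `S` does not depend on `t_0`. -/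
theorem MomentFamily.schrodinger (h : MomentFamily O K G) {k : ℕ} (hk : k ≤ K)
    {Φ : Times D → MIdx D → ℂ} (hΦ : ∀ s ∈ O, WaveAt Φ s) {s : Times D} (hs : s ∈ O) :
    SchrodingerSystem dT (fun s => gaussS (G s)) k
      (fun s => pairing (blockRow k (gaussS (G s))) (Φ s)) s := by
  intro a b γ
  have hB := fun s => banded_blockRow (gaussS_lower (G s)) k
  have hBnn := Banded.nabla (fun s => Banded.nabla hB (unitVec b) s) (unitVec a) s
  have key := h.dT_pairing_blockRow hk hΦ hs (unitVec a + unitVec b) γ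
  rw [h.nabla_nabla hk hs, pairing_add hBnn ((hB s).mul _), pairing_mul (hB s), Pi.add_apply,
    ← h.dT_dT_pairing_blockRow hk hΦ hs] at key
  refine ⟨fun _ => key, fun hab => ?_⟩
  rw [← key, hab, h.dT_pairing_blockRow hk hΦ hs 0 γ, nabla, h.mderiv_zero hk hs, zero_add,
    pairing_shift]
  simp

end Systems

/-! ### Compatibility of two linear systems -/

lemma nabla_nabla_mul {O : Set (Times D)} (hO : FinOpen O) {ι κ : Type} [Fintype κ]
    {A : Times D → Matrix ι κ ℂ} {Z : Times D → Matrix κ (MIdx D) ℂ}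
    (hA : ∀ s ∈ O, MHolAt A s) (hZ : ∀ s ∈ O, MHolAt Z s) (α β : MIdx D) {t : Times D}
    (ht : t ∈ O) :
    nabla α (nabla β fun s => A s * Z s) t =
      mderiv dT α (mderiv dT β A) t * Z t + mderiv dT β A t * nabla α Z t +
      (mderiv dT α A t * nabla β Z t + A t * nabla α (nabla β Z) t) := by
  rw [nabla_congr hO (fun r hr => nabla_mul β (hA r hr) (hZ r hr)) α ht,
    nabla_add α (((hA t ht).mderiv β).mul (hZ t ht)) ((hA t ht).mul ((hZ t ht).nabla β)),
    nabla_mul α ((hA t ht).mderiv β) (hZ t ht), nabla_mul α (hA t ht) ((hZ t ht).nabla β)]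

/-- The compatibility of `∂_p = ∂_a ∂_b + U` and `∂_q = ∂_c ∂_d + V`. -/
lemma compatibility {O : Set (Times D)} (hO : FinOpen O) {ι : Type} [Fintype ι]
    {Z : Times D → Matrix ι (MIdx D) ℂ} {U V : Times D → Matrix ι ι ℂ}
    (hZ : ∀ s ∈ O, MHolAt Z s) (hU : ∀ s ∈ O, MHolAt U s) (hV : ∀ s ∈ O, MHolAt V s)
    {p a b q c d : MIdx D}
    (h1 : ∀ s ∈ O, nabla p Z s = nabla a (nabla b Z) s + U s * Z s)
    (h2 : ∀ s ∈ O, nabla q Z s = nabla c (nabla d Z) s + V s * Z s) {t : Times D} (ht : t ∈ O) :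
    mderiv dT a (mderiv dT b V) t * Z t + mderiv dT b V t * nabla a Z t +
      mderiv dT a V t * nabla b Z t + mderiv dT q U t * Z t + U t * (V t * Z t) =
    mderiv dT c (mderiv dT d U) t * Z t + mderiv dT d U t * nabla c Z t +
      mderiv dT c U t * nabla d Z t + mderiv dT p V t * Z t + V t * (U t * Z t) := by
  have n2 : ∀ s ∈ O, ∀ a b, MHolAt (nabla a (nabla b Z)) s := fun s hs a b =>
    ((hZ s hs).nabla b).nabla a
  -- One order of the mixed derivative: differentiate the first system, then substitute the second.
  -- The other order is the same computation with the two systems exchanged.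
  have half : ∀ {U V : Times D → Matrix ι ι ℂ} {p a b q c d : MIdx D},
      (∀ s ∈ O, MHolAt U s) → (∀ s ∈ O, MHolAt V s) →
      (∀ s ∈ O, nabla p Z s = nabla a (nabla b Z) s + U s * Z s) →
      (∀ s ∈ O, nabla q Z s = nabla c (nabla d Z) s + V s * Z s) →
      nabla q (nabla p Z) t = nabla a (nabla b (nabla c (nabla d Z))) t +
        (mderiv dT a (mderiv dT b V) t * Z t + mderiv dT b V t * nabla a Z t +
        (mderiv dT a V t * nabla b Z t + V t * nabla a (nabla b Z) t)) +
        (mderiv dT q U t * Z t + U t * (nabla c (nabla d Z) t + V t * Z t)) := by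
    intro U V p a b q c d hU hV h1 h2
    have e1 : ∀ s ∈ O, nabla b (nabla q Z) s =
        nabla b (nabla c (nabla d Z)) s + nabla b (fun s => V s * Z s) s := fun s hs => by
      rw [nabla_congr hO h2 b hs, nabla_add b (n2 s hs c d) ((hV s hs).mul (hZ s hs))]
    rw [nabla_congr hO h1 q ht, nabla_add q (n2 t ht a b) ((hU t ht).mul (hZ t ht)),
      nabla_mul q (hU t ht) (hZ t ht), h2 t ht, nabla_comm ((hZ t ht).nabla b) q a,
      nabla_congr hO (fun s hs => nabla_comm (hZ s hs) q b) a ht, nabla_congr hO e1 a ht,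
      nabla_add a ((n2 t ht c d).nabla b) (((hV t ht).mul (hZ t ht)).nabla b),
      nabla_nabla_mul hO hV hZ a b ht]
  have hpq := nabla_comm (hZ t ht) q p
  rw [half hU hV h1 h2, half hV hU h2 h1] at hpq
  have h4 : nabla a (nabla b (nabla c (nabla d Z))) t =
      nabla c (nabla d (nabla a (nabla b Z))) t := by
    rw [nabla_congr hO (fun s hs => nabla_comm ((hZ s hs).nabla d) b c) a ht,
      nabla_comm (((hZ t ht).nabla d).nabla b) a c]
    refine nabla_congr hO (fun s hs => ?_) c ht
    rw [nabla_congr hO (fun r hr => nabla_comm (hZ r hr) b d) a hs,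
      nabla_comm ((hZ s hs).nabla b) a d]
  rw [h4] at hpq
  simp only [Matrix.mul_add] at hpq
  -- Besides the fourth-order terms, the products of `U` with `nabla c (nabla d Z)` and of `V` with
  -- `nabla a (nabla b Z)` occur on both sides and cancel.
  linear_combination (norm := abel) hpq

/-! ### The diagonal block -/

/-- The columns of longitude `k`. -/
def blockCol {ι : Type} (k : ℕ) (A : Matrix ι (MIdx D) ℂ) : Matrix ι (Level D k) ℂ :=
  A.submatrix id Subtype.val

lemma blockCol_add {ι : Type} (k : ℕ) (A B : Matrix ι (MIdx D) ℂ) :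
    blockCol k (A + B) = blockCol k A + blockCol k B := rfl

lemma blockCol_sub {ι : Type} (k : ℕ) (A B : Matrix ι (MIdx D) ℂ) :
    blockCol k (A - B) = blockCol k A - blockCol k B := rfl

lemma blockCol_smul {ι : Type} (k : ℕ) (x : ℂ) (A : Matrix ι (MIdx D) ℂ) :
    blockCol k (x • A) = x • blockCol k A := rfl

lemma blockCol_sum {σ : Type*} {κ : Type} (k : ℕ) (S : Finset σ) (A : σ → Matrix κ (MIdx D) ℂ) :
    blockCol k (∑ x ∈ S, A x) = ∑ x ∈ S, blockCol k (A x) := by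
  ext i j
  simp [blockCol, Matrix.sum_apply]

lemma blockCol_mul {ι κ : Type} [Fintype κ] (k : ℕ) (A : Matrix ι κ ℂ)
    (B : Matrix κ (MIdx D) ℂ) : blockCol k (A * B) = A * blockCol k B := rfl

lemma blockCol_blockRow {A : BMat D} (hA : IsLowerUnitriangular A) (k : ℕ) :
    blockCol k (blockRow k A) = 1 := by
  ext γ δ
  show A γ δ = _
  rw [hA _ _ (by rw [γ.2, δ.2]), Matrix.one_apply]
  simp [Subtype.ext_iff]

/-- The diagonal block is constant, so only the translation contributes. A column `δ - e_b` has
longitude at least `k`, and by parity not `k + 1`; hence it lies in level `k`, giving `β Υ_b`, or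
beyond level `k + 1`, where the row is zero. -/
lemma blockCol_nabla {S : Times D → BMat D} (hS : ∀ s, IsLowerUnitriangular (S s)) (k : ℕ)
    (b : SDir D) (t : Times D) :
    blockCol (k + 1) (nabla (unitVec b) (fun s => blockRow (k + 1) (S s)) t) =
      block (k + 1) k (S t) * up k b := by
  ext γ δ
  rw [mul_up_apply]
  have hγ := γ.2
  have hδ := δ.2
  show dT _ (fun s => S s γ.1 δ.1) t + S t γ.1 (δ.1 - unitVec b) = _
  rw [dT_lower hS (by omega), zero_add]
  split_ifs with h
  · rfl
  · have h1 := longitude_le_sub_unitVec δ.1 b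
    have h2 := longitude_sub_unitVec_ne δ.1 b
    rw [hS _ _ _ (by omega), if_neg]
    intro e
    rw [← e] at h2
    omega

section KP

variable {O : Set (Times D)} {K : ℕ} {G : Times D → BMat D}

lemma MomentFamily.mHolAt_block (h : MomentFamily O K G) {k : ℕ} (hk : k ≤ K) (l : ℕ)
    {s : Times D} (hs : s ∈ O) : MHolAt (fun s => block k l (gaussS (G s))) s :=
  fun γ δ => h.mHolAt hk hs γ δ.1

/-- The onsite KP equations. -/
theorem MomentFamily.kp (h : MomentFamily O K G) {k : ℕ} (hk : k + 1 ≤ K) {t : Times D}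
    (ht : t ∈ O) (a b c d : SDir D) :
    KPEquation dT k (fun s => block (k + 1) k (gaussS (G s))) a b c d t := by
  set β := fun s => block (k + 1) k (gaussS (G s)) with hβ
  have hβh : ∀ s ∈ O, MHolAt β s := fun s hs => h.mHolAt_block hk k hs
  have hβd : ∀ x, ∀ s ∈ O, MHolAt (mderiv dT x β) s := fun x s hs => (hβh s hs).mderiv x
  have hc : ∀ (x : MIdx D) (y : SDir D), ∀ s ∈ O,
      MHolAt (fun s : Times D => mderiv dT x β s * up k y) s :=
    fun x y s hs => (hβd x s hs).mul (MHolAt.const _)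
  let P : SDir D → SDir D → Times D → Matrix (Level D (k + 1)) (Level D (k + 1)) ℂ :=
    fun a b s => mderiv dT (unitVec a) β s * up k b + mderiv dT (unitVec b) β s * up k a
  have hP : ∀ a b, ∀ s ∈ O, MHolAt (P a b) s := fun a b s hs => (hc _ _ s hs).add (hc _ _ s hs)
  have hpot : ∀ a b s, potential dT (fun s => gaussS (G s)) a b s (k + 1) = -P a b s := by
    intro a b s
    simp only [potential, P, neg_add, sub_eq_add_neg, hβ]
  have key := compatibility h.finOpen (fun s hs => h.mHolAt hk hs) (fun s hs => (hP a b s hs).neg)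
    (fun s hs => (hP c d s hs).neg)
    (fun s hs => by simpa only [hpot] using h.nabla_nabla hk hs a b)
    (fun s hs => by simpa only [hpot] using h.nabla_nabla hk hs c d) ht
  -- In the columns of longitude `k + 1`, `Z` becomes the identity and `nabla b Z` becomes `β Υ_b`.
  -- The identity of rows turns into an equation for `β` alone.
  have key2 := congrArg (blockCol (k + 1)) key
  simp only [blockCol_add, blockCol_mul, blockCol_blockRow (gaussS_lower _),
    blockCol_nabla (fun s => gaussS_lower (G s)), Matrix.mul_one] at key2
  have eP : ∀ a b x : SDir D, mderiv dT (unitVec x) (P a b) t =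
      mderiv dT (unitVec x) (mderiv dT (unitVec a) β) t * up k b +
      mderiv dT (unitVec x) (mderiv dT (unitVec b) β) t * up k a := by
    intro a b x
    refine (mderiv_add _ (hc _ _ t ht) (hc _ _ t ht)).trans ?_
    rw [mderiv_mul_const _ (hβd _ t ht), mderiv_mul_const _ (hβd _ t ht)]
  have eN : ∀ a b, ∀ x : MIdx D, ∀ s ∈ O,
      mderiv dT x (fun s => -P a b s) s = -mderiv dT x (P a b) s :=
    fun a b x s hs => mderiv_neg x (hP a b s hs)
  have eNN : ∀ a b, ∀ x y : MIdx D, mderiv dT x (mderiv dT y (fun s => -P a b s)) t =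
      -mderiv dT x (mderiv dT y (P a b)) t := fun a b x y => by
    rw [mderiv_congr h.finOpen (fun s hs => eN a b y s hs) x ht,
      mderiv_neg x ((hP a b t ht).mderiv y)]
  simp only [eNN, eN _ _ _ t ht] at key2
  -- The mixed derivatives coming from `U` and from `V` are put in the same order, so that they
  -- combine into the commutator-like brackets `Υ_d β Υ_a - Υ_a β Υ_d`.
  rw [eP, eP, eP, eP, mderiv_comm (hβh t ht) (unitVec d) (unitVec a),
    mderiv_comm (hβh t ht) (unitVec d) (unitVec b),
    mderiv_comm (hβh t ht) (unitVec c) (unitVec a),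
    mderiv_comm (hβh t ht) (unitVec c) (unitVec b)] at key2
  rw [show block (k + 1) k (gaussS (G t)) = β t from rfl] at key2
  show mderiv dT (unitVec a + unitVec b) (P c d) t - mderiv dT (unitVec c + unitVec d) (P a b) t =
    mderiv dT (unitVec a) (mderiv dT (unitVec b) (P c d)) t
      - mderiv dT (unitVec c) (mderiv dT (unitVec d) (P a b)) t + _ + _ + _ + _
      + (P c d t * P a b t - P a b t * P c d t)
  simp only [Matrix.neg_mul, Matrix.mul_neg, neg_neg, Matrix.add_mul, Matrix.mul_sub,
    Matrix.mul_assoc] at key2 ⊢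
  linear_combination (norm := abel) key2

end KP

/-! ### Rows and discrete times -/

section Rows

variable {ι : Type} {t : Times D}

lemma Banded.sub {A B : Matrix ι (MIdx D) ℂ} {N : ℕ} (hA : Banded A N) (hB : Banded B N) :
    Banded (A - B) N := fun i ε hε => by
  rw [Matrix.sub_apply, hA i ε hε, hB i ε hε, sub_zero]

lemma pairing_sub {A B : Matrix ι (MIdx D) ℂ} {N N' : ℕ} (hA : Banded A N) (hB : Banded B N')
    (Φ : MIdx D → ℂ) : pairing (A - B) Φ = pairing A Φ - pairing B Φ := by
  rw [sub_eq_add_neg, ← neg_one_smul ℂ B, pairing_add hA (hB.smul _), pairing_smul,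
    neg_one_smul, sub_eq_add_neg]

/-- The derivative of rows in the direction `c`. -/
def nablaDir (c : SDir D → ℂ) (F : Times D → Matrix ι (MIdx D) ℂ) (s : Times D) :
    Matrix ι (MIdx D) ℂ := ∑ b, c b • nabla (unitVec b) F s

/-- Multiplication of the wave function of a row by `L_c - w`. -/
def shiftDir (c : SDir D → ℂ) (w : ℂ) (A : Matrix ι (MIdx D) ℂ) : Matrix ι (MIdx D) ℂ :=
  ∑ b, c b • A.submatrix id (· - unitVec b) - w • A

variable {F H : Times D → Matrix ι (MIdx D) ℂ}

lemma MHolAt.shiftDir (hF : MHolAt F t) (c : SDir D → ℂ) (w : ℂ) :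
    MHolAt (fun s => shiftDir c w (F s)) t :=
  (MHolAt.sum _ fun b _ => (hF.submatrix (· - unitVec b)).smul (c b)).sub (hF.smul w)

lemma nablaDir_add (c : SDir D → ℂ) (hF : MHolAt F t) (hH : MHolAt H t) :
    nablaDir c (fun s => F s + H s) t = nablaDir c F t + nablaDir c H t := by
  simp only [nablaDir, nabla_add _ hF hH, smul_add, Finset.sum_add_distrib]

lemma nablaDir_congr {O : Set (Times D)} (hO : FinOpen O) (h : ∀ s ∈ O, F s = H s)
    (c : SDir D → ℂ) (ht : t ∈ O) : nablaDir c F t = nablaDir c H t := by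
  simp only [nablaDir, nabla_congr hO h _ ht]

lemma nablaDir_mul {κ : Type} [Fintype κ] {A : Times D → Matrix ι κ ℂ}
    {Z : Times D → Matrix κ (MIdx D) ℂ} (c : SDir D → ℂ) (hA : MHolAt A t) (hZ : MHolAt Z t) :
    nablaDir c (fun s => A s * Z s) t =
      (∑ b, c b • mderiv dT (unitVec b) A t) * Z t + A t * nablaDir c Z t := by
  simp only [nablaDir, nabla_mul _ hA hZ, smul_add, Finset.sum_add_distrib,
    Matrix.sum_mul, Matrix.mul_sum, Matrix.smul_mul, Matrix.mul_smul]

lemma shiftDir_mul {κ : Type} [Fintype κ] (c : SDir D → ℂ) (w : ℂ) (A : Matrix ι κ ℂ)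
    (Z : Matrix κ (MIdx D) ℂ) : shiftDir c w (A * Z) = A * shiftDir c w Z := by
  simp only [shiftDir, Matrix.mul_sub, Matrix.mul_sum, Matrix.mul_smul]
  rfl

lemma shiftDir_add (c : SDir D → ℂ) (w : ℂ) (A B : Matrix ι (MIdx D) ℂ) :
    shiftDir c w (A + B) = shiftDir c w A + shiftDir c w B := by
  simp only [shiftDir, Matrix.submatrix_add, Pi.add_apply, smul_add, Finset.sum_add_distrib]
  abel

lemma shiftDir_shiftDir (c c' : SDir D → ℂ) (w w' : ℂ) (A : Matrix ι (MIdx D) ℂ) :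
    shiftDir c w (shiftDir c' w' A) = shiftDir c' w' (shiftDir c w A) := by
  have e : ∀ (c c' : SDir D → ℂ) (w w' : ℂ) i δ, shiftDir c w (shiftDir c' w' A) i δ =
      (∑ b, ∑ b', c b * c' b' * A i (δ - unitVec b - unitVec b')) -
      (∑ b, w' * c b * A i (δ - unitVec b)) -
      ((∑ b', w * c' b' * A i (δ - unitVec b')) - w * w' * A i δ) := by
    intro c c' w w' i δ
    simp only [shiftDir, Matrix.sub_apply, Matrix.sum_apply, Matrix.smul_apply,
      Matrix.submatrix_apply, smul_eq_mul, id, mul_sub, Finset.sum_sub_distrib, Finset.mul_sum,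
      ← mul_assoc, mul_comm (c _) w']
  ext i δ
  rw [e c c' w w', e c' c w' w, Finset.sum_comm]
  simp only [sub_right_comm δ, mul_comm (c' _) (c _), mul_comm w' w]
  ring

lemma nabla_shiftDir (α : MIdx D) (c : SDir D → ℂ) (w : ℂ) (hF : MHolAt F t) :
    nabla α (fun s => shiftDir c w (F s)) t = shiftDir c w (nabla α F t) := by
  have h1 : ∀ b, MHolAt (fun s => c b • (F s).submatrix id (· - unitVec b)) t :=
    fun b => (hF.submatrix (· - unitVec b)).smul (c b)
  have e : mderiv dT α (fun s => shiftDir c w (F s)) t = shiftDir c w (mderiv dT α F t) := by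
    refine (mderiv_sub α (MHolAt.sum _ fun b _ => h1 b) (hF.smul w)).trans ?_
    rw [mderiv_smul α w hF, mderiv_sum α _ fun b _ => h1 b]
    congr 1
    exact Finset.sum_congr rfl fun b _ => mderiv_smul α (c b) (hF.submatrix (· - unitVec b))
  rw [nabla, nabla, e, shiftDir_add]
  congr 1
  ext i δ
  simp only [shiftDir, Matrix.sub_apply, Matrix.sum_apply, Matrix.smul_apply,
      Matrix.submatrix_apply, id, sub_right_comm δ]

lemma nablaDir_shiftDir (c c' : SDir D → ℂ) (w : ℂ) (hF : MHolAt F t) :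
    nablaDir c (fun s => shiftDir c' w (F s)) t = shiftDir c' w (nablaDir c F t) := by
  simp only [nablaDir, nabla_shiftDir _ c' w hF]
  ext i δ
  simp only [shiftDir, Matrix.sub_apply, Matrix.sum_apply, Matrix.smul_apply,
    Matrix.submatrix_apply, id, smul_eq_mul, mul_sub, Finset.sum_sub_distrib, Finset.mul_sum]
  rw [Finset.sum_comm]
  congr 1
  · exact Finset.sum_congr rfl fun b _ => Finset.sum_congr rfl fun b' _ => by ring
  · exact Finset.sum_congr rfl fun b _ => by ring

lemma nablaDir_comm {O : Set (Times D)} (hF : ∀ s ∈ O, MHolAt F s)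
    (c c' : SDir D → ℂ) (ht : t ∈ O) :
    nablaDir c (nablaDir c' F) t = nablaDir c' (nablaDir c F) t := by
  have e : ∀ c c' : SDir D → ℂ, nablaDir c (nablaDir c' F) t =
      ∑ b, ∑ b', (c b * c' b') • nabla (unitVec b) (nabla (unitVec b') F) t := by
    intro c c'
    refine Finset.sum_congr rfl fun b _ => ?_
    have h1 : ∀ b', MHolAt (nabla (unitVec b') F) t := fun b' => (hF t ht).nabla _
    have : nabla (unitVec b) (nablaDir c' F) t =
        ∑ b', c' b' • nabla (unitVec b) (nabla (unitVec b') F) t := by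
      rw [nabla]
      have e1 : mderiv dT (unitVec b) (nablaDir c' F) t =
          ∑ b', c' b' • mderiv dT (unitVec b) (nabla (unitVec b') F) t := by
        refine (mderiv_sum _ _ fun b' _ => (h1 b').smul (c' b')).trans ?_
        exact Finset.sum_congr rfl fun b' _ => mderiv_smul _ _ (h1 b')
      rw [e1]
      simp only [nabla, smul_add, Finset.sum_add_distrib]
      congr 1
      ext i δ
      simp [nablaDir, nabla, Matrix.sum_apply, mul_add, Finset.sum_add_distrib]
    rw [this, Finset.smul_sum]
    exact Finset.sum_congr rfl fun b' _ => smul_smul _ _ _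
  rw [e c c', e c' c, Finset.sum_comm]
  refine Finset.sum_congr rfl fun b _ => Finset.sum_congr rfl fun b' _ => ?_
  rw [nabla_comm (hF t ht), mul_comm]

lemma Banded.nablaDir {N : ℕ} (h : ∀ s, Banded (F s) N) (c : SDir D → ℂ) (s : Times D) :
    Banded (nablaDir c F s) (N + 1) := Banded.sum _ fun b => by
  have := (Banded.nabla h (unitVec b) s).smul (c b)
  rwa [longitude_unitVec] at this

lemma Banded.sum_shift {A : Matrix ι (MIdx D) ℂ} {N : ℕ} (h : Banded A N) (c : SDir D → ℂ) :
    Banded (∑ b, c b • A.submatrix id (· - unitVec b)) (N + 1) := Banded.sum _ fun b => by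
  have := (h.shift (unitVec b)).smul (c b)
  rwa [longitude_unitVec] at this

lemma Banded.shiftDir {A : Matrix ι (MIdx D) ℂ} {N : ℕ} (h : Banded A N) (c : SDir D → ℂ)
    (w : ℂ) : Banded (shiftDir c w A) (N + 1) :=
  (h.sum_shift c).sub ((h.smul w).mono (Nat.le_succ N))

/-- Multiplying the wave by `L_c - w` is transferred to the row by reindexing. -/
lemma pairing_shiftDir {A : Matrix ι (MIdx D) ℂ} {N : ℕ} (h : Banded A N) (c : SDir D → ℂ)
    (w : ℂ) (Φ : MIdx D → ℂ) :
    pairing (shiftDir c w A) Φ = pairing A fun ε => ∑ b, c b * Φ (ε + unitVec b) - w * Φ ε := by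
  have h1 : ∀ b, Banded (c b • A.submatrix id (· - unitVec b)) (N + 1) := fun b => by
    have := (h.shift (unitVec b)).smul (c b)
    rwa [longitude_unitVec] at this
  rw [shiftDir, pairing_sub (h.sum_shift c) (h.smul w), pairing_sum _ h1, pairing_smul]
  simp only [pairing_smul, pairing_shift]
  ext i
  simp only [Pi.sub_apply, Finset.sum_apply, Pi.smul_apply, pairing_eq_sum h, smul_eq_mul,
    mul_sub, Finset.mul_sum, Finset.sum_sub_distrib]
  rw [Finset.sum_comm]
  congr 1
  · exact Finset.sum_congr rfl fun b _ => Finset.sum_congr rfl fun b' _ => by ring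
  · exact Finset.sum_congr rfl fun b _ => by ring

lemma pairing_nablaDir {N : ℕ} (h : ∀ s, Banded (F s) N) (c : SDir D → ℂ) (s : Times D)
    (Φ : MIdx D → ℂ) (i : ι) :
    pairing (nablaDir c F s) Φ i = ∑ b, c b * pairing (nabla (unitVec b) F s) Φ i := by
  have h1 : ∀ b, Banded (c b • nabla (unitVec b) F s) (N + 1) := fun b => by
    have := (Banded.nabla h (unitVec b) s).smul (c b)
    rwa [longitude_unitVec] at this
  rw [nablaDir, pairing_sum _ h1]
  simp [pairing_smul]

end Rows

/-! ### The difference systems -/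

/-- `Φ'` is the shift of `Φ` in the discrete direction with data `c`, `w`. -/
def IsShift (c : SDir D → ℂ) (w : ℂ) (Φ Φ' : MIdx D → ℂ) : Prop :=
  ∀ ε, Φ' ε = ∑ b, c b * Φ (ε + unitVec b) - w * Φ ε

section Difference

variable {O : Set (Times D)} {K : ℕ} {G : Times D → Disc D → BMat D}
  {n : SDir D → SDir D → ℂ} {q : SDir D → ℂ}

/-- The rows of `S` satisfy `∂_{n_a} S = T_a S (L_{n_a}(Υ) - q_a) + (q_a - Δ_a β N_a) S`. -/
theorem nablaDir_blockRow {m : Disc D} {a : SDir D} (h : MomentFamily O K fun s => G s m)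
    (h' : MomentFamily O K fun s => G s (m + Pi.single a 1))
    (hs : ∀ s ∈ O, ∀ δ, IsShift (n a) (q a) (fun ε => G s m ε δ)
      fun ε => G s (m + Pi.single a 1) ε δ)
    {k : ℕ} (hk : k ≤ K) {s : Times D} (ht : s ∈ O) :
    nablaDir (n a) (fun s => blockRow k (gaussS (G s m))) s =
      shiftDir (n a) (q a) (blockRow k (gaussS (G s (m + Pi.single a 1)))) +
      (q a • 1 - diffPotential n (fun m => gaussS (G s m)) a m k) *
        blockRow k (gaussS (G s m)) := by
  set Z : Times D → Matrix (Level D k) (MIdx D) ℂ := fun s => blockRow k (gaussS (G s m)) with hZ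
  set Z' := blockRow k (gaussS (G s (m + Pi.single a 1))) with hZ'
  set P := diffPotential n (fun m => gaussS (G s m)) a m k with hP
  have hlow : ∀ s m, IsLowerUnitriangular (gaussS (G s m)) := fun s m => gaussS_lower _
  have hB : ∀ s, Banded (Z s) (k + 1) := fun s => banded_blockRow (hlow s m) k
  have hB' : Banded Z' (k + 1) := banded_blockRow (hlow s _) k
  rw [← sub_eq_zero]
  refine eq_zero_of_pairing (h.det_ne s ht k hk) ?_ fun δ hδ => ?_
  -- Beyond level `k - 1` the rows at `m` and at `m + ε_a` agree, and the time derivatives vanish.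
  -- The discrepancy of the shifted terms is the difference potential at longitude `k`, and zero
  -- beyond it.
  · intro γ δ hδ
    have hγ : longitude γ.1 = k := γ.2
    have e0 : ∀ ε, k ≤ longitude ε → Z' γ ε = Z s γ ε := fun ε hε => by
      show gaussS _ γ ε = gaussS _ γ ε
      rw [hlow _ _ _ _ (hγ.le.trans hε), hlow _ _ _ _ (hγ.le.trans hε)]
    have e1 : nablaDir (n a) Z s γ δ = ∑ b, n a b * Z s γ (δ - unitVec b) := by
      rw [nablaDir, Matrix.sum_apply]
      refine Finset.sum_congr rfl fun b _ => ?_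
      show n a b * (dT _ (fun s => Z s γ δ) s + Z s γ (δ - unitVec b)) = _
      have : dT (unitVec b) (fun s => Z s γ δ) s = 0 :=
        dT_lower (fun s => hlow s m) (hγ.le.trans hδ) _ _
      rw [this, zero_add]
    have e2 : shiftDir (n a) (q a) Z' γ δ =
        ∑ b, n a b * Z' γ (δ - unitVec b) - q a * Z s γ δ := by
      rw [← e0 δ hδ]
      simp [shiftDir, Matrix.sum_apply]
    have e3 : (P * Z s) γ δ = ∑ b, n a b * (Z' γ (δ - unitVec b) - Z s γ (δ - unitVec b)) := by
      refine (mul_blockRow_apply (hlow s m) P γ hδ).trans ?_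
      split_ifs with hk'
      · rw [hP, diffPotential_apply n (hlow s)]
        rfl
      · refine (Finset.sum_eq_zero fun b _ => ?_).symm
        have h1 := longitude_le_sub_unitVec δ b
        rw [e0 _ (by omega), sub_self, mul_zero]
    rw [Matrix.sub_mul, Matrix.smul_mul, Matrix.one_mul, Matrix.sub_apply, Matrix.add_apply,
      Matrix.sub_apply, e1, e2, e3, Matrix.smul_apply, smul_eq_mul]
    simp only [mul_sub, Finset.sum_sub_distrib]
    ring
  · have p : pairing (Z s) (fun ε => G s m ε δ) = 0 := pairing_gaussS (h.det_ne s ht k hk) hδ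
    have q1 : pairing (nablaDir (n a) Z s) (fun ε => G s m ε δ) = 0 := by
      ext γ
      rw [pairing_nablaDir hB]
      refine Finset.sum_eq_zero fun b _ => ?_
      rw [← h.dT_pairing_blockRow hk (fun s hs => h.wave s hs δ) ht,
        dT_congr h.finOpen (g := fun _ => 0) (fun r hr => by
          rw [pairing_gaussS (h.det_ne r hr k hk) hδ, Pi.zero_apply]) _ ht, dT_const, mul_zero]
    -- Applying `L_{n_a} - q_a` to a column at `m` gives the column at `m + ε_a`, to which the row
    -- `Z'` is orthogonal.
    have q2 : pairing (shiftDir (n a) (q a) Z') (fun ε => G s m ε δ) = 0 := by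
      rw [pairing_shiftDir hB', ← funext (hs s ht δ)]
      exact pairing_gaussS (h'.det_ne s ht k hk) hδ
    rw [pairing_sub (Banded.nablaDir hB (n a) s) ((hB'.shiftDir _ _).add
      (((hB s).mul _).mono (Nat.le_succ _))), pairing_add (hB'.shiftDir _ _) ((hB s).mul _),
      pairing_mul (hB s), q1, q2, p, Matrix.mulVec_zero]
    simp

/-- The row identity `nablaDir_blockRow` paired with a wave. Its shifted term pairs to `T_a Ψ`,
since `Φ` obeys the same discrete rule as the columns of `G`. -/
theorem differenceSystem {m : Disc D} {a : SDir D} (h : MomentFamily O K fun s => G s m)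
    (h' : MomentFamily O K fun s => G s (m + Pi.single a 1))
    (hs : ∀ s ∈ O, ∀ δ, IsShift (n a) (q a) (fun ε => G s m ε δ)
      fun ε => G s (m + Pi.single a 1) ε δ)
    {k : ℕ} (hk : k ≤ K) {Φ : Times D → Disc D → MIdx D → ℂ}
    (hΦ : ∀ s ∈ O, WaveAt (fun s => Φ s m) s)
    {t : Times D} (ht : t ∈ O) (hΦs : IsShift (n a) (q a) (Φ t m) (Φ t (m + Pi.single a 1))) :
    DifferenceSystem dT n q (fun s m => gaussS (G s m)) k
      (fun s m => pairing (blockRow k (gaussS (G s m))) (Φ s m)) a t m := by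
  intro γ
  have hB : ∀ s m, Banded (blockRow k (gaussS (G s m))) (k + 1) :=
    fun s m => banded_blockRow (gaussS_lower _) k
  have e1 := pairing_nablaDir (fun s => hB s m) (n a) t (Φ t m) γ
  simp only [← h.dT_pairing_blockRow hk hΦ ht] at e1
  rw [nablaDir_blockRow h h' hs hk ht,
    pairing_add ((hB t _).shiftDir _ _) ((hB t m).mul _), pairing_mul (hB t m),
    pairing_shiftDir (hB t _), ← funext hΦs, Matrix.sub_mulVec, Matrix.smul_mulVec,
    Matrix.one_mulVec] at e1
  simp only [Pi.add_apply, Pi.sub_apply, Pi.smul_apply, smul_eq_mul] at e1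
  rw [← e1]
  ring

/-- The differential-difference equations. -/
theorem diffDiff {m : Disc D} {a c : SDir D} (h0 : MomentFamily O K fun s => G s m)
    (ha : MomentFamily O K fun s => G s (m + Pi.single a 1))
    (hc : MomentFamily O K fun s => G s (m + Pi.single c 1))
    (hac : MomentFamily O K fun s => G s (m + Pi.single a 1 + Pi.single c 1))
    (sa : ∀ s ∈ O, ∀ δ, IsShift (n a) (q a) (fun ε => G s m ε δ)
      fun ε => G s (m + Pi.single a 1) ε δ)
    (sc : ∀ s ∈ O, ∀ δ, IsShift (n c) (q c) (fun ε => G s m ε δ)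
      fun ε => G s (m + Pi.single c 1) ε δ)
    (sac : ∀ s ∈ O, ∀ δ, IsShift (n c) (q c) (fun ε => G s (m + Pi.single a 1) ε δ)
      fun ε => G s (m + Pi.single a 1 + Pi.single c 1) ε δ)
    (sca : ∀ s ∈ O, ∀ δ, IsShift (n a) (q a) (fun ε => G s (m + Pi.single c 1) ε δ)
      fun ε => G s (m + Pi.single a 1 + Pi.single c 1) ε δ)
    {k : ℕ} (hk : k + 1 ≤ K) {t : Times D} (ht : t ∈ O) :
    DiffDiffEquation dT n q k (fun s m => block (k + 1) k (gaussS (G s m))) a c t m := by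
  have hcomm : m + Pi.single a 1 + Pi.single c 1 = m + Pi.single c 1 + Pi.single a 1 :=
    add_right_comm _ _ _
  let β : Disc D → Times D → Matrix (Level D (k + 1)) (Level D k) ℂ :=
    fun m s => block (k + 1) k (gaussS (G s m))
  let N : SDir D → Matrix (Level D k) (Level D (k + 1)) ℂ := fun a => block k (k + 1) (slash (n a))
  let Z : Disc D → Times D → Matrix (Level D (k + 1)) (MIdx D) ℂ :=
    fun m s => blockRow (k + 1) (gaussS (G s m))
  let A : SDir D → Disc D → Times D → Matrix (Level D (k + 1)) (Level D (k + 1)) ℂ :=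
    fun a m s => q a • 1 - (β (m + Pi.single a 1) s - β m s) * N a
  have E1 : ∀ s ∈ O, nablaDir (n a) (Z m) s =
      shiftDir (n a) (q a) (Z (m + Pi.single a 1) s) + A a m s * Z m s :=
    fun s hs => nablaDir_blockRow h0 ha sa hk hs
  have E2 : ∀ s ∈ O, nablaDir (n c) (Z m) s =
      shiftDir (n c) (q c) (Z (m + Pi.single c 1) s) + A c m s * Z m s :=
    fun s hs => nablaDir_blockRow h0 hc sc hk hs
  have E3 : ∀ s ∈ O, nablaDir (n a) (Z (m + Pi.single c 1)) s =
      shiftDir (n a) (q a) (Z (m + Pi.single a 1 + Pi.single c 1) s) +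
      A a (m + Pi.single c 1) s * Z (m + Pi.single c 1) s := fun s hs => by
    rw [hcomm] at hac sca ⊢
    exact nablaDir_blockRow hc hac sca hk hs
  have E4 : ∀ s ∈ O, nablaDir (n c) (Z (m + Pi.single a 1)) s =
      shiftDir (n c) (q c) (Z (m + Pi.single a 1 + Pi.single c 1) s) +
      A c (m + Pi.single a 1) s * Z (m + Pi.single a 1) s :=
    fun s hs => nablaDir_blockRow ha hac sac hk hs
  have hZ0 : ∀ s ∈ O, MHolAt (Z m) s := fun s hs => h0.mHolAt hk hs
  have hZa : MHolAt (Z (m + Pi.single a 1)) t := ha.mHolAt hk ht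
  have hZc : MHolAt (Z (m + Pi.single c 1)) t := hc.mHolAt hk ht
  have hβ0 : MHolAt (β m) t := h0.mHolAt_block hk k ht
  have hβa : MHolAt (β (m + Pi.single a 1)) t := ha.mHolAt_block hk k ht
  have hβc : MHolAt (β (m + Pi.single c 1)) t := hc.mHolAt_block hk k ht
  have hAa : MHolAt (A a m) t := (MHolAt.const _).sub ((hβa.sub hβ0).mul (MHolAt.const _))
  have hAc : MHolAt (A c m) t := (MHolAt.const _).sub ((hβc.sub hβ0).mul (MHolAt.const _))
  have dA : ∀ a x : SDir D, MHolAt (β (m + Pi.single a 1)) t →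
      mderiv dT (unitVec x) (A a m) t = -((mderiv dT (unitVec x) (β (m + Pi.single a 1)) t -
        mderiv dT (unitVec x) (β m) t) * N a) := by
    intro a x hβa
    refine (mderiv_sub _ (MHolAt.const _) ((hβa.sub hβ0).mul (MHolAt.const _))).trans ?_
    rw [mderiv_const, zero_sub, mderiv_mul_const _ (hβa.sub hβ0), mderiv_sub _ hβa hβ0]
  -- the two ways of computing the mixed derivative
  have L1 : nablaDir (n a) (nablaDir (n c) (Z m)) t =
      shiftDir (n c) (q c) (shiftDir (n a) (q a) (Z (m + Pi.single a 1 + Pi.single c 1) t)) +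
      A a (m + Pi.single c 1) t * (nablaDir (n c) (Z m) t - A c m t * Z m t) +
      ((∑ b, n a b • mderiv dT (unitVec b) (A c m) t) * Z m t +
        A c m t * nablaDir (n a) (Z m) t) := by
    rw [nablaDir_congr h0.finOpen E2 (n a) ht,
      nablaDir_add (n a) (hZc.shiftDir _ _) (hAc.mul (hZ0 t ht)), nablaDir_shiftDir _ _ _ hZc,
      nablaDir_mul _ hAc (hZ0 t ht), E3 t ht, shiftDir_add, shiftDir_mul, E2 t ht,
      add_sub_cancel_right]
  have L2 : nablaDir (n c) (nablaDir (n a) (Z m)) t =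
      shiftDir (n a) (q a) (shiftDir (n c) (q c) (Z (m + Pi.single a 1 + Pi.single c 1) t)) +
      A c (m + Pi.single a 1) t * (nablaDir (n a) (Z m) t - A a m t * Z m t) +
      ((∑ b, n c b • mderiv dT (unitVec b) (A a m) t) * Z m t +
        A a m t * nablaDir (n c) (Z m) t) := by
    rw [nablaDir_congr h0.finOpen E1 (n c) ht,
      nablaDir_add (n c) (hZa.shiftDir _ _) (hAa.mul (hZ0 t ht)), nablaDir_shiftDir _ _ _ hZa,
      nablaDir_mul _ hAa (hZ0 t ht), E4 t ht, shiftDir_add, shiftDir_mul, E1 t ht,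
      add_sub_cancel_right]
  -- In both expansions the singly shifted rows have been eliminated through the linear systems `E1`
  -- and `E2`. Only `Z m`, its first derivatives and the doubly shifted row remain; the last is
  -- common to both sides because the discrete shifts commute.
  have key := nablaDir_comm hZ0 (n a) (n c) ht
  rw [L1, L2, shiftDir_shiftDir] at key
  have key1 := congrArg (blockCol (k + 1)) key
  have eN : ∀ a, blockCol (k + 1) (nablaDir (n a) (Z m) t) = β m t * N a := by
    intro a
    have e : N a = ∑ b, n a b • up k b := by
      ext i j
      simp [N, block, slash, up, Matrix.sum_apply]
    rw [nablaDir, blockCol_sum, e, Matrix.mul_sum]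
    refine Finset.sum_congr rfl fun b _ => ?_
    rw [blockCol_smul, Matrix.mul_smul]
    congr 1
    exact blockCol_nabla (fun s => gaussS_lower (G s m)) k b t
  have eZ : blockCol (k + 1) (Z m t) = 1 := blockCol_blockRow (gaussS_lower _) _
  let L : SDir D → Disc D → Matrix (Level D (k + 1)) (Level D k) ℂ :=
    fun a m => ∑ b, n a b • mderiv dT (unitVec b) (β m) t
  have eS : ∀ a c, MHolAt (β (m + Pi.single c 1)) t →
      ∑ b, n a b • mderiv dT (unitVec b) (A c m) t =
        -((L a (m + Pi.single c 1) - L a m) * N c) := by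
    intro a c hβc
    simp only [dA c _ hβc, L, smul_neg, Finset.sum_neg_distrib, ← Finset.sum_sub_distrib,
      ← smul_sub, Matrix.sum_mul, Matrix.smul_mul]
  have eA : ∀ a m, A a m t = q a • 1 - (β (m + Pi.single a 1) t - β m t) * N a := fun _ _ => rfl
  simp only [blockCol_add, blockCol_sub, blockCol_mul, eN, eZ, Matrix.mul_one, eS a c hβc,
    eS c a hβa, eA] at key1
  show (L a (m + Pi.single c 1) + (β (m + Pi.single c 1 + Pi.single a 1) t -
        β (m + Pi.single c 1) t) * (q a • 1 + N a * β (m + Pi.single c 1) t) -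
      (L a m + (β (m + Pi.single a 1) t - β m t) * (q a • 1 + N a * β m t))) * N c =
    (L c (m + Pi.single a 1) + (β (m + Pi.single a 1 + Pi.single c 1) t -
        β (m + Pi.single a 1) t) * (q c • 1 + N c * β (m + Pi.single a 1) t) -
      (L c m + (β (m + Pi.single c 1) t - β m t) * (q c • 1 + N c * β m t))) * N a
  rw [← hcomm] at key1 ⊢
  simp only [Matrix.add_mul, Matrix.sub_mul, Matrix.mul_add, Matrix.mul_sub, Matrix.smul_mul,
    Matrix.mul_smul, Matrix.one_mul, Matrix.mul_one, Matrix.mul_assoc] at key1 ⊢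
  linear_combination (norm := module) key1.symm

end Difference

/-! ### Integration of continuous functions on the torus -/

/-- From the Jordan decomposition: a difference is bounded by the sum of the positive and negative
parts. -/
lemma enorm_le_totalVariation {X : Type*} [MeasurableSpace X] (s : SignedMeasure X) {E : Set X}
    (hE : MeasurableSet E) : ‖s E‖ₑ ≤ s.totalVariation E := by
  have h := congrArg (fun v : SignedMeasure X => v E) s.toSignedMeasure_toJordanDecomposition
  simp only [JordanDecomposition.toSignedMeasure, _root_.sub_apply,
    Measure.toSignedMeasure_apply_measurable hE] at h
  rw [← h, SignedMeasure.totalVariation, Measure.add_apply]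
  refine (enorm_sub_le).trans (add_le_add ?_ ?_) <;>
  · rw [Real.enorm_of_nonneg measureReal_nonneg, ofReal_measureReal]

/-- The variation is dominated by the total variations of the real and imaginary parts, which are
finite. Continuous functions on the torus thus become integrable. -/
instance isFiniteMeasure_variation {X : Type*} [MeasurableSpace X] (μ : ComplexMeasure X) :
    IsFiniteMeasure μ.variation := by
  have hle : μ.variation ≤ (ComplexMeasure.re μ).totalVariation +
      (ComplexMeasure.im μ).totalVariation := by
    refine VectorMeasure.variation_le_of_forall_enorm_le fun E hE => ?_
    rw [Measure.add_apply]
    refine le_trans ?_ (add_le_add (enorm_le_totalVariation _ hE) (enorm_le_totalVariation _ hE))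
    show ‖μ E‖ₑ ≤ ‖(μ E).re‖ₑ + ‖(μ E).im‖ₑ
    simp only [enorm_eq_nnnorm, ← ENNReal.coe_add, ENNReal.coe_le_coe]
    exact Complex.norm_le_abs_re_add_abs_im _
  exact isFiniteMeasure_of_le _ hle

instance compactSpace_unitTorus : CompactSpace (UnitTorus D) := by
  suffices h : IsCompact {z : Fin D → ℂ | ∀ i, ‖z i‖ = 1} from isCompact_iff_compactSpace.mp h
  have : {z : Fin D → ℂ | ∀ i, ‖z i‖ = 1} = Set.pi Set.univ fun _ => Metric.sphere 0 1 := by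
    ext z; simp
  rw [this]
  exact isCompact_univ_pi fun _ => isCompact_sphere _ _

lemma integrable_continuousMap (μ : ComplexMeasure (UnitTorus D)) (f : C(UnitTorus D, ℂ)) :
    Integrable f μ.variation :=
  (integrable_const ‖f‖).mono' f.continuous.aestronglyMeasurable
    (Eventually.of_forall fun z => f.norm_coe_le_norm z)

/-- Integration against a complex measure, as a functional on continuous functions. -/
def integralFunctional (μ : ComplexMeasure (UnitTorus D)) : C(UnitTorus D, ℂ) →L[ℂ] ℂ :=
  LinearMap.mkContinuous
    { toFun := fun f => VectorMeasure.integral μ f (ContinuousLinearMap.mul ℝ ℂ)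
      map_add' := fun f g => VectorMeasure.integral_add (integrable_continuousMap μ f)
        (integrable_continuousMap μ g)
      -- The integral is formed with the real-bilinear product; complex homogeneity holds because
      -- this product also commutes with complex scalars.
      map_smul' := fun c f => setToFun_smul (𝕜 := ℂ) _
        (fun c s x => by
          simp only [transpose_eq_cbmApplyMeasure, cbmApplyMeasure_apply]
          simp [mul_assoc]) c f }
    (‖ContinuousLinearMap.mul ℝ ℂ‖ * μ.variation.real Set.univ) fun f => by
      refine (VectorMeasure.norm_integral_le_of_norm_le_const (C := ‖f‖)
        (Eventually.of_forall fun z => f.norm_coe_le_norm z)).trans_eq ?_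
      ring

/-- `J` is a functional which on continuous functions is the bounded linear functional `I`. -/
def Represents (J : (UnitTorus D → ℂ) → ℂ) (I : C(UnitTorus D, ℂ) →L[ℂ] ℂ) : Prop :=
  ∀ f : C(UnitTorus D, ℂ), J f = I f

/-! ### Laurent monomials and the deformation factor -/

lemma mono_add {z : Fin D → ℂ} (hz : ∀ i, z i ≠ 0) (α β : MIdx D) :
    mono z (α + β) = mono z α * mono z β := by
  simp only [mono, ← Finset.prod_mul_distrib, Pi.add_apply]
  exact Finset.prod_congr rfl fun i _ => zpow_add₀ (hz i) _ _

lemma unitTorus_ne_zero (z : UnitTorus D) (i : Fin D) : z.1 i ≠ 0 := by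
  intro h
  have := z.2 i
  simp [h] at this

lemma norm_mono (z : UnitTorus D) (α : MIdx D) : ‖mono z.1 α‖ = 1 := by
  simp [mono, norm_prod, z.2]

lemma continuous_mono (α : MIdx D) : Continuous fun z : UnitTorus D => mono z.1 α :=
  continuous_finsetProd _ fun i _ =>
    ((continuous_apply i).comp continuous_subtype_val).zpow₀ _ fun z => Or.inl (unitTorus_ne_zero z i)

/-- The Laurent monomial as a continuous function on the torus. -/
def monoMap (α : MIdx D) : C(UnitTorus D, ℂ) := ⟨_, continuous_mono α⟩

/-! ### Dependence of the deformation factor and of the moments on the times. -/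

section Deformation

variable {n : SDir D → SDir D → ℂ} {q : SDir D → ℂ}

lemma hasSum_slice {N : ℕ} (v : Fin N → MIdx D) (r : Fin N → ℂ) (z : Fin D → ℂ) :
    HasSum (fun α => slice v r α * mono z α) (∑ j, r j * mono z (v j)) := by
  have : (fun α => slice v r α * mono z α) =
      fun α => ∑ j, (Pi.single (v j) (r j) : Times D) α * mono z α := by
    funext α
    rw [slice, Finset.sum_apply, Finset.sum_mul]
  rw [this]
  refine hasSum_sum fun j _ => ?_
  have := hasSum_single (f := fun α => (Pi.single (v j) (r j) : Times D) α * mono z α) (v j)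
    fun α hα => by rw [Pi.single_eq_of_ne hα, zero_mul]
  simpa using this

lemma summable_norm_slice {N : ℕ} (v : Fin N → MIdx D) (r : Fin N → ℂ) (z : Fin D → ℂ) :
    Summable fun α => ‖slice v r α * mono z α‖ :=
  (hasSum_slice v r z).summable.norm

lemma VacuumDefined.slice {t : Times D} {m : Disc D} {z : Fin D → ℂ}
    (h : VacuumDefined n q t m z) {N : ℕ} (v : Fin N → MIdx D) (r : Fin N → ℂ) :
    VacuumDefined n q (t + slice v r) m z where
  summable := by
    refine Summable.of_nonneg_of_le (fun _ => norm_nonneg _) (fun α => ?_)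
      (h.summable.add (summable_norm_slice v r z))
    rw [Pi.add_apply, add_mul]
    exact norm_add_le _ _
  ne_zero := h.ne_zero

/-- Changing finitely many times multiplies the factor by the exponential of a Laurent polynomial.
-/
lemma vacuum_slice {t : Times D} {m : Disc D} {z : Fin D → ℂ}
    (h : VacuumDefined n q t m z) {N : ℕ} (v : Fin N → MIdx D) (r : Fin N → ℂ) :
    vacuum n q (t + slice v r) m z =
      vacuum n q t m z * Complex.exp (∑ j, r j * mono z (v j)) := by
  have h1 := h.summable.of_norm.hasSum.add (hasSum_slice v r z)
  have h2 : ∑' α, (t + TorusKP.slice v r) α * mono z α =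
      ∑' α, t α * mono z α + ∑ j, r j * mono z (v j) := by
    rw [← h1.tsum_eq]
    exact tsum_congr fun α => by rw [Pi.add_apply, add_mul]
  rw [vacuum, vacuum, h2, Complex.exp_add]
  ring

lemma vacuum_single {t : Times D} {m : Disc D} {z : Fin D → ℂ}
    (h : VacuumDefined n q t m z) (a : SDir D) :
    vacuum n q t (m + Pi.single a 1) z = vacuum n q t m z * (laurent (n a) z - q a) := by
  rw [vacuum, vacuum, mul_assoc]
  congr 1
  rw [← Finset.mul_prod_erase _ _ (Finset.mem_univ a),
    ← Finset.mul_prod_erase _ (fun a => (laurent (n a) z - q a) ^ m a) (Finset.mem_univ a)]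
  have e1 : ∀ b ∈ Finset.univ.erase a, (laurent (n b) z - q b) ^ (m + Pi.single a 1 : Disc D) b =
      (laurent (n b) z - q b) ^ m b := fun b hb => by
    rw [Pi.add_apply, Pi.single_eq_of_ne (Finset.ne_of_mem_erase hb), add_zero]
  rw [Finset.prod_congr rfl e1, Pi.add_apply, Pi.single_eq_same]
  have e2 : (laurent (n a) z - q a) ^ (m a + 1) =
      (laurent (n a) z - q a) ^ m a * (laurent (n a) z - q a) := by
    -- At a zero of `L_{n_a} - q_a`, definedness forces `m_a ≥ 0`. Then the exponent `m_a + 1` is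
    -- nonzero and both sides vanish, even when `m_a = 0`.
    by_cases h0 : laurent (n a) z - q a = 0
    · have h1 : 0 ≤ m a := by
        by_contra hneg
        exact h.ne_zero a (not_le.mp hneg) (sub_eq_zero.mp h0)
      rw [h0, mul_zero, _root_.zero_zpow _ (by omega)]
    · exact zpow_add_one₀ h0 _
  rw [e2]
  ring

lemma continuous_vacuum {t : Times D} {m : Disc D}
    (h : ∀ z : UnitTorus D, VacuumDefined n q t m z.1) :
    Continuous fun z : UnitTorus D => vacuum n q t m z.1 := by
  -- At the point `(1, …, 1)` all monomials are `1`. Absolute convergence there bounds the series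
  -- uniformly on the torus.
  have hs : Summable fun α => ‖t α‖ := by
    have := (h ⟨fun _ => 1, fun _ => by simp⟩).summable
    simpa [mono] using this
  refine (Complex.continuous_exp.comp ?_).mul ?_
  · exact continuous_tsum (fun α => continuous_const.mul (continuous_mono α)) hs
      fun α z => by rw [norm_mul, norm_mono, mul_one]
  · refine continuous_finsetProd _ fun a _ => Continuous.zpow₀ ?_ _ fun z => ?_
    · exact (continuous_finsetSum _ fun b _ =>
        continuous_const.mul (continuous_mono (unitVec b))).sub continuous_const
    · by_cases hm : 0 ≤ m a
      · exact Or.inr hm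
      · exact Or.inl (sub_ne_zero.mpr ((h z).ne_zero a (not_le.mp hm)))

/-! ### Moment matrices of functionals -/

/-- The moment matrix of a functional. -/
def genMoment (J : (UnitTorus D → ℂ) → ℂ) (n : SDir D → SDir D → ℂ) (q : SDir D → ℂ)
    (t : Times D) (m : Disc D) : BMat D := fun γ δ =>
  J fun z => vacuum n q t m z.1 * mono z.1 (γ - δ)

variable {J : (UnitTorus D → ℂ) → ℂ} {I : C(UnitTorus D, ℂ) →L[ℂ] ℂ}

/-- The deformation factor as a continuous function on the torus. -/
def vacuumMap {t : Times D} {m : Disc D} (h : ∀ z : UnitTorus D, VacuumDefined n q t m z.1) :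
    C(UnitTorus D, ℂ) := ⟨_, continuous_vacuum h⟩

lemma genMoment_eq (hJ : Represents J I) {t : Times D} {m : Disc D}
    (h : ∀ z : UnitTorus D, VacuumDefined n q t m z.1) (γ δ : MIdx D) :
    genMoment J n q t m γ δ = I (vacuumMap h * monoMap (γ - δ)) :=
  hJ (vacuumMap h * monoMap (γ - δ))

lemma exp_continuousMap_apply (f : C(UnitTorus D, ℂ)) (z : UnitTorus D) :
    NormedSpace.exp f z = Complex.exp (f z) := by
  rw [Complex.exp_eq_exp_ℂ]
  exact NormedSpace.map_exp (ContinuousMap.evalAlgHom ℂ ℂ z) (continuous_eval_const z) f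

/-- All dependence on the chosen times is moved into an exponential in the Banach algebra
`C(UnitTorus D, ℂ)`, followed by a bounded linear map. -/
lemma genMoment_slice (hJ : Represents J I) {t : Times D} {m : Disc D}
    (h : ∀ z : UnitTorus D, VacuumDefined n q t m z.1) (γ δ : MIdx D) {N : ℕ}
    (v : Fin N → MIdx D) (r : Fin N → ℂ) :
    genMoment J n q (t + slice v r) m γ δ =
      I (vacuumMap h * monoMap (γ - δ) * NormedSpace.exp (∑ j, r j • monoMap (v j))) := by
  rw [genMoment_eq hJ fun z => (h z).slice v r]
  congr 1
  ext z
  simp only [ContinuousMap.mul_apply, exp_continuousMap_apply, ContinuousMap.sum_apply,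
    ContinuousMap.smul_apply, smul_eq_mul]
  show vacuum n q (t + slice v r) m z.1 * _ = vacuum n q t m z.1 * _ * _
  rw [vacuum_slice (h z)]
  show _ * Complex.exp (∑ j, r j * mono z.1 (v j)) * _ =
    _ * _ * Complex.exp (∑ j, r j * mono z.1 (v j))
  ring

/-- The Banach algebra exponential is analytic. Differentiating `exp(x z^α)` at `x = 0` inserts the
monomial `z^α`, which raises the row index from `ε` to `ε + α`. -/
lemma waveAt_genMoment (hJ : Represents J I) {t : Times D} {m : Disc D}
    (h : ∀ z : UnitTorus D, VacuumDefined n q t m z.1) (δ : MIdx D) :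
    WaveAt (fun s ε => genMoment J n q s m ε δ) t := by
  set M : C(UnitTorus D, ℂ) → (C(UnitTorus D, ℂ) →L[ℂ] ℂ) := fun W =>
    I.comp (ContinuousLinearMap.mul ℂ C(UnitTorus D, ℂ) W)
  refine ⟨fun ε N v => ?_, fun α ε => ?_⟩
  · show AnalyticAt ℂ (fun r => genMoment J n q (t + slice v r) m ε δ) 0
    simp only [genMoment_slice hJ h]
    have h1 : AnalyticAt ℂ (fun r : Fin N → ℂ => ∑ j, r j • monoMap (v j)) 0 :=
      Finset.analyticAt_fun_sum _ fun j _ =>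
        ((ContinuousLinearMap.proj (R := ℂ) (φ := fun _ : Fin N => ℂ) j).analyticAt 0).smul
          analyticAt_const
    exact ((M (vacuumMap h * monoMap (ε - δ))).analyticAt _).comp
      ((NormedSpace.exp_analytic _).comp h1)
  · apply dT_eq_of_hasDerivAt
    have e : ∀ x : ℂ, genMoment J n q (t + Pi.single α x) m ε δ =
        M (vacuumMap h * monoMap (ε - δ)) (NormedSpace.exp (x • monoMap α)) := fun x => by
      have := genMoment_slice hJ h ε δ (fun _ : Fin 1 => α) (fun _ => x)
      simp only [slice, Finset.univ_unique, Finset.sum_singleton] at this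
      exact this
    simp only [e]
    have h1 := hasDerivAt_exp_smul_const (𝕂 := ℂ) (monoMap α : C(UnitTorus D, ℂ)) (0 : ℂ)
    have h2 := (M (vacuumMap h * monoMap (ε - δ))).hasFDerivAt.comp_hasDerivAt (0 : ℂ) h1
    refine h2.congr_deriv ?_
    rw [genMoment_eq hJ h]
    symm
    show I _ = I _
    congr 1
    ext z
    show vacuum n q t m z.1 * mono z.1 (ε + α - δ) =
      vacuum n q t m z.1 * mono z.1 (ε - δ) * (NormedSpace.exp ((0 : ℂ) • monoMap α) z * mono z.1 α)
    rw [zero_smul, NormedSpace.exp_zero, ContinuousMap.one_apply, one_mul, mul_assoc,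
      ← mono_add (unitTorus_ne_zero z), sub_add_eq_add_sub]

lemma isShift_vacuum {t : Times D} {m : Disc D} {z : Fin D → ℂ} (hz : ∀ i, z i ≠ 0)
    (h : VacuumDefined n q t m z) (a : SDir D) :
    IsShift (n a) (q a) (fun ε => vacuum n q t m z * mono z ε)
      fun ε => vacuum n q t (m + Pi.single a 1) z * mono z ε := by
  intro ε
  simp only [vacuum_single h, laurent, mono_add hz, mul_sub, sub_mul, Finset.mul_sum,
    Finset.sum_mul]
  congr 1
  · exact Finset.sum_congr rfl fun b _ => by ring
  · ring

lemma isShift_genMoment (hJ : Represents J I) {t : Times D} {m : Disc D} {a : SDir D}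
    (h : ∀ z : UnitTorus D, VacuumDefined n q t m z.1)
    (h' : ∀ z : UnitTorus D, VacuumDefined n q t (m + Pi.single a 1) z.1) (δ : MIdx D) :
    IsShift (n a) (q a) (fun ε => genMoment J n q t m ε δ)
      fun ε => genMoment J n q t (m + Pi.single a 1) ε δ := by
  intro ε
  simp only [genMoment_eq hJ h, genMoment_eq hJ h']
  rw [← smul_eq_mul (q a), ← map_smul]
  simp only [← smul_eq_mul (n a _), ← map_smul, ← map_sum, ← map_sub]
  congr 1
  ext z
  simp only [ContinuousMap.sub_apply, ContinuousMap.sum_apply, ContinuousMap.smul_apply,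
    ContinuousMap.mul_apply, smul_eq_mul]
  have := isShift_vacuum (unitTorus_ne_zero z) (h z) a (ε - δ)
  simp only [sub_add_eq_add_sub] at this
  exact this

lemma waveAt_vacuum {t : Times D} {m : Disc D} {z : Fin D → ℂ} (hz : ∀ i, z i ≠ 0)
    (h : VacuumDefined n q t m z) : WaveAt (fun s ε => vacuum n q s m z * mono z ε) t := by
  refine ⟨fun ε N v => ?_, fun α ε => ?_⟩
  · show AnalyticAt ℂ (fun r => vacuum n q (t + slice v r) m z * mono z ε) 0
    simp only [vacuum_slice h]
    refine (analyticAt_const.mul (AnalyticAt.cexp ?_)).mul analyticAt_const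
    exact Finset.analyticAt_fun_sum _ fun j _ =>
      ((ContinuousLinearMap.proj (R := ℂ) (φ := fun _ : Fin N => ℂ) j).analyticAt 0).mul
        analyticAt_const
  · apply dT_eq_of_hasDerivAt
    have e : ∀ x : ℂ, vacuum n q (t + Pi.single α x) m z * mono z ε =
        vacuum n q t m z * Complex.exp (x * mono z α) * mono z ε := fun x => by
      have := vacuum_slice h (fun _ : Fin 1 => α) (fun _ => x)
      simp only [slice, Finset.univ_unique, Finset.sum_singleton] at this
      rw [this]
    simp only [e, mono_add hz]
    have h1 : HasDerivAt (fun x : ℂ => x * mono z α) (mono z α) 0 := by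
      simpa using (hasDerivAt_id (0 : ℂ)).mul_const (mono z α)
    refine ((h1.cexp.const_mul (vacuum n q t m z)).mul_const (mono z ε)).congr_deriv ?_
    rw [zero_mul, Complex.exp_zero]
    ring

/-! ### The set of times with a Gauss–Borel factorization up to a given size -/

lemma finOpen_vacuumDefined (m : Disc D) (z : Fin D → ℂ) :
    FinOpen {s | VacuumDefined n q s m z} := fun _ hs _ v =>
  Eventually.of_forall fun r => VacuumDefined.slice hs v r

/-- The times at which the deformed measure is defined and the truncations of its moment matrix up
to size `K` are nonsingular. -/
def regularSet (J : (UnitTorus D → ℂ) → ℂ) (n : SDir D → SDir D → ℂ) (q : SDir D → ℂ)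
    (K : ℕ) (m : Disc D) : Set (Times D) :=
  {s | (∀ z : UnitTorus D, VacuumDefined n q s m z.1) ∧
    ∏ k ∈ Finset.range (K + 1), (trunc k (genMoment J n q s m)).det ≠ 0}

/-- Finitely many determinants are involved, so their product is holomorphic and its nonvanishing is
an open condition on slices. Full quasi-definiteness imposes infinitely many such conditions, and
openness could be lost. -/
lemma finOpen_regularSet (hJ : Represents J I) (K : ℕ) (m : Disc D) :
    FinOpen (regularSet J n q K m) := by
  have h : FinOpen {s : Times D | ∀ z : UnitTorus D, VacuumDefined n q s m z.1} :=
    fun s hs N v => Eventually.of_forall fun r z => (hs z).slice v r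
  exact h.ne_zero fun s hs => HolAt.prod _ fun k _ => HolAt.det fun i j =>
    (waveAt_genMoment hJ hs j.1).hol i.1

lemma det_ne_of_mem_regularSet {K : ℕ} {m : Disc D} {s : Times D}
    (hs : s ∈ regularSet J n q K m) {k : ℕ} (hk : k ≤ K) :
    (trunc k (genMoment J n q s m)).det ≠ 0 :=
  Finset.prod_ne_zero_iff.mp hs.2 k (by simpa [Nat.lt_succ_iff] using hk)

lemma momentFamily_genMoment (hJ : Represents J I) {K : ℕ} {m : Disc D} {O : Set (Times D)}
    (hO : FinOpen O) (h : O ⊆ regularSet J n q K m) :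
    MomentFamily O K fun s => genMoment J n q s m where
  finOpen := hO
  wave _ hs δ := waveAt_genMoment hJ (h hs).1 δ
  det_ne _ hs _ hk := det_ne_of_mem_regularSet (h hs) hk

end Deformation

/-! ### The second wave matrix -/

/-- `S G Ŝ† = H` on the truncations up to the first singular one. -/
lemma gauss_mul_of_det_ne {G : BMat D} {K : ℕ} (hG : ∀ k ≤ K, (trunc k G).det ≠ 0) :
    trunc K (gaussS G) * trunc K G * (trunc K (gaussSh G))ᴴ = trunc K (gaussH G) := by
  have orth : ∀ {A : BMat D}, (∀ k ≤ K, (trunc k A).det ≠ 0) → ∀ γ δ : Low D K,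
      longitude δ.1 < longitude γ.1 → (trunc K (gaussS A) * trunc K A) γ δ = 0 := by
    intro A hA γ δ h
    have e := congrFun (pairing_gaussS (hA _ γ.2.le) h) ⟨γ.1, rfl⟩
    have hB : Banded (blockRow (longitude γ.1) (gaussS A)) K :=
      (banded_blockRow (gaussS_lower A) _).mono γ.2
    rw [pairing_eq_sum hB] at e
    exact (sum_low K fun ε => gaussS A γ ε * A ε δ).trans e
  -- The part above the block diagonal is treated by adjoints: the rows of `gaussS Gᴴ` are
  -- orthogonal to the low columns of `Gᴴ`.
  have hGH : ∀ k ≤ K, (trunc k Gᴴ).det ≠ 0 := fun k hk => by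
    rw [show trunc k Gᴴ = (trunc k G)ᴴ from rfl, Matrix.det_conjTranspose]
    exact star_ne_zero.mpr (hG k hk)
  ext γ δ
  by_cases hlt : longitude γ.1 < longitude δ.1
  · have e0 : trunc K (gaussH G) γ δ = 0 := by simp [trunc, gaussH, hlt.ne]
    rw [e0, Matrix.mul_assoc, Matrix.mul_apply]
    refine Finset.sum_eq_zero fun ε _ => ?_
    by_cases h : longitude ε.1 < longitude δ.1
    · have := congrArg star (orth hGH δ ε h)
      rw [star_zero, ← Matrix.conjTranspose_apply, Matrix.conjTranspose_mul] at this
      rw [show trunc K G = (trunc K Gᴴ)ᴴ by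
        rw [show trunc K Gᴴ = (trunc K G)ᴴ from rfl, Matrix.conjTranspose_conjTranspose]]
      exact mul_eq_zero_of_right _ this
    · have hne : γ.1 ≠ ε.1 := by intro e; rw [e] at hlt; omega
      have : trunc K (gaussS G) γ ε = 0 := by
        show gaussS G γ ε = 0
        rw [gaussS_lower _ _ _ (by omega), if_neg hne]
      rw [this, zero_mul]
  · rw [not_lt] at hlt
    rw [Matrix.mul_apply, Finset.sum_eq_single δ]
    · have e1 : (trunc K (gaussSh G))ᴴ δ δ = 1 := by
        show star (gaussS Gᴴ δ δ) = 1
        rw [gaussS_lower _ _ _ le_rfl, if_pos rfl, star_one]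
      rw [e1, mul_one]
      rcases hlt.lt_or_eq with h | h
      · rw [orth hG γ δ h]
        simp [trunc, gaussH, h.ne']
      · refine (sum_gaussS_mul G γ δ.1).trans ?_
        simp [trunc, gaussH, h]
    · intro ε _ hε
      by_cases h : longitude ε.1 < longitude δ.1
      · rw [orth hG γ ε (by omega), zero_mul]
      · have : (trunc K (gaussSh G))ᴴ ε δ = 0 := by
          show star (gaussS Gᴴ δ ε) = 0
          rw [gaussS_lower _ _ _ (not_lt.mp h), if_neg fun e => hε (Subtype.ext e.symm), star_zero]
        rw [this, mul_zero]
    · simp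

/-- The factorization gives `H (Ŝ⁻¹)† = S G`. The coefficients of the second Baker function are thus
pairings of the rows of `S` with columns of `G`, which are waves. -/
lemma waveTwo_eq_pairing {G : BMat D} {k : ℕ} (γ : Level D k) (δ : MIdx D)
    (hG : ∀ j ≤ k + longitude δ + 1, (trunc j G).det ≠ 0) :
    waveTwo (gaussH G) (gaussSh G) γ δ =
      pairing (blockRow k (gaussS G)) (fun ε => G ε δ) γ := by
  obtain ⟨γ, rfl⟩ := γ
  have hB : Banded (blockRow (longitude γ) (gaussS G)) (longitude γ + longitude δ + 1) :=
    (banded_blockRow (gaussS_lower G) _).mono (by omega)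
  rw [pairing_eq_sum hB]
  have uSh : IsUnit (trunc (longitude γ + longitude δ + 1) (gaussSh G))ᴴ.det := by
    have h1 : (trunc (longitude γ + longitude δ + 1) (gaussSh G)).det = 1 :=
      det_trunc_of_lower (gaussS_lower Gᴴ) _
    rw [Matrix.det_conjTranspose, h1]; simp
  rw [waveTwo, ← gauss_mul_of_det_ne hG, Matrix.conjTranspose_nonsing_inv,
    Matrix.mul_nonsing_inv_cancel_right _ _ uSh]
  exact sum_low _ fun ε => gaussS G γ ε * G ε δ

lemma pairing_eq_lop (S : BMat D) (hS : IsLowerUnitriangular S) (x : ℂ) (z : Fin D → ℂ) {k : ℕ}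
    (γ : Level D k) :
    pairing (blockRow k S) (fun ε => x * mono z ε) γ = x * lop S z γ := by
  obtain ⟨γ, rfl⟩ := γ
  rw [pairing_eq_sum (banded_blockRow hS _), lop, sum_low _ fun ε => S γ ε * mono z ε,
    Finset.mul_sum]
  exact Finset.sum_congr rfl fun ε _ => mul_left_comm _ _ _

lemma SchrodingerSystem.congr {O : Set (Times D)} (hO : FinOpen O) {S : Times D → BMat D} {k : ℕ}
    {Ψ Ψ' : Times D → Level D k → ℂ} (h : ∀ s ∈ O, Ψ s = Ψ' s) {t : Times D} (ht : t ∈ O)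
    (hΨ : SchrodingerSystem dT S k Ψ t) : SchrodingerSystem dT S k Ψ' t := by
  intro a b γ
  have e : ∀ x : MIdx D, ∀ s ∈ O, dT x (fun s => Ψ s γ) s = dT x (fun s => Ψ' s γ) s :=
    fun x s hs => dT_congr hO (fun r hr => by rw [h r hr]) x hs
  have := hΨ a b γ
  rwa [e _ t ht, dT_congr hO (e _) _ ht, h t ht] at this

lemma DifferenceSystem.congr {O : Set (Times D)} (hO : FinOpen O) {n : SDir D → SDir D → ℂ}
    {q : SDir D → ℂ} {S : Times D → Disc D → BMat D} {k : ℕ} {a : SDir D} {m : Disc D}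
    {Ψ Ψ' : Times D → Disc D → Level D k → ℂ} {t : Times D} (ht : t ∈ O)
    (h : ∀ s ∈ O, Ψ s m = Ψ' s m) (h' : Ψ t (m + Pi.single a 1) = Ψ' t (m + Pi.single a 1))
    (hΨ : DifferenceSystem dT n q S k Ψ a t m) : DifferenceSystem dT n q S k Ψ' a t m := by
  intro γ
  have e : ∀ x : MIdx D, dT x (fun s => Ψ s m γ) t = dT x (fun s => Ψ' s m γ) t :=
    fun x => dT_congr hO (fun r hr => by rw [h r hr]) x ht
  have := hΨ γ
  simp only [e, h', h t ht] at this
  exact this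

/-! ### The equations for the moment matrix of a functional -/

section Functional

variable {n : SDir D → SDir D → ℂ} {q : SDir D → ℂ} {J : (UnitTorus D → ℂ) → ℂ}
  {I : C(UnitTorus D, ℂ) →L[ℂ] ℂ}

/-- The deformed functional is defined and its moment matrix is quasi-definite. -/
def Regular (J : (UnitTorus D → ℂ) → ℂ) (n : SDir D → SDir D → ℂ) (q : SDir D → ℂ)
    (t : Times D) (m : Disc D) : Prop :=
  (∀ z : UnitTorus D, VacuumDefined n q t m z.1) ∧ QuasiDefinite (genMoment J n q t m)

lemma Regular.mem {t : Times D} {m : Disc D} (h : Regular J n q t m) (K : ℕ) :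
    t ∈ regularSet J n q K m :=
  ⟨h.1, Finset.prod_ne_zero_iff.mpr fun k _ => h.2 k⟩

variable {t : Times D} {m : Disc D}

lemma holAt_gaussS_genMoment (hJ : Represents J I) (h : Regular J n q t m)
    (γ δ : MIdx D) :
    HolAt (fun s => gaussS (genMoment J n q s m) γ δ) t :=
  holAt_gaussS (fun γ δ => (waveAt_genMoment hJ h.1 δ).hol γ) γ δ (h.2 _)

lemma kp_genMoment (hJ : Represents J I) (h : Regular J n q t m)
    (k : ℕ) (a b c d : SDir D) :
    KPEquation dT k (fun s => block (k + 1) k (gaussS (genMoment J n q s m))) a b c d t :=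
  (momentFamily_genMoment hJ (finOpen_regularSet hJ (k + 1) m) subset_rfl).kp le_rfl
    (h.mem _) a b c d

lemma diffDiff_genMoment (hJ : Represents J I) (h : Regular J n q t m)
    {a c : SDir D} (ha : Regular J n q t (m + Pi.single a 1))
    (hc : Regular J n q t (m + Pi.single c 1))
    (hac : Regular J n q t (m + Pi.single a 1 + Pi.single c 1)) (k : ℕ) :
    DiffDiffEquation dT n q k (fun s m => block (k + 1) k (gaussS (genMoment J n q s m)))
      a c t m := by
  have hcomm : m + Pi.single a 1 + Pi.single c 1 = m + Pi.single c 1 + Pi.single a 1 :=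
    add_right_comm _ _ _
  -- The systems get differentiated in the times, so all four lattice points must be regular on one
  -- finitely open set containing `t`.
  set R := fun m => regularSet J n q (k + 1) m with hR
  set O := R m ∩ R (m + Pi.single a 1) ∩ (R (m + Pi.single c 1) ∩
    R (m + Pi.single a 1 + Pi.single c 1)) with hO
  have fo : ∀ m, FinOpen (R m) := fun m => finOpen_regularSet hJ (k + 1) m
  have hfo : FinOpen O := ((fo _).inter (fo _)).inter ((fo _).inter (fo _))
  have i0 : O ⊆ R m := fun s hs => hs.1.1
  have ia : O ⊆ R (m + Pi.single a 1) := fun s hs => hs.1.2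
  have ic : O ⊆ R (m + Pi.single c 1) := fun s hs => hs.2.1
  have iac : O ⊆ R (m + Pi.single a 1 + Pi.single c 1) := fun s hs => hs.2.2
  refine diffDiff (O := O) (K := k + 1) (G := fun s m => genMoment J n q s m)
    (momentFamily_genMoment hJ hfo i0) (momentFamily_genMoment hJ hfo ia)
    (momentFamily_genMoment hJ hfo ic) (momentFamily_genMoment hJ hfo iac)
    (fun s hs δ => isShift_genMoment hJ (i0 hs).1 (ia hs).1 δ)
    (fun s hs δ => isShift_genMoment hJ (i0 hs).1 (ic hs).1 δ)
    (fun s hs δ => isShift_genMoment hJ (ia hs).1 (iac hs).1 δ)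
    (fun s hs δ => ?_) le_rfl ⟨⟨h.mem _, ha.mem _⟩, hc.mem _, hac.mem _⟩
  rw [hcomm]
  exact isShift_genMoment hJ (ic hs).1 (hcomm ▸ (iac hs).1) δ

/-- The Baker functions attached to a family of waves. -/
lemma systems_genMoment (hJ : Represents J I) (h : Regular J n q t m)
    {k K : ℕ} (hK : k ≤ K) {O : Set (Times D)} (hO : FinOpen O) (htO : t ∈ O)
    {Φ : Times D → Disc D → MIdx D → ℂ}
    (hΦ : ∀ s ∈ O ∩ regularSet J n q K m, WaveAt (fun s => Φ s m) s)
    {Ψ : Times D → Disc D → Level D k → ℂ}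
    (hΨ : ∀ m, ∀ s ∈ regularSet J n q K m,
      pairing (blockRow k (gaussS (genMoment J n q s m))) (Φ s m) = Ψ s m)
    (hs : ∀ a, Regular J n q t (m + Pi.single a 1) →
      IsShift (n a) (q a) (Φ t m) (Φ t (m + Pi.single a 1))) :
    (∀ γ, HolAt (fun s => Ψ s m γ) t) ∧
    SchrodingerSystem dT (fun s => gaussS (genMoment J n q s m)) k (fun s => Ψ s m) t ∧
    ∀ a, Regular J n q t (m + Pi.single a 1) →
      DifferenceSystem dT n q (fun s m => gaussS (genMoment J n q s m)) k Ψ a t m := by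
  have fo := finOpen_regularSet (n := n) (q := q) hJ K m
  have hfo := hO.inter fo
  have hf := momentFamily_genMoment hJ hfo Set.inter_subset_right
  have ht : t ∈ O ∩ regularSet J n q K m := ⟨htO, h.mem K⟩
  have hB : ∀ s, Banded (blockRow k (gaussS (genMoment J n q s m))) (k + 1) :=
    fun s => banded_blockRow (gaussS_lower _) k
  refine ⟨fun γ => ?_, ?_, fun a ha => ?_⟩
  · exact HolAt.congr hfo (fun s hs => congrFun (hΨ m s hs.2) γ) ht
      (holAt_pairing hB (hf.mHolAt hK ht) (hΦ t ht).hol γ)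
  · exact SchrodingerSystem.congr hfo (fun s hs => hΨ m s hs.2) ht (hf.schrodinger hK hΦ ht)
  · have hfo' := hfo.inter (finOpen_regularSet (n := n) (q := q) hJ K (m + Pi.single a 1))
    have ht' : t ∈ O ∩ regularSet J n q K m ∩ regularSet J n q K (m + Pi.single a 1) :=
      ⟨ht, ha.mem K⟩
    refine DifferenceSystem.congr
      (Ψ := fun s m => pairing (blockRow k (gaussS (genMoment J n q s m))) (Φ s m)) hfo ht (fun s hs => hΨ m s hs.2) (hΨ _ t (ha.mem K)) ?_
    exact differenceSystem (G := fun s m => genMoment J n q s m)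
      (momentFamily_genMoment hJ hfo' fun s hs => hs.1.2)
      (momentFamily_genMoment hJ hfo' fun s hs => hs.2)
      (fun s hs δ => isShift_genMoment hJ hs.1.2.1 hs.2.1 δ) hK (fun s hs => hΦ s hs.1) ht'
      (hs a ha)

/-- The Baker function `v S χ(z)`. -/
lemma systems_lop (hJ : Represents J I) (h : Regular J n q t m)
    {z : Fin D → ℂ} (hz : ∀ i, z i ≠ 0) (hv : VacuumDefined n q t m z) (k : ℕ)
    {Ψ : Times D → Disc D → Level D k → ℂ}
    (hΨ : ∀ s m γ, Ψ s m γ = vacuum n q s m z * lop (gaussS (genMoment J n q s m)) z γ) :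
    (∀ γ, HolAt (fun s => Ψ s m γ) t) ∧
    SchrodingerSystem dT (fun s => gaussS (genMoment J n q s m)) k (fun s => Ψ s m) t ∧
    ∀ a, Regular J n q t (m + Pi.single a 1) →
      DifferenceSystem dT n q (fun s m => gaussS (genMoment J n q s m)) k Ψ a t m :=
  systems_genMoment hJ h le_rfl (finOpen_vacuumDefined m z) hv
    (Φ := fun s m ε => vacuum n q s m z * mono z ε) (fun _ hs => waveAt_vacuum hz hs.1)
    (fun m s _ => funext fun γ => by rw [pairing_eq_lop _ (gaussS_lower _), hΨ])
    fun a _ => isShift_vacuum hz hv a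

/-- The coefficients of the Baker function `H (Ŝ⁻¹)† χ(z)`. -/
lemma systems_waveTwo (hJ : Represents J I) (h : Regular J n q t m)
    (δ : MIdx D) (k : ℕ) {Ψ : Times D → Disc D → Level D k → ℂ}
    (hΨ : ∀ s m (γ : Level D k), Ψ s m γ =
      waveTwo (gaussH (genMoment J n q s m)) (gaussSh (genMoment J n q s m)) γ δ) :
    (∀ γ, HolAt (fun s => Ψ s m γ) t) ∧
    SchrodingerSystem dT (fun s => gaussS (genMoment J n q s m)) k (fun s => Ψ s m) t ∧
    ∀ a, Regular J n q t (m + Pi.single a 1) →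
      DifferenceSystem dT n q (fun s m => gaussS (genMoment J n q s m)) k Ψ a t m :=
  -- The bound `k + |δ| + 1` is the size of the truncation in the definition of `waveTwo`.
  systems_genMoment hJ h (K := k + longitude δ + 1) (by omega)
    (finOpen_regularSet hJ (k + longitude δ + 1) m) (h.mem _)
    (Φ := fun s m ε => genMoment J n q s m ε δ) (fun _ hs => waveAt_genMoment hJ hs.2.1 δ)
    (fun m s hs => funext fun γ => by
      rw [hΨ, waveTwo_eq_pairing γ δ fun j hj => det_ne_of_mem_regularSet hs hj])
    fun a ha => isShift_genMoment hJ h.1 ha.1 δ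

end Functional

/-! ### Conjugation of the times -/

/-- The expansion has the conjugated coefficients of that of `g`: each term conjugated on the inside
and outside is again complex multilinear, with no larger norm. -/
lemma analyticAt_conj_conj {N : ℕ} {g : (Fin N → ℂ) → ℂ} (hg : AnalyticAt ℂ g 0) :
    AnalyticAt ℂ (fun r => conj (g (star r))) 0 := by
  obtain ⟨p, ρ, hp⟩ := hg
  let p' : FormalMultilinearSeries ℂ (Fin N → ℂ) ℂ := fun n =>
    MultilinearMap.mkContinuous
      { toFun := fun x => conj (p n fun i => star (x i))
        map_update_add' := fun x i a b => by
          have e : ∀ c : Fin N → ℂ, (fun j => star (Function.update x i c j)) =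
              Function.update (fun j => star (x j)) i (star c) := fun c =>
            (Function.comp_update (star : (Fin N → ℂ) → Fin N → ℂ) x i c)
          simp only [e, star_add, ContinuousMultilinearMap.map_update_add, map_add]
        map_update_smul' := fun x i c a => by
          have e : ∀ c : Fin N → ℂ, (fun j => star (Function.update x i c j)) =
              Function.update (fun j => star (x j)) i (star c) := fun c =>
            (Function.comp_update (star : (Fin N → ℂ) → Fin N → ℂ) x i c)
          simp only [e, star_smul, ContinuousMultilinearMap.map_update_smul, smul_eq_mul, map_mul]
          simp }
      ‖p n‖ fun x => by
        show ‖conj (p n fun i => star (x i))‖ ≤ _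
        rw [RCLike.norm_conj]
        refine ((p n).le_opNorm _).trans_eq ?_
        simp only [norm_star]
  have hnorm : ∀ n, ‖p' n‖ ≤ ‖p n‖ := fun n =>
    MultilinearMap.mkContinuous_norm_le _ (norm_nonneg _) _
  refine ⟨p', ρ, ?_, hp.r_pos, ?_⟩
  · exact hp.r_le.trans (FormalMultilinearSeries.radius_le_of_le fun n => hnorm n)
  · intro y hy
    have hy' : star y ∈ Metric.eball (0 : Fin N → ℂ) ρ := by
      rw [mem_eball_zero_iff] at hy ⊢
      rwa [enorm_eq_iff_norm_eq.mpr (norm_star y)]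
    have := Complex.hasSum_conj'.mpr (hp.hasSum hy')
    rw [zero_add] at this ⊢
    exact this

lemma tHat_slice (t : Times D) {N : ℕ} (v : Fin N → MIdx D) (r : Fin N → ℂ) :
    tHat (t + slice v r) = tHat t + slice (fun j => -v j) (star r) := by
  funext α
  simp only [tHat, slice, Pi.add_apply, Finset.sum_apply, map_add, map_sum]
  congr 1
  refine Finset.sum_congr rfl fun j _ => ?_
  by_cases h : α = -v j
  · subst h; simp
  · have h' : -α ≠ v j := fun e => h (by rw [← e, neg_neg])
    simp [Pi.single_eq_of_ne h, Pi.single_eq_of_ne h']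

lemma tHat_single (t : Times D) (α : MIdx D) (x : ℂ) :
    tHat (t + Pi.single (-α) x) = tHat t + Pi.single α (conj x) := by
  have := tHat_slice t (fun _ : Fin 1 => -α) fun _ => x
  simpa [slice] using this

lemma antiHolAt_tHat {F : Times D → ℂ} {t : Times D} (h : HolAt F (tHat t)) :
    AntiHolAt (fun s => F (tHat s)) t := by
  intro N v
  show AnalyticAt ℂ (fun r => conj (F (tHat (t + slice v r)))) 0
  simp only [tHat_slice]
  exact analyticAt_conj_conj (h N fun j => -v j)

/-- Conjugating the time fixes the real direction and reverses the imaginary one. No regularity is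
needed, since the derivative of a reflected function is minus the derivative even where it takes its
default value. -/
lemma dTbarNeg_tHat (α : MIdx D) (F : Times D → ℂ) (t : Times D) :
    dTbarNeg α (fun s => F (tHat s)) t = dT α F (tHat t) := by
  rw [dTbarNeg, dTbar, dT]
  simp only [tHat_single, map_mul, Complex.conj_ofReal, Complex.conj_I]
  have : deriv (fun y : ℝ => F (tHat t + Pi.single α (y * -Complex.I))) 0 =
      -deriv (fun y : ℝ => F (tHat t + Pi.single α (y * Complex.I))) 0 := by
    have := deriv_comp_neg (fun y : ℝ => F (tHat t + Pi.single α (y * Complex.I))) 0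
    rw [neg_zero] at this
    rw [← this]
    congr 1
    funext y
    push_cast
    rw [neg_mul, mul_neg]
  rw [this]
  ring

lemma dTbarNeg_comp_tHat (α : MIdx D) (F : Times D → ℂ) :
    dTbarNeg α (fun s => F (tHat s)) = fun s => dT α F (tHat s) :=
  funext fun t => dTbarNeg_tHat α F t

lemma mderiv_comp_tHat {ι κ : Type} (α : MIdx D) (F : Times D → Matrix ι κ ℂ) :
    mderiv dTbarNeg α (fun s => F (tHat s)) = fun s => mderiv dT α F (tHat s) :=
  funext fun t => by ext i j; exact dTbarNeg_tHat α (fun s => F s i j) t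

lemma KPEquation.tHat {k : ℕ} {β : Times D → Matrix (Level D (k + 1)) (Level D k) ℂ}
    {a b c d : SDir D} {t : Times D} (h : KPEquation dT k β a b c d (tHat t)) :
    KPEquation dTbarNeg k (fun s => β (TorusKP.tHat s)) a b c d t := by
  obtain ⟨Z, hZ⟩ : ∃ Z : SDir D → SDir D → Times D →
      Matrix (Level D (k + 1)) (Level D (k + 1)) ℂ, Z = fun a b s =>
        mderiv dT (unitVec a) β s * up k b + mderiv dT (unitVec b) β s * up k a := ⟨_, rfl⟩
  have eZ : ∀ a b : SDir D, (fun s : Times D =>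
      (mderiv dTbarNeg (unitVec a) (fun s => β (TorusKP.tHat s)) s * up k b +
        mderiv dTbarNeg (unitVec b) (fun s => β (TorusKP.tHat s)) s * up k a :
        Matrix (Level D (k + 1)) (Level D (k + 1)) ℂ)) = fun s => Z a b (TorusKP.tHat s) := by
    intro a b
    simp only [mderiv_comp_tHat, hZ]
  have e2 : ∀ (α α' : MIdx D) {ι κ : Type} (F : Times D → Matrix ι κ ℂ),
      mderiv dTbarNeg α (mderiv dTbarNeg α' (fun s => F (TorusKP.tHat s))) t =
        mderiv dT α (mderiv dT α' F) (TorusKP.tHat t) := by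
    intro α α' ι κ F
    rw [mderiv_comp_tHat, mderiv_comp_tHat]
  have e1 : ∀ (α : MIdx D) {ι κ : Type} (F : Times D → Matrix ι κ ℂ),
      mderiv dTbarNeg α (fun s => F (TorusKP.tHat s)) t = mderiv dT α F (TorusKP.tHat t) := by
    intro α ι κ F
    rw [mderiv_comp_tHat]
  unfold KPEquation
  intro X Y
  have hX : X = _ := eZ a b
  have hY : Y = _ := eZ c d
  rw [hX, hY, e1 _ (Z c d), e1 _ (Z a b), e2 _ _ (Z c d), e2 _ _ (Z a b), e2 _ _ β, e2 _ _ β,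
    e2 _ _ β, e2 _ _ β, hZ]
  exact h

lemma DiffDiffEquation.tHat {n : SDir D → SDir D → ℂ} {q : SDir D → ℂ} {k : ℕ}
    {β : Times D → Disc D → Matrix (Level D (k + 1)) (Level D k) ℂ} {a c : SDir D}
    {t : Times D} {m : Disc D} (h : DiffDiffEquation dT n q k β a c (tHat t) m) :
    DiffDiffEquation dTbarNeg n q k (fun s => β (TorusKP.tHat s)) a c t m := by
  unfold DiffDiffEquation at h ⊢
  have e : ∀ (α : MIdx D) (m : Disc D), mderiv dTbarNeg α (fun s => β (TorusKP.tHat s) m) t =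
      mderiv dT α (fun s => β s m) (TorusKP.tHat t) := fun α m => by
    rw [mderiv_comp_tHat α fun s => β s m]
  simp only [e]
  exact h

lemma potential_comp_tHat (S : Times D → BMat D) (a b : SDir D) (t : Times D) (k : ℕ) :
    potential dTbarNeg (fun s => S (tHat s)) a b t k = potential dT S a b (tHat t) k := by
  cases k with
  | zero => rfl
  | succ k =>
    simp only [potential]
    rw [mderiv_comp_tHat (unitVec a) fun s => block (k + 1) k (S s),
      mderiv_comp_tHat (unitVec b) fun s => block (k + 1) k (S s)]

lemma SchrodingerSystem.tHat {S : Times D → BMat D} {k : ℕ} {Ψ : Times D → Level D k → ℂ}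
    {t : Times D} (h : SchrodingerSystem dT S k Ψ (tHat t)) :
    SchrodingerSystem dTbarNeg (fun s => S (TorusKP.tHat s)) k (fun s => Ψ (TorusKP.tHat s)) t := by
  intro a b γ
  have := h a b γ
  have e1 : ∀ α, dTbarNeg α (fun s => Ψ (TorusKP.tHat s) γ) =
      fun s => dT α (fun s => Ψ s γ) (TorusKP.tHat s) := fun α =>
    dTbarNeg_comp_tHat α fun s => Ψ s γ
  simp only [potential_comp_tHat, e1, dTbarNeg_comp_tHat]
  exact this

lemma DifferenceSystem.tHat {n : SDir D → SDir D → ℂ} {q : SDir D → ℂ}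
    {S : Times D → Disc D → BMat D} {k : ℕ} {Ψ : Times D → Disc D → Level D k → ℂ} {a : SDir D}
    {t : Times D} {m : Disc D} (h : DifferenceSystem dT n q S k Ψ a (tHat t) m) :
    DifferenceSystem dTbarNeg n q (fun s => S (TorusKP.tHat s)) k
      (fun s => Ψ (TorusKP.tHat s)) a t m := by
  intro γ
  have e : ∀ b : SDir D, dTbarNeg (unitVec b) (fun s => Ψ (TorusKP.tHat s) m γ) t =
      dT (unitVec b) (fun s => Ψ s m γ) (TorusKP.tHat t) := fun b =>
    dTbarNeg_tHat _ (fun s => Ψ s m γ) t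
  simp only [e]
  exact h γ

/-! ### The conjugate functional -/

/-- The functional `f ↦ conj (J (conj f))`. -/
def conjFunctional (J : (UnitTorus D → ℂ) → ℂ) (f : UnitTorus D → ℂ) : ℂ :=
  conj (J fun z => conj (f z))

/-- The two conjugations cancel on scalars and preserve norms, so the conjugate of a bounded linear
functional is again one. -/
lemma Represents.conjFunctional {J : (UnitTorus D → ℂ) → ℂ} {I : C(UnitTorus D, ℂ) →L[ℂ] ℂ}
    (hJ : Represents J I) : ∃ I' : C(UnitTorus D, ℂ) →L[ℂ] ℂ,
      Represents (TorusKP.conjFunctional J) I' :=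
  ⟨LinearMap.mkContinuous
    { toFun := fun f => conj (I (star f))
      map_add' := fun f g => by simp
      map_smul' := fun c f => by simp [star_smul] } ‖I‖ fun f => by
      show ‖conj (I (star f))‖ ≤ _
      rw [RCLike.norm_conj, ← norm_star f]
      exact I.le_opNorm _,
    fun f => congrArg conj (hJ (star f))⟩

/-- On the unit circle conjugation is inversion. The identities for hatted data below rest on this,
and are stated on the torus only. -/
lemma conj_mono (z : UnitTorus D) (α : MIdx D) : conj (mono z.1 α) = mono z.1 (-α) := by
  rw [mono, mono, map_prod]
  refine Finset.prod_congr rfl fun i _ => ?_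
  rw [map_zpow₀, ← Complex.inv_eq_conj (z.2 i), Pi.neg_apply, _root_.inv_zpow,
    _root_.zpow_neg]

lemma unitVec_neg (b : SDir D) : unitVec (b.1, -b.2) = -unitVec b := by
  rw [unitVec, unitVec, ← Pi.single_neg]
  simp

lemma laurent_nHat (n : SDir D → SDir D → ℂ) (a : SDir D) (z : UnitTorus D) :
    laurent (nHat n a) z.1 = conj (laurent (n a) z.1) := by
  rw [laurent, laurent, map_sum]
  refine Fintype.sum_equiv ((Equiv.refl _).prodCongr (Equiv.neg ℤˣ)) _ _ fun b => ?_
  simp only [nHat, map_mul, conj_mono]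
  congr 2
  show unitVec b = -unitVec (b.1, -b.2)
  rw [unitVec_neg, neg_neg]

lemma tHat_mul_mono (t : Times D) (α : MIdx D) (z : UnitTorus D) :
    tHat t α * mono z.1 α = conj (t (-α) * mono z.1 (-α)) := by
  rw [map_mul, conj_mono, neg_neg, tHat]

lemma vacuum_hat (n : SDir D → SDir D → ℂ) (q : SDir D → ℂ) (t : Times D) (m : Disc D)
    (z : UnitTorus D) :
    vacuum (nHat n) (qHat q) (tHat t) m z.1 = conj (vacuum n q t m z.1) := by
  rw [vacuum, vacuum, map_mul, ← Complex.exp_conj, map_prod, Complex.conj_tsum]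
  congr 1
  · congr 1
    simp only [tHat_mul_mono]
    exact (Equiv.neg (MIdx D)).tsum_eq fun α => conj (t α * mono z.1 α)
  · refine Finset.prod_congr rfl fun a _ => ?_
    rw [laurent_nHat, map_zpow₀, map_sub, qHat]

lemma VacuumDefined.hat {n : SDir D → SDir D → ℂ} {q : SDir D → ℂ} {t : Times D} {m : Disc D}
    {z : UnitTorus D} (h : VacuumDefined n q t m z.1) :
    VacuumDefined (nHat n) (qHat q) (tHat t) m z.1 where
  summable := by
    simp only [tHat_mul_mono, RCLike.norm_conj]
    exact (Equiv.neg (MIdx D)).summable_iff.mpr h.summable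
  ne_zero a ha := by
    rw [laurent_nHat, qHat]
    exact fun e => h.ne_zero a ha ((starRingEnd ℂ).injective e)

/-- This reduces the hatted statements to the unhatted ones: conjugating the integrand on the torus
replaces the data by their hats and exchanges `γ` and `δ`. -/
lemma conjTranspose_genMoment (J : (UnitTorus D → ℂ) → ℂ) (n : SDir D → SDir D → ℂ)
    (q : SDir D → ℂ) (t : Times D) (m : Disc D) :
    (genMoment J n q t m)ᴴ =
      genMoment (conjFunctional J) (nHat n) (qHat q) (tHat t) m := by
  ext γ δ
  show conj (J _) = conj (J _)
  congr 2
  funext z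
  rw [map_mul, vacuum_hat, Complex.conj_conj, conj_mono, neg_sub]

lemma Regular.hat {J : (UnitTorus D → ℂ) → ℂ} {n : SDir D → SDir D → ℂ} {q : SDir D → ℂ}
    {t : Times D} {m : Disc D} (h : Regular J n q t m) :
    Regular (conjFunctional J) (nHat n) (qHat q) (tHat t) m :=
  ⟨fun z => (h.1 z).hat, by rw [← conjTranspose_genMoment]; exact h.2.conjTranspose⟩

lemma gaussH_conjTranspose (G : BMat D) : gaussH Gᴴ = (gaussH G)ᴴ := by
  ext γ δ
  rw [Matrix.conjTranspose_apply]
  by_cases h : longitude γ = longitude δ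
  · have e : ∀ k, (trunc k Gᴴ)⁻¹ = ((trunc k G)⁻¹)ᴴ := fun k => by
      rw [Matrix.conjTranspose_nonsing_inv]; rfl
    rw [gaussH, gaussH, if_pos h, if_pos h.symm, ← h, e, star_sub, star_sum, Finset.sum_comm]
    congr 1
    refine Finset.sum_congr rfl fun ε _ => ?_
    rw [star_sum]
    refine Finset.sum_congr rfl fun ε' _ => ?_
    simp only [Matrix.conjTranspose_apply, star_mul']
    ring
  · simp [gaussH, h, Ne.symm h]

/-! ### The Gauss–Borel factors of a complex measure -/

section Measure

variable (μ : ComplexMeasure (UnitTorus D)) (n : SDir D → SDir D → ℂ) (q : SDir D → ℂ)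

/-- Integration against `μ`, with junk value on the functions that are not integrable. -/
def measureFunctional (f : UnitTorus D → ℂ) : ℂ :=
  VectorMeasure.integral μ f (ContinuousLinearMap.mul ℝ ℂ)

lemma represents_measureFunctional : Represents (measureFunctional μ) (integralFunctional μ) :=
  fun _ => rfl

/-- The hermitian conjugate of the moment matrix, as a function of the conjugate times. -/
def hatMoment (t : Times D) (m : Disc D) : BMat D :=
  genMoment (conjFunctional (measureFunctional μ)) (nHat n) (qHat q) t m

lemma conjTranspose_moment (t : Times D) (m : Disc D) :
    (moment μ n q t m)ᴴ = hatMoment μ n q (tHat t) m :=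
  conjTranspose_genMoment _ _ _ _ _

lemma facSh_eq : facSh μ n q = fun s m => gaussS (hatMoment μ n q (tHat s) m) := by
  funext s m
  rw [facSh, gaussSh, conjTranspose_moment]

lemma betaHat_eq (k : ℕ) :
    betaHat μ n q k = fun s m => block (k + 1) k (gaussS (hatMoment μ n q (tHat s) m)) := by
  funext s m
  rw [betaHat, facSh_eq]

lemma Psi1Hat_eq (z : Fin D → ℂ) (k : ℕ) : Psi1Hat μ n q z k = fun s m (γ : Level D k) =>
    vacuum (nHat n) (qHat q) (tHat s) m z * lop (gaussS (hatMoment μ n q (tHat s) m)) z γ := by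
  funext s m γ
  rw [Psi1Hat, facSh_eq]

lemma Psi2_eq (δ : MIdx D) (k : ℕ) : Psi2 μ n q δ k = fun s m (γ : Level D k) =>
    waveTwo (gaussH (hatMoment μ n q (tHat s) m)) (gaussSh (hatMoment μ n q (tHat s) m)) γ δ := by
  funext s m γ
  rw [Psi2, ← conjTranspose_moment, gaussH_conjTranspose, gaussSh,
    Matrix.conjTranspose_conjTranspose]
  rfl

variable {μ n q}

lemma Admissible.regular {t : Times D} {m : Disc D} (h : Admissible μ n q t m) :
    Regular (measureFunctional μ) n q t m := by
  obtain ⟨hv, S, H, Sh, hG⟩ := h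
  exact ⟨hv, hG.quasiDefinite⟩

end Measure

end TorusKP

end

/-! ### The theorem for a complex measure. -/

theorem mainTheorem12 (D : ℕ) (μ : ComplexMeasure (UnitTorus D))
    (n : SDir D → SDir D → ℂ) (q : SDir D → ℂ) (t : Times D) (m : Disc D)
    (hadm : Admissible μ n q t m) :
    -- regularity of the coefficients, so that the derivatives below are genuine
    (∀ k γ δ, HolAt (fun s => beta μ n q k s m γ δ) t ∧
      AntiHolAt (fun s => betaHat μ n q k s m γ δ) t) ∧
    -- the onsite KP equations
    (∀ (k : ℕ) (a b c d : SDir D),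
      KPEquation dT k (fun s => beta μ n q k s m) a b c d t ∧
      KPEquation dTbarNeg k (fun s => betaHat μ n q k s m) a b c d t) ∧
    -- the differential-difference equations
    (∀ a c : SDir D, Admissible μ n q t (m + Pi.single a 1) →
      Admissible μ n q t (m + Pi.single c 1) →
      Admissible μ n q t (m + Pi.single a 1 + Pi.single c 1) → ∀ k : ℕ,
      DiffDiffEquation dT n q k (beta μ n q k) a c t m ∧
      DiffDiffEquation dTbarNeg (nHat n) (qHat q) k (betaHat μ n q k) a c t m) ∧
    -- the linear systems solved by the Baker functions
    (∀ z : Fin D → ℂ, (∀ i, z i ≠ 0) → VacuumDefined n q t m z → ∀ k : ℕ,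
      (∀ γ, HolAt (fun s => Psi1 μ n q z k s m γ) t) ∧
      SchrodingerSystem dT (fun s => facS μ n q s m) k (fun s => Psi1 μ n q z k s m) t ∧
      ∀ a : SDir D, Admissible μ n q t (m + Pi.single a 1) →
        DifferenceSystem dT n q (facS μ n q) k (Psi1 μ n q z k) a t m) ∧
    (∀ z : Fin D → ℂ, (∀ i, z i ≠ 0) → VacuumDefined (nHat n) (qHat q) (tHat t) m z → ∀ k : ℕ,
      (∀ γ, AntiHolAt (fun s => Psi1Hat μ n q z k s m γ) t) ∧
      SchrodingerSystem dTbarNeg (fun s => facSh μ n q s m) k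
        (fun s => Psi1Hat μ n q z k s m) t ∧
      ∀ a : SDir D, Admissible μ n q t (m + Pi.single a 1) →
        DifferenceSystem dTbarNeg (nHat n) (qHat q) (facSh μ n q) k
          (Psi1Hat μ n q z k) a t m) ∧
    (∀ (δ : MIdx D) (k : ℕ),
      (∀ γ, HolAt (fun s => Psi2Hat μ n q δ k s m γ) t) ∧
      SchrodingerSystem dT (fun s => facS μ n q s m) k (fun s => Psi2Hat μ n q δ k s m) t ∧
      ∀ a : SDir D, Admissible μ n q t (m + Pi.single a 1) →
        DifferenceSystem dT n q (facS μ n q) k (Psi2Hat μ n q δ k) a t m) ∧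
    (∀ (δ : MIdx D) (k : ℕ),
      (∀ γ, AntiHolAt (fun s => Psi2 μ n q δ k s m γ) t) ∧
      SchrodingerSystem dTbarNeg (fun s => facSh μ n q s m) k
        (fun s => Psi2 μ n q δ k s m) t ∧
      ∀ a : SDir D, Admissible μ n q t (m + Pi.single a 1) →
        DifferenceSystem dTbarNeg (nHat n) (qHat q) (facSh μ n q) k
          (Psi2 μ n q δ k) a t m) := by
  -- Each unhatted claim is the functional version for `μ` at `t`. Each hatted one is the same
  -- version for the conjugate functional at `tHat t`, pulled back along `tHat`.
  obtain ⟨J', hJ'⟩ := (represents_measureFunctional μ).conjFunctional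
  have hJ := represents_measureFunctional μ
  have hr := hadm.regular
  have hh := hr.hat
  refine ⟨fun k γ δ => ⟨holAt_gaussS_genMoment hJ hr γ.1 δ.1, ?_⟩, fun k a b c d =>
    ⟨kp_genMoment hJ hr k a b c d, ?_⟩, fun a c ha hc hac k =>
    ⟨diffDiff_genMoment hJ hr ha.regular hc.regular hac.regular k, ?_⟩, fun z hz hv k => ?_,
    fun z hz hv k => ?_, fun δ k => ?_, fun δ k => ?_⟩
  · rw [betaHat_eq]
    exact antiHolAt_tHat (F := fun s => gaussS (hatMoment μ n q s m) γ.1 δ.1)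
      (holAt_gaussS_genMoment hJ' hh γ.1 δ.1)
  · rw [betaHat_eq]
    exact (kp_genMoment hJ' hh k a b c d).tHat
  · rw [betaHat_eq]
    exact (diffDiff_genMoment hJ' hh ha.regular.hat hc.regular.hat hac.regular.hat k).tHat
  · obtain ⟨h1, h2, h3⟩ := systems_lop hJ hr hz hv k (Ψ := Psi1 μ n q z k) fun _ _ _ => rfl
    exact ⟨h1, h2, fun a ha => h3 a ha.regular⟩
  · obtain ⟨h1, h2, h3⟩ := systems_lop hJ' hh hz hv k (Ψ := fun s m (γ : Level D k) =>
      vacuum (nHat n) (qHat q) s m z * lop (gaussS (hatMoment μ n q s m)) z γ) fun _ _ _ => rfl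
    rw [Psi1Hat_eq, facSh_eq]
    exact ⟨fun γ => antiHolAt_tHat (h1 γ), h2.tHat, fun a ha => (h3 a ha.regular.hat).tHat⟩
  · obtain ⟨h1, h2, h3⟩ := systems_waveTwo hJ hr δ k (Ψ := Psi2Hat μ n q δ k) fun _ _ _ => rfl
    exact ⟨h1, h2, fun a ha => h3 a ha.regular⟩
  · obtain ⟨h1, h2, h3⟩ := systems_waveTwo hJ' hh δ k (Ψ := fun s m (γ : Level D k) =>
      waveTwo (gaussH (hatMoment μ n q s m)) (gaussSh (hatMoment μ n q s m)) γ δ)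
      fun _ _ _ => rfl
    rw [Psi2_eq, facSh_eq]
    exact ⟨fun γ => antiHolAt_tHat (h1 γ), h2.tHat, fun a ha => (h3 a ha.regular.hat).tHat⟩
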